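/- Let $X$ be a compact oriented Riemannian 3-manifold without boundary (metric $g$, volume form $\mathrm{vol}_X$), $G\subseteq U(N)$ a compact group with Lie algebra $\mathfrak g$, and $P\to X$ a smooth principal $G$-bundle. Extend complex conjugation $\overline{B+i\psi}=B-i\psi$ to $\mathfrak g_{\mathbb C}=\mathfrak g\oplus i\mathfrak g$. For a connection $D_A=d+A$ on $P$ and a 1-form $\phi$ with values in $P\times_G\mathfrak g$, let $$F_{\mathbb C}=F_A-\tfrac12[\phi\wedge\phi]+iD_A\phi ,\qquad \tfrac12[\phi\wedge\phi](u,w)=[\phi(u),\phi(w)],$$ be the curvature of the complex connection $D_A+i\phi$. Fix a base connection $A_0$ and let $$CS(D_A+i\phi)=\int_X \mathrm{tr}\Big(a\wedge F_{A_0}+\tfrac12\,a\wedge D_{A_0}a+\tfrac13\,a\wedge a\wedge a\Big),\qquad a=A+i\phi-A_0,$$ be the complex Chern–Simons functional, normalized so that its derivative in the direction $B+i\psi$ is $\int_X\mathrm{tr}(F_{\mathbb C}\wedge(B+i\psi))$ (on a trivial bundle with $A_0=0$ it is $\tfrac12\int_X\mathrm{tr}(\mathcal A\wedge d\mathcal A+\tfrac23\mathcal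 A\wedge\mathcal A\wedge\mathcal A)$, $\mathcal A=A+i\phi$). Gradients are taken on the space of pairs $(A,\phi)$ with respect to the $L^2$ inner product $\langle(B,\psi),(B',\psi')\rangle=-\int_X \mathrm{tr}(B\wedge *B'+\psi\wedge *\psi')$. Let $\theta\in\mathbb R$ and $f_\theta=\mathrm{Re}(e^{2i\theta}CS)$. Let $(A,\phi)$ be a smooth connection and a smooth adjoint-valued 1-form on the pullback of $P$ to $X\times\mathbb R$ (metric $g+dt^2$), in the gauge $A_t=0$ and with $\phi_t=0$; they amount to a smooth path $(A(t),\phi(t))$, $t\in\mathbb R$, of pairs on $X$. **Proposition.** Orient $X\times\mathbb R$ by $dt\wedge \mathrm{vol}_X$. The following are equivalent: 1. $(A(t),\phi(t))$ satisfies the (descending) gradient flow equation $\partial_t(A,\phi)=-\operatorname{grad} f_\theta(A,\phi)$ for all $t\in\mathbb R$; 2. $e^{i\theta}F_{\mathbb C}=*\,\overline{e^{i\theta}F_{\mathbb C}}$ on $X\times\mathbb R$; 3. $(A,\phi)$ satisfies the $\theta$-Kapustin–Witten equation (without the moment map condition $D_A*\phi=0$) $$\big(\cos\theta\,(F_A-\tfrac12[\phi\wedge\phi])-\sin\theta\,D_A\phi\big)^-=0,\qquad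 \big(\sin\theta\,(F_A-\tfrac12[\phi\wedge\phi])+\cos\theta\,D_A\phi\big)^+=0$$ on $X\times\mathbb R$, where $\eta^\pm=\tfrac12(\eta\pm*\eta)$. If $X\times\mathbb R$ is instead oriented by $\mathrm{vol}_X\wedge dt$, then 2 and 3 (with the corresponding $*$) are equivalent to each other and to the ascending gradient flow equation $\partial_t(A,\phi)=+\operatorname{grad} f_\theta(A,\phi)$ for all $t\in\mathbb R$. -/

import Mathlib

open scoped Manifold ContDiff Matrix Matrix.Norms.L2Operator
open Set

namespace KapustinWitten

/-- Complex `N × N` matrices. The structure group is a compact group `G ⊆ U(N)`; its Lie algebra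
`𝔤 ⊆ 𝔲(N)` and the complexification `𝔤_ℂ = 𝔤 ⊕ i𝔤` both sit inside this space. (Its norm is the operator norm, which induces the usual topology.) -/
abbrev Mat (N : ℕ) := Matrix (Fin N) (Fin N) ℂ

/-- The model space of a three-manifold. -/
abbrev E3 := EuclideanSpace ℝ (Fin 3)

/-- The model with corners of `X × ℝ`, for `X` a three-manifold. -/
noncomputable abbrev I4 := (𝓡 3).prod 𝓘(ℝ, ℝ)

/-- The Lie algebra of a (closed) group `G` of unitary matrices: velocities at the identity of
curves in `G`. -/
def lieAlg {N : ℕ} (G : Subgroup (Matrix.unitaryGroup (Fin N) ℂ)) : Set (Mat N) :=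
  {ξ | ∃ γ : ℝ → Matrix.unitaryGroup (Fin N) ℂ, (∀ s, γ s ∈ G) ∧ γ 0 = 1 ∧
    HasDerivAt (fun s => (γ s : Mat N)) ξ 0}

/-- Complex conjugation `B + iψ ↦ B - iψ` (`B, ψ ∈ 𝔤`) on `𝔤_ℂ`. As `𝔤` consists of
skew-Hermitian matrices, it is `Z ↦ -Zᴴ`. -/
noncomputable def conjLie {N : ℕ} (Z : Mat N) : Mat N := -Zᴴ

section Forms

variable {E H M : Type*} [NormedAddCommGroup E] [NormedSpace ℝ E] [TopologicalSpace H]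
  [TopologicalSpace M] [ChartedSpace H M]

/-- A matrix valued 1-form on a manifold `M` modelled on `E`. In Mathlib `TangentSpace I x` is, as
a vector space, `E`, the identification being the one given by the preferred chart at `x`. -/
abbrev OneForm (E M : Type*) [NormedAddCommGroup E] [NormedSpace ℝ E] (N : ℕ) :=
  M → E →L[ℝ] Mat N

/-- The expression of a 1-form in the preferred chart at `x₀`, i.e. its pullback under the inverse
of that chart. -/
noncomputable def inChart {N : ℕ} (I : ModelWithCorners ℝ E H) [I.Boundaryless] (x₀ : M)
    (α : OneForm E M N) : E → E →L[ℝ] Mat N := fun y =>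
  (α ((extChartAt I x₀).symm y)).comp
    (mfderiv 𝓘(ℝ, E) I (extChartAt I x₀).symm y : E →L[ℝ] E)

/-- Smoothness of a 1-form on an open set `U`: its expression in every chart is smooth. -/
def SmoothOn {N : ℕ} (I : ModelWithCorners ℝ E H) [I.Boundaryless] (U : Set M)
    (α : OneForm E M N) : Prop :=
  ∀ x₀ : M, ContDiffOn ℝ ∞ (inChart I x₀ α)
    ((extChartAt I x₀).target ∩ (extChartAt I x₀).symm ⁻¹' U)

/-- The exterior derivative `(dα)_x(u, w)` of a 1-form, computed in the chart at `x` (which induces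
the identification of the tangent space at `x` with `E`). -/
noncomputable def extD {N : ℕ} (I : ModelWithCorners ℝ E H) [I.Boundaryless]
    (α : OneForm E M N) (x : M) (u w : E) : Mat N :=
  fderiv ℝ (inChart I x α) (extChartAt I x x) u w -
    fderiv ℝ (inChart I x α) (extChartAt I x x) w u

/-- The differential `df`, a 1-form, of a matrix valued function `f` on `M`. -/
noncomputable def differential {N : ℕ} (I : ModelWithCorners ℝ E H) (f : M → Mat N) :
    OneForm E M N :=
  fun x => mfderiv I 𝓘(ℝ, Mat N) f x

/-- `α ∧ β + β ∧ α` for matrix valued 1-forms, that is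
`(u, w) ↦ [α(u), β(w)] - [α(w), β(u)]`. -/
noncomputable def wedgeBracket {N : ℕ} (α β : OneForm E M N) (x : M) (u w : E) : Mat N :=
  (α x u * β x w - β x w * α x u) - (α x w * β x u - β x u * α x w)

/-- The curvature `F = d𝒜 + 𝒜 ∧ 𝒜` of the connection `d + 𝒜`. -/
noncomputable def curvature {N : ℕ} (I : ModelWithCorners ℝ E H) [I.Boundaryless]
    (α : OneForm E M N) (x : M) (u w : E) : Mat N :=
  extD I α x u w + (α x u * α x w - α x w * α x u)

/-- The covariant exterior derivative `d_A α = dα + A ∧ α + α ∧ A`. -/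
noncomputable def covD {N : ℕ} (I : ModelWithCorners ℝ E H) [I.Boundaryless]
    (A α : OneForm E M N) (x : M) (u w : E) : Mat N :=
  extD I α x u w + wedgeBracket A α x u w

/-- The connection form `A + iφ` of the complex connection `D_A + iφ`. -/
noncomputable def complexForm {N : ℕ} (A φ : OneForm E M N) : OneForm E M N :=
  fun x => A x + Complex.I • φ x

/-- A smooth principal `G`-bundle over `M`, presented by a trivializing open cover
`(baseSet i)` and smooth transition functions satisfying the cocycle condition. -/
structure GaugeBundle {N : ℕ} (I : ModelWithCorners ℝ E H) (M : Type*) [TopologicalSpace M]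
    [ChartedSpace H M] (G : Subgroup (Matrix.unitaryGroup (Fin N) ℂ)) (ι : Type*) where
  baseSet : ι → Set M
  isOpen_baseSet : ∀ i, IsOpen (baseSet i)
  /-- for each point, the label of one trivialization that is defined there -/
  indexAt : M → ι
  mem_baseSet_at : ∀ x, x ∈ baseSet (indexAt x)
  trans : ι → ι → M → Matrix.unitaryGroup (Fin N) ℂ
  trans_mem : ∀ i j, ∀ x ∈ baseSet i ∩ baseSet j, trans i j x ∈ G
  trans_smooth : ∀ i j, ContMDiffOn I 𝓘(ℝ, Mat N) ∞ (fun x => (trans i j x : Mat N))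
    (baseSet i ∩ baseSet j)
  trans_comp : ∀ i j k, ∀ x ∈ baseSet i ∩ baseSet j ∩ baseSet k,
    trans i j x * trans j k x = trans i k x

namespace GaugeBundle

variable {N : ℕ} {I : ModelWithCorners ℝ E H} {G : Subgroup (Matrix.unitaryGroup (Fin N) ℂ)}
  {ι : Type*}

/-- `A` is a smooth `G`-connection on `P`: in the trivialization `i` the covariant derivative is
`d + A i`, with `A i` a smooth `𝔤`-valued 1-form on `baseSet i`, and
`A i = g (A j) g⁻¹ - dg g⁻¹` on overlaps, where `g = trans i j`. Values of `A i` outside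
`baseSet i` carry no information. -/
structure IsConnection [I.Boundaryless] (P : GaugeBundle I M G ι) (A : ι → OneForm E M N) :
    Prop where
  smooth : ∀ i, SmoothOn I (P.baseSet i) (A i)
  mem : ∀ i, ∀ x ∈ P.baseSet i, ∀ v, A i x v ∈ lieAlg G
  change : ∀ i j, ∀ x ∈ P.baseSet i ∩ P.baseSet j, ∀ v : E,
    A i x v = (P.trans i j x : Mat N) * A j x v * ((P.trans i j x)⁻¹ : Matrix.unitaryGroup _ ℂ) -
      differential I (fun z => (P.trans i j z : Mat N)) x v *
        ((P.trans i j x)⁻¹ : Matrix.unitaryGroup _ ℂ)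

/-- `φ` is a smooth 1-form with values in the adjoint bundle `P ×_G 𝔤`. -/
structure IsAdForm [I.Boundaryless] (P : GaugeBundle I M G ι) (φ : ι → OneForm E M N) :
    Prop where
  smooth : ∀ i, SmoothOn I (P.baseSet i) (φ i)
  mem : ∀ i, ∀ x ∈ P.baseSet i, ∀ v, φ i x v ∈ lieAlg G
  change : ∀ i j, ∀ x ∈ P.baseSet i ∩ P.baseSet j, ∀ v : E,
    φ i x v = (P.trans i j x : Mat N) * φ j x v * ((P.trans i j x)⁻¹ : Matrix.unitaryGroup _ ℂ)

/-- The pullback of `P` to the cylinder `M × ℝ`. -/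
def cylinder (P : GaugeBundle I M G ι) : GaugeBundle (I.prod 𝓘(ℝ, ℝ)) (M × ℝ) G ι where
  baseSet i := Prod.fst ⁻¹' P.baseSet i
  isOpen_baseSet i := (P.isOpen_baseSet i).preimage continuous_fst
  indexAt p := P.indexAt p.1
  mem_baseSet_at p := P.mem_baseSet_at p.1
  trans i j p := P.trans i j p.1
  trans_mem i j p hp := P.trans_mem i j p.1 hp
  trans_smooth i j := (P.trans_smooth i j).comp contMDiff_fst.contMDiffOn (fun _ hp => hp)
  trans_comp i j k p hp := P.trans_comp i j k p.1 hp

end GaugeBundle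

end Forms

section ThreeManifold

variable {X : Type*} [TopologicalSpace X] [ChartedSpace E3 X]

/-- The standard basis vectors of `E3`. Seen in `TangentSpace (𝓡 3) x`, they are the coordinate
vectors of the chart at `x`. -/
noncomputable def e3 (k : Fin 3) : E3 := EuclideanSpace.single k 1

/-- The coefficient `η(∂₀, ∂₁, ∂₂)` of a 3-form `η` in the preferred chart at `p`. -/
noncomputable def coeff {F : Type*} (p : X) (η : X → (Fin 3 → E3) → F) (y : E3) : F :=
  η ((extChartAt (𝓡 3) p).symm y)
    (fun k => (mfderiv 𝓘(ℝ, E3) (𝓡 3) (extChartAt (𝓡 3) p).symm y : E3 →L[ℝ] E3) (e3 k))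

/-- A smooth Riemannian metric and an orientation on a three-manifold. The orientation is given by
the Riemannian volume form `vol`: the smooth 3-form with `vol(v₀, v₁, v₂)² = det(⟨vᵢ, vⱼ⟩)`, i.e.
with value `±1` on orthonormal frames, and `1` on the oriented ones. -/
structure OrientedMetric (X : Type*) [TopologicalSpace X] [ChartedSpace E3 X]
    [IsManifold (𝓡 3) ∞ X] where
  metric : Bundle.ContMDiffRiemannianMetric (𝓡 3) ∞ E3 (fun x : X => TangentSpace (𝓡 3) x)
  vol : X → E3 [⋀^Fin 3]→ₗ[ℝ] ℝ
  vol_smooth : ∀ p : X, ContDiffOn ℝ ∞ (coeff p (fun x v => vol x v)) (extChartAt (𝓡 3) p).target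
  vol_sq : ∀ x (v : Fin 3 → E3),
    vol x v ^ 2 = (Matrix.of fun i j => (metric.inner x (v i) (v j) : ℝ)).det

variable [IsManifold (𝓡 3) ∞ X]

/-- The metric at `x` as a bilinear form on the tangent space. -/
noncomputable def OrientedMetric.form (g : OrientedMetric X) (x : X) (u w : E3) : ℝ :=
  g.metric.inner x u w

/-- A smooth partition of unity subordinate to the chart domains. -/
noncomputable def chartPartition (X : Type*) [TopologicalSpace X] [T2Space X] [CompactSpace X]
    [ChartedSpace E3 X] [IsManifold (𝓡 3) ∞ X] : SmoothPartitionOfUnity X (𝓡 3) X univ :=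
  (SmoothPartitionOfUnity.exists_isSubordinate_chartAt_source (𝓡 3) X).choose

/-- The integral `∫_X η` of a (continuous) 3-form over the compact oriented manifold `X`, by means
of a partition of unity; the sign is that of the orientation in the chart. The sum is finite. -/
noncomputable def integralForm {F : Type*} [NormedAddCommGroup F] [NormedSpace ℝ F]
    [T2Space X] [CompactSpace X] (g : OrientedMetric X) (η : X → (Fin 3 → E3) → F) : F :=
  ∑ᶠ p : X, ∫ y in (extChartAt (𝓡 3) p).target,
    (chartPartition X p ((extChartAt (𝓡 3) p).symm y) *
      Real.sign (coeff p (fun x v => g.vol x v) y)) • coeff p η y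

/-- The 3-form `tr(α ∧ η)` for a 1-form `α` and a 2-form `η` at a point. -/
noncomputable def trWedge {N : ℕ} (α : E3 → Mat N) (η : E3 → E3 → Mat N) (v : Fin 3 → E3) : ℂ :=
  (α (v 0) * η (v 1) (v 2)).trace + (α (v 1) * η (v 2) (v 0)).trace +
    (α (v 2) * η (v 0) (v 1)).trace

/-- The Chern–Simons 3-form of the connection `d + 𝒜` relative to the connection `d + A₀`, with
`a = 𝒜 - A₀`:
`tr(a ∧ F_{A₀}) + (1/2) tr(a ∧ d_{A₀} a) + (1/3) tr(a ∧ a ∧ a)`.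
For `A₀ = 0` it is `(1/2) tr(𝒜 ∧ d𝒜 + (2/3) 𝒜 ∧ 𝒜 ∧ 𝒜)`. -/
noncomputable def csForm {N : ℕ} (A₀ 𝒜 : OneForm E3 X N) (x : X) (v : Fin 3 → E3) : ℂ :=
  trWedge ((𝒜 - A₀) x) (curvature (𝓡 3) A₀ x) v +
    (1 / 2) * trWedge ((𝒜 - A₀) x) (covD (𝓡 3) A₀ (𝒜 - A₀) x) v +
    (1 / 3) * trWedge ((𝒜 - A₀) x)
      (fun u w => (𝒜 - A₀) x u * (𝒜 - A₀) x w - (𝒜 - A₀) x w * (𝒜 - A₀) x u) v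

variable {N : ℕ} {ι : Type*} {G : Subgroup (Matrix.unitaryGroup (Fin N) ℂ)}

/-- The complex Chern–Simons functional `CS(D_A + iφ)` on `X`, relative to the base connection
`A₀`, normalized so that its derivative in the direction `B + iψ` is
`∫_X tr(F_ℂ ∧ (B + iψ))`. The 3-form does not depend on the trivialization. -/
noncomputable def complexCS [T2Space X] [CompactSpace X] (g : OrientedMetric X)
    (P : GaugeBundle (𝓡 3) X G ι) (A₀ A φ : ι → OneForm E3 X N) : ℂ :=
  integralForm g fun x v =>
    csForm (A₀ (P.indexAt x)) (complexForm (A (P.indexAt x)) (φ (P.indexAt x))) x v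

/-- The pointwise inner product `⟨a, b⟩ = -∑ g^{ij} tr(a_i b_j)` of `𝔤`-valued 1-forms at `x`. -/
noncomputable def pointInner (g : OrientedMetric X) (x : X) (a b : E3 →L[ℝ] Mat N) : ℝ :=
  -∑ i, ∑ j, (Matrix.of fun k l => g.form x (e3 k) (e3 l))⁻¹ i j *
    (a (e3 i) * b (e3 j)).trace.re

/-- The `L²` inner product `∫_X (⟨B, B'⟩ + ⟨ψ, ψ'⟩) dμ` of the tangent vectors `B + iψ` and
`B' + iψ'` to the space of complex connections. -/
noncomputable def innerL2 [T2Space X] [CompactSpace X] (g : OrientedMetric X)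
    (P : GaugeBundle (𝓡 3) X G ι) (B ψ B' ψ' : ι → OneForm E3 X N) : ℝ :=
  integralForm g fun x v =>
    (pointInner g x (B (P.indexAt x) x) (B' (P.indexAt x) x) +
      pointInner g x (ψ (P.indexAt x) x) (ψ' (P.indexAt x) x)) * g.vol x v

/-- `(B, ψ)` is the `L²` gradient at `(A, φ)` of the functional `f` on pairs of a connection and
an adjoint valued 1-form. -/
def IsGradient [T2Space X] [CompactSpace X] (g : OrientedMetric X) (P : GaugeBundle (𝓡 3) X G ι)
    (f : (ι → OneForm E3 X N) → (ι → OneForm E3 X N) → ℝ) (A φ B ψ : ι → OneForm E3 X N) : Prop :=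
  ∀ B' ψ' : ι → OneForm E3 X N, P.IsAdForm B' → P.IsAdForm ψ' →
    HasDerivAt (fun s : ℝ => f (A + s • B') (φ + s • ψ')) (innerL2 g P B ψ B' ψ') 0

/-- The restriction to the slice `X × {t}` of a family of 1-forms on `X × ℝ`. -/
noncomputable def slice (A : ι → OneForm (E3 × ℝ) (X × ℝ) N) (t : ℝ) : ι → OneForm E3 X N :=
  fun i x => (A i (x, t)).comp (ContinuousLinearMap.inl ℝ E3 ℝ)

/-- The velocity `∂A/∂t` of the path of slices. -/
noncomputable def sliceDeriv (A : ι → OneForm (E3 × ℝ) (X × ℝ) N) (t : ℝ) :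
    ι → OneForm E3 X N :=
  fun i x => deriv (fun s => slice A s i x) t

/-- The functional `Re(e^{2iθ} CS)`. -/
noncomputable def realCS [T2Space X] [CompactSpace X] (g : OrientedMetric X)
    (P : GaugeBundle (𝓡 3) X G ι) (A₀ : ι → OneForm E3 X N) (θ : ℝ) (A φ : ι → OneForm E3 X N) :
    ℝ :=
  (Complex.exp (2 * Complex.I * θ) * complexCS g P A₀ A φ).re

/-- The ascending gradient flow `∂(A, φ)/∂t = grad f`. -/
def IsAscendingFlow [T2Space X] [CompactSpace X] (g : OrientedMetric X)
    (P : GaugeBundle (𝓡 3) X G ι) (f : (ι → OneForm E3 X N) → (ι → OneForm E3 X N) → ℝ)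
    (A φ : ι → OneForm (E3 × ℝ) (X × ℝ) N) : Prop :=
  ∀ t : ℝ, IsGradient g P f (slice A t) (slice φ t) (sliceDeriv A t) (sliceDeriv φ t)

/-- The descending gradient flow `∂(A, φ)/∂t = -grad f`. -/
def IsDescendingFlow [T2Space X] [CompactSpace X] (g : OrientedMetric X)
    (P : GaugeBundle (𝓡 3) X G ι) (f : (ι → OneForm E3 X N) → (ι → OneForm E3 X N) → ℝ)
    (A φ : ι → OneForm (E3 × ℝ) (X × ℝ) N) : Prop :=
  ∀ t : ℝ, IsGradient g P f (slice A t) (slice φ t) (-sliceDeriv A t) (-sliceDeriv φ t)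

/-- The coordinate basis of the tangent space of `X × ℝ`. -/
noncomputable def e4 : Fin 3 ⊕ Unit → E3 × ℝ := Sum.elim (fun k => (e3 k, 0)) (fun _ => (0, 1))

/-- The product metric `g + dt²` of `X × ℝ`. -/
noncomputable def OrientedMetric.form4 (g : OrientedMetric X) (x : X) (u w : E3 × ℝ) : ℝ :=
  g.form x u.1 w.1 + u.2 * w.2

/-- The volume form `dt ∧ vol_X` of `X × ℝ`. -/
noncomputable def volDtX (g : OrientedMetric X) (x : X) (u : Fin 4 → E3 × ℝ) : ℝ :=
  ∑ k : Fin 4, (-1) ^ (k : ℕ) * (u k).2 * g.vol x (fun j => (u (k.succAbove j)).1)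

/-- The volume form `vol_X ∧ dt` of `X × ℝ`. -/
noncomputable def volXDt (g : OrientedMetric X) (x : X) (u : Fin 4 → E3 × ℝ) : ℝ :=
  ∑ k : Fin 4, (-1) ^ (k.rev : ℕ) * (u k).2 * g.vol x (fun j => (u (k.succAbove j)).1)

/-- The Hodge star on 2-forms at a point of `X × ℝ` over `x`, for the product metric and the
orientation with volume form `vol₄`:
`(*η)(u, w) = (1/2) ∑ G^{aa'} G^{bb'} η(∂_a, ∂_b) vol₄(∂_{a'}, ∂_{b'}, u, w)`. -/
noncomputable def hodge (g : OrientedMetric X) (vol₄ : X → (Fin 4 → E3 × ℝ) → ℝ) (x : X)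
    (η : E3 × ℝ → E3 × ℝ → Mat N) (u w : E3 × ℝ) : Mat N :=
  let Ginv := (Matrix.of fun a b => g.form4 x (e4 a) (e4 b))⁻¹
  (1 / 2 : ℝ) • ∑ a, ∑ b, ∑ a', ∑ b',
    (Ginv a a' * Ginv b b' * vol₄ x ![e4 a', e4 b', u, w]) • η (e4 a) (e4 b)

/-- The self-dual part `(η + *η)/2` of a 2-form. -/
noncomputable def selfDualPart (g : OrientedMetric X) (vol₄ : X → (Fin 4 → E3 × ℝ) → ℝ) (x : X)
    (η : E3 × ℝ → E3 × ℝ → Mat N) (u w : E3 × ℝ) : Mat N :=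
  (1 / 2 : ℝ) • (η u w + hodge g vol₄ x η u w)

/-- The anti-self-dual part `(η - *η)/2` of a 2-form. -/
noncomputable def antiSelfDualPart (g : OrientedMetric X) (vol₄ : X → (Fin 4 → E3 × ℝ) → ℝ)
    (x : X) (η : E3 × ℝ → E3 × ℝ → Mat N) (u w : E3 × ℝ) : Mat N :=
  (1 / 2 : ℝ) • (η u w - hodge g vol₄ x η u w)

/-- The equation `e^{iθ} F_ℂ = * conj(e^{iθ} F_ℂ)` on `X × ℝ`, where `F_ℂ` is the curvature of
`D_A + iφ`. -/
def IsKW (g : OrientedMetric X) (P : GaugeBundle (𝓡 3) X G ι)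
    (vol₄ : X → (Fin 4 → E3 × ℝ) → ℝ) (θ : ℝ) (A φ : ι → OneForm (E3 × ℝ) (X × ℝ) N) : Prop :=
  ∀ i, ∀ x ∈ P.baseSet i, ∀ t : ℝ, ∀ u w : E3 × ℝ,
    let T : E3 × ℝ → E3 × ℝ → Mat N := fun u w =>
      Complex.exp (Complex.I * θ) • curvature I4 (complexForm (A i) (φ i)) (x, t) u w
    T u w = hodge g vol₄ x (fun u w => conjLie (T u w)) u w

/-- The `θ`-Kapustin–Witten system on `X × ℝ`, written with real forms:
`(cos θ (F_A - ½[φ ∧ φ]) - sin θ D_A φ)⁻ = 0` and `(sin θ (F_A - ½[φ ∧ φ]) + cos θ D_A φ)⁺ = 0`,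
where `½[φ ∧ φ](u, w) = [φ(u), φ(w)]`. -/
def IsKWSystem (g : OrientedMetric X) (P : GaugeBundle (𝓡 3) X G ι)
    (vol₄ : X → (Fin 4 → E3 × ℝ) → ℝ) (θ : ℝ) (A φ : ι → OneForm (E3 × ℝ) (X × ℝ) N) : Prop :=
  ∀ i, ∀ x ∈ P.baseSet i, ∀ t : ℝ, ∀ u w : E3 × ℝ,
    let R : E3 × ℝ → E3 × ℝ → Mat N := fun u w =>
      curvature I4 (A i) (x, t) u w - (φ i (x, t) u * φ i (x, t) w - φ i (x, t) w * φ i (x, t) u)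
    let Q : E3 × ℝ → E3 × ℝ → Mat N := covD I4 (A i) (φ i) (x, t)
    antiSelfDualPart g vol₄ x (fun u w => Real.cos θ • R u w - Real.sin θ • Q u w) u w = 0 ∧
      selfDualPart g vol₄ x (fun u w => Real.sin θ • R u w + Real.cos θ • Q u w) u w = 0

end ThreeManifold

end KapustinWitten

/-!
The proof computes the gradient of `Re (e^{2iθ} CS)` explicitly and compares it with the component
along `dt` of the two equations on the cylinder.

*The gradient.* Write `a = 𝒜 - A₀`. Along a line `𝒜 + s b` of connections the Chern–Simons form is
a cubic polynomial in `s` (`csForm_line`), whose linear coefficient is `tr (b ∧ F)` plus half of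
`tr (a ∧ d_{A₀} b) - tr (b ∧ d_{A₀} a)`. The latter is the exterior derivative of the globally
defined 2-form `tr (b ∧ a)` (`coeff_exact`), so it integrates to zero by Stokes' theorem
(`integralForm_eq_zero_of_exact`) and the first variation is `∫ tr (b ∧ F)` (`hasDerivAt_csForm`).
Let `R = F_A - ½[φ ∧ φ]` and `Q = D_A φ` be the components of the complex curvature `R + iQ`.
They are `𝔤`-valued and traces of products of skew-Hermitian matrices are real, so the first
variation of `Re (e^{2iθ} CS)` is the `L²` inner product with the pair
`⋆(sin 2θ Q - cos 2θ R)`, `⋆(sin 2θ R + cos 2θ Q)` (`innerL2_grad`). These are smooth sections of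
the adjoint bundle, and the inner product is definite, so this pair is the only gradient
(`isGradient_iff`).

*The cylinder.* Every 2-form on `X × ℝ` consists of its `dt`-component, a 1-form on the slices, and
of its restriction to the slices, and the four-dimensional Hodge star exchanges the two by means of
the three-dimensional one. As `⋆⋆ = 1`, an equation `η = ⋆ T η` with an involution `T` of the values
is equivalent to its `dt`-component (`eq_hodge_iff`). Since `A` and `φ` have no `dt`-component,
those of `R` and `Q` are the velocities `∂A/∂t` and `∂φ/∂t`, while the restrictions of `R` and `Q`
are the corresponding forms of the slices. It remains to solve for the velocities: in the complex
equation by multiplying with `e^{-iθ}` and separating `𝔤` from `i𝔤` (`exp_smul_eq_iff`), in the real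
system by a rotation through the angle `θ` (`rotation_eq_iff`). Both give the flow equation
`IsFlow`, with a sign `c` that is `1` for the orientation `dt ∧ vol_X` and `-1` for the opposite
one.
-/

namespace KapustinWitten

open Filter MeasureTheory
open scoped Topology

set_option linter.unusedSectionVars false

/-! ### The exterior derivative on a vector space -/

section Flat

variable {E F : Type*} [NormedAddCommGroup E] [NormedSpace ℝ E] [NormedAddCommGroup F]
  [NormedSpace ℝ F]

/-- The antisymmetrized derivative of a vector valued 1-form on a vector space, that is its
exterior derivative. -/
noncomputable def flatD (a : E → E →L[ℝ] F) (y u w : E) : F :=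
  fderiv ℝ a y u w - fderiv ℝ a y w u

/-- The exterior derivative commutes with pullback: the second derivatives of the map cancel. -/
lemma flatD_pullback {a : E → E →L[ℝ] F} {τ : E → E} {y : E}
    (ha : DifferentiableAt ℝ a (τ y)) (hτ : ContDiffAt ℝ ∞ τ y) (u w : E) :
    flatD (fun z => (a (τ z)).comp (fderiv ℝ τ z)) y u w =
      flatD a (τ y) (fderiv ℝ τ y u) (fderiv ℝ τ y w) := by
  have h1 : DifferentiableAt ℝ τ y := hτ.differentiableAt (by simp)
  have h2 : DifferentiableAt ℝ (fderiv ℝ τ) y :=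
    (hτ.fderiv_right (m := ∞) (by simp)).differentiableAt (by simp)
  have h0 : HasFDerivAt (fun z => a (τ z)) _ y := ha.hasFDerivAt.comp y h1.hasFDerivAt
  have h3 := h0.clm_comp h2.hasFDerivAt
  have hs : fderiv ℝ (fderiv ℝ τ) y u w = fderiv ℝ (fderiv ℝ τ) y w u :=
    (hτ.isSymmSndFDerivAt (by
      simp [minSmoothness_of_isRCLikeNormedField]; exact WithTop.coe_le_coe.2 le_top)).eq u w
  have h4 : fderiv ℝ (fun z => (a (τ z)).comp (fderiv ℝ τ z)) y = _ := h3.fderiv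
  simp only [flatD, h4]
  simp [hs]

end Flat

/-! ### Forms in charts -/

section Charts

variable {E H M : Type*} [NormedAddCommGroup E] [NormedSpace ℝ E] [TopologicalSpace H]
  [TopologicalSpace M] [ChartedSpace H M] {I : ModelWithCorners ℝ E H} [I.Boundaryless]

/-- The derivative at `y` of the inverse of the preferred chart at `p`: it maps a vector `u` to the
tangent vector at the point with coordinates `y` that has components `u` in that chart. -/
noncomputable def chartDeriv (I : ModelWithCorners ℝ E H) (p : M) (y : E) : E →L[ℝ] E :=
  mfderiv 𝓘(ℝ, E) I (extChartAt I p).symm y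

variable {N : ℕ}

lemma inChart_eq (p : M) (α : OneForm E M N) (y : E) :
    inChart I p α y = (α ((extChartAt I p).symm y)).comp (chartDeriv I p y) := rfl

lemma inChart_apply (p : M) (α : OneForm E M N) (y u : E) :
    inChart I p α y u = α ((extChartAt I p).symm y) (chartDeriv I p y u) := rfl

/-- The part of the preferred chart at `p` that lies over `U`. -/
def chartDomain (I : ModelWithCorners ℝ E H) (p : M) (U : Set M) : Set E :=
  (extChartAt I p).target ∩ (extChartAt I p).symm ⁻¹' U

lemma isOpen_chartDomain (p : M) {U : Set M} (hU : IsOpen U) : IsOpen (chartDomain I p U) :=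
  (continuousOn_extChartAt_symm p).isOpen_inter_preimage (isOpen_extChartAt_target p) hU

lemma extChartAt_mem_chartDomain {U : Set M} {x : M} (hx : x ∈ U) :
    extChartAt I x x ∈ chartDomain I x U :=
  ⟨mem_extChartAt_target x, by simpa using hx⟩

lemma smoothOn_iff {U : Set M} (hU : IsOpen U) {α : OneForm E M N} :
    SmoothOn I U α ↔ ∀ p, ∀ y ∈ chartDomain I p U, ContDiffAt ℝ ∞ (inChart I p α) y := by
  refine forall_congr' fun p => ⟨fun h y hy => ?_, fun h y hy => (h y hy).contDiffWithinAt⟩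
  exact h.contDiffAt ((isOpen_chartDomain p hU).mem_nhds hy)

variable [IsManifold I ∞ M]

/-- The change of coordinates from the preferred chart at `p` to the one at `q`. -/
noncomputable def transition (I : ModelWithCorners ℝ E H) (p q : M) : E → E :=
  extChartAt I q ∘ (extChartAt I p).symm

lemma contDiffAt_transition (p q : M) {y : E}
    (hy : y ∈ chartDomain I p (extChartAt I q).source) :
    ContDiffAt ℝ ∞ (transition I p q) y := by
  have h := contDiffWithinAt_ext_coord_change (n := ∞) q p (y := y) (I := I)
    (by rw [PartialEquiv.trans_source]; exact hy)
  rwa [I.range_eq_univ, contDiffWithinAt_univ] at h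

lemma mdifferentiableAt_extChartAt_symm {p : M} {y : E} (hy : y ∈ (extChartAt I p).target) :
    MDifferentiableAt 𝓘(ℝ, E) I (extChartAt I p).symm y := by
  have := mdifferentiableWithinAt_extChartAt_symm hy
  rwa [I.range_eq_univ, mdifferentiableWithinAt_univ] at this

lemma chartDeriv_eq_fderiv_transition {p : M} {y : E} (hy : y ∈ (extChartAt I p).target) :
    chartDeriv I p y = fderiv ℝ (transition I p ((extChartAt I p).symm y)) y := by
  have h := mdifferentiableAt_extChartAt_symm hy
  rw [chartDeriv, h.mfderiv]
  simp [writtenInExtChartAt, transition]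
  rfl

lemma chartDeriv_self (x : M) : chartDeriv I x (extChartAt I x x) = ContinuousLinearMap.id ℝ E := by
  have := mfderivWithin_range_extChartAt_symm (I := I) (x := x)
  rwa [I.range_eq_univ, mfderivWithin_univ] at this

/-- The chain rule for the coordinate vector fields of two charts. -/
lemma chartDeriv_eq_comp (p q : M) {y : E} (hy : y ∈ chartDomain I p (extChartAt I q).source) :
    chartDeriv I p y =
      (chartDeriv I q (transition I p q y)).comp (fderiv ℝ (transition I p q) y) := by
  have hd : DifferentiableAt ℝ (transition I p q) y :=
    (contDiffAt_transition p q hy).differentiableAt (by simp)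
  have hq : transition I p q y ∈ (extChartAt I q).target := (extChartAt I q).map_source hy.2
  have h := mfderiv_comp y (mdifferentiableAt_extChartAt_symm hq) hd.mdifferentiableAt
  rw [mfderiv_eq_fderiv] at h
  refine Eq.trans ?_ h
  refine Filter.EventuallyEq.mfderiv_eq ?_
  filter_upwards [(isOpen_chartDomain p (isOpen_extChartAt_source q)).mem_nhds hy] with z hz
  exact ((extChartAt I q).left_inv hz.2).symm

lemma symm_transition (p q : M) {y : E} (hy : y ∈ chartDomain I p (extChartAt I q).source) :
    (extChartAt I q).symm (transition I p q y) = (extChartAt I p).symm y :=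
  (extChartAt I q).left_inv hy.2

lemma transition_mem (p q : M) {y : E} (hy : y ∈ chartDomain I p (extChartAt I q).source) :
    transition I p q y ∈ chartDomain I q (extChartAt I p).source := by
  refine ⟨(extChartAt I q).map_source hy.2, ?_⟩
  rw [mem_preimage, symm_transition p q hy]
  exact (extChartAt I p).map_target hy.1

lemma transition_transition (p q : M) {y : E}
    (hy : y ∈ chartDomain I p (extChartAt I q).source) :
    transition I q p (transition I p q y) = y := by
  rw [transition, Function.comp_apply, symm_transition p q hy, (extChartAt I p).right_inv hy.1]

lemma inChart_eq_comp (p q : M) (α : OneForm E M N) {y : E}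
    (hy : y ∈ chartDomain I p (extChartAt I q).source) :
    inChart I p α y =
      (inChart I q α (transition I p q y)).comp (fderiv ℝ (transition I p q) y) := by
  rw [inChart_eq, inChart_eq, chartDeriv_eq_comp p q hy, symm_transition p q hy]
  rfl

/-- Two opposite changes of coordinates have inverse derivatives. -/
lemma fderiv_transition_comp (p q : M) {y : E}
    (hy : y ∈ chartDomain I p (extChartAt I q).source) :
    (fderiv ℝ (transition I q p) (transition I p q y)).comp (fderiv ℝ (transition I p q) y) =
      ContinuousLinearMap.id ℝ E := by
  have h1 : DifferentiableAt ℝ (transition I p q) y :=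
    (contDiffAt_transition p q hy).differentiableAt (by simp)
  have h2 : DifferentiableAt ℝ (transition I q p) (transition I p q y) :=
    (contDiffAt_transition q p (transition_mem p q hy)).differentiableAt (by simp)
  rw [← fderiv_comp y h2 h1, ← fderiv_id (𝕜 := ℝ) (x := y)]
  refine Filter.EventuallyEq.fderiv_eq ?_
  filter_upwards [(isOpen_chartDomain p (isOpen_extChartAt_source q)).mem_nhds hy] with z hz
  exact transition_transition p q hz

lemma extD_eq_flatD (α : OneForm E M N) (x : M) (u w : E) :
    extD I α x u w = flatD (inChart I x α) (extChartAt I x x) u w := rfl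

/-- The exterior derivative, defined by the preferred chart at each point, can be computed in any
chart. -/
lemma extD_chartDeriv {α : OneForm E M N} {p : M} {y : E} (hy : y ∈ (extChartAt I p).target)
    (hα : DifferentiableAt ℝ (inChart I p α) y) (u w : E) :
    extD I α ((extChartAt I p).symm y) (chartDeriv I p y u) (chartDeriv I p y w) =
      flatD (inChart I p α) y u w := by
  set x := (extChartAt I p).symm y with hx
  have hyx : y ∈ chartDomain I p (extChartAt I x).source := ⟨hy, mem_extChartAt_source x⟩
  have hty : transition I p x y = extChartAt I x x := rfl
  have hxp : extChartAt I x x ∈ chartDomain I x (extChartAt I p).source := by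
    simpa [hty] using transition_mem p x hyx
  have hback : transition I x p (extChartAt I x x) = y := by
    simpa [hty] using transition_transition p x hyx
  -- the form in the chart at `x` is the pullback of the form in the chart at `p`
  have key : inChart I x α =ᶠ[𝓝 (extChartAt I x x)] fun z =>
      (inChart I p α (transition I x p z)).comp (fderiv ℝ (transition I x p) z) := by
    filter_upwards [(isOpen_chartDomain x (isOpen_extChartAt_source p)).mem_nhds hxp] with z hz
    exact inChart_eq_comp x p α hz
  have hcomp := fderiv_transition_comp p x hyx
  rw [hty, ← chartDeriv_eq_fderiv_transition hy] at hcomp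
  rw [extD_eq_flatD, flatD, key.fderiv_eq]
  have := flatD_pullback (a := inChart I p α) (τ := transition I x p) (y := extChartAt I x x)
    (by rwa [hback]) (contDiffAt_transition x p hxp) (chartDeriv I p y u) (chartDeriv I p y w)
  rw [flatD] at this
  rw [this, hback]
  have e : ∀ v, fderiv ℝ (transition I x p) (extChartAt I x x) (chartDeriv I p y v) = v :=
    fun v => by simpa using congrArg (fun T => T v) hcomp
  rw [e, e]

end Charts

section Flat

variable {E F : Type*} [NormedAddCommGroup E] [NormedSpace ℝ E] [NormedAddCommGroup F]
  [NormedSpace ℝ F]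

lemma flatD_add {a b : E → E →L[ℝ] F} {y : E} (ha : DifferentiableAt ℝ a y)
    (hb : DifferentiableAt ℝ b y) (u w : E) :
    flatD (a + b) y u w = flatD a y u w + flatD b y u w := by
  simp only [flatD, fderiv_add ha hb, _root_.add_apply]
  abel

lemma flatD_const_smul {R : Type*} [Semiring R] [Module R F] [SMulCommClass ℝ R F]
    [ContinuousConstSMul R F] {a : E → E →L[ℝ] F} {y : E} (ha : DifferentiableAt ℝ a y) (c : R)
    (u w : E) : flatD (c • a) y u w = c • flatD a y u w := by
  simp only [flatD, fderiv_const_smul ha, _root_.smul_apply, smul_sub]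

lemma fderiv_apply_mem {a : E → E →L[ℝ] F} {y : E} (ha : DifferentiableAt ℝ a y)
    {S : Submodule ℝ F} (hS : IsClosed (S : Set F)) (h : ∀ᶠ z in 𝓝 y, ∀ v, a z v ∈ S) (u w : E) :
    fderiv ℝ a y u w ∈ S := by
  have h1 : HasFDerivAt (fun z => a z w) ((fderiv ℝ a y).flip w) y := by
    simpa using ha.hasFDerivAt.clm_apply (hasFDerivAt_const w y)
  have h2 := (h1.hasLineDerivAt u).tendsto_slope_zero_right
  simp only [ContinuousLinearMap.flip_apply] at h2
  refine hS.mem_of_tendsto h2 ?_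
  have h3 : Tendsto (fun t : ℝ => y + t • u) (𝓝[>] 0) (𝓝 y) := by
    have : Continuous fun t : ℝ => y + t • u := by fun_prop
    simpa using (this.tendsto 0).mono_left nhdsWithin_le_nhds
  filter_upwards [h3.eventually h] with t ht
  exact S.smul_mem _ (S.sub_mem (ht w) (by simpa using h.self_of_nhds w))

lemma flatD_mem {a : E → E →L[ℝ] F} {y : E} (ha : DifferentiableAt ℝ a y)
    {S : Submodule ℝ F} (hS : IsClosed (S : Set F)) (h : ∀ᶠ z in 𝓝 y, ∀ v, a z v ∈ S) (u w : E) :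
    flatD a y u w ∈ S :=
  S.sub_mem (fderiv_apply_mem ha hS h u w) (fderiv_apply_mem ha hS h w u)

variable {𝔸 : Type*} [NormedRing 𝔸] [NormedAlgebra ℝ 𝔸]

/-- The curvature `da + a ∧ a` of a connection form with values in an algebra. -/
noncomputable def flatCurv (a : E → E →L[ℝ] 𝔸) (y u w : E) : 𝔸 :=
  flatD a y u w + (a y u * a y w - a y w * a y u)

/-- The curvature is conjugated under a gauge transformation of the connection form. -/
lemma flatCurv_gauge {a b : E → E →L[ℝ] 𝔸} {g h : E → 𝔸} {y : E}
    (ha : DifferentiableAt ℝ a y) (hb : DifferentiableAt ℝ b y) (hg : ContDiffAt ℝ ∞ g y)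
    (hh : DifferentiableAt ℝ h y) (hgh : ∀ᶠ z in 𝓝 y, g z * h z = 1) (hhg : h y * g y = 1)
    (hab : ∀ᶠ z in 𝓝 y, ∀ v, a z v = g z * b z v * h z - fderiv ℝ g z v * h z) (u w : E) :
    flatCurv a y u w = g y * flatCurv b y u w * h y := by
  have hg1 : DifferentiableAt ℝ g y := hg.differentiableAt (by simp)
  have hg2 : DifferentiableAt ℝ (fderiv ℝ g) y :=
    (hg.fderiv_right (m := ∞) (by simp)).differentiableAt (by simp)
  have hs : ∀ u w, fderiv ℝ (fderiv ℝ g) y u w = fderiv ℝ (fderiv ℝ g) y w u := fun u w =>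
    (hg.isSymmSndFDerivAt (by
      simp [minSmoothness_of_isRCLikeNormedField]; exact WithTop.coe_le_coe.2 le_top)).eq u w
  -- the derivative of the inverse, from `g h = 1`
  have h' : ∀ v, fderiv ℝ h y v = -(h y * fderiv ℝ g y v * h y) := by
    intro v
    have e1 : HasFDerivAt (fun z => g z * h z) _ y := hg1.hasFDerivAt.mul' hh.hasFDerivAt
    have e2 := e1.congr_of_eventuallyEq (f₁ := fun _ => (1 : 𝔸))
      (hgh.mono fun z hz => hz.symm)
    have e3 := congrArg (fun T : E →L[ℝ] 𝔸 => h y * T v)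
      (e2.unique (hasFDerivAt_const (1 : 𝔸) y))
    simp [mul_add, ← mul_assoc, hhg] at e3
    exact eq_neg_of_add_eq_zero_left e3
  -- the product rule; the second derivative of `g` drops out of the antisymmetrization
  have hd : ∀ w u, fderiv ℝ a y u w = fderiv ℝ g y u * b y w * h y +
      g y * fderiv ℝ b y u w * h y + g y * b y w * fderiv ℝ h y u -
      fderiv ℝ (fderiv ℝ g) y u w * h y - fderiv ℝ g y w * fderiv ℝ h y u := by
    intro w u
    have ea : HasFDerivAt (fun z => a z w) ((fderiv ℝ a y).flip w) y := by
      simpa using ha.hasFDerivAt.clm_apply (hasFDerivAt_const w y)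
    have eb : HasFDerivAt (fun z => b z w) ((fderiv ℝ b y).flip w) y := by
      simpa using hb.hasFDerivAt.clm_apply (hasFDerivAt_const w y)
    have eg : HasFDerivAt (fun z => fderiv ℝ g z w) ((fderiv ℝ (fderiv ℝ g) y).flip w) y := by
      simpa using hg2.hasFDerivAt.clm_apply (hasFDerivAt_const w y)
    have e := (((hg1.hasFDerivAt.mul' eb).mul' hh.hasFDerivAt).sub
      (eg.mul' hh.hasFDerivAt)).congr_of_eventuallyEq (f₁ := fun z => a z w)
      (hab.mono fun z hz => hz w)
    have := congrArg (fun T : E →L[ℝ] 𝔸 => T u) (ea.unique e)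
    simp only [ContinuousLinearMap.flip_apply] at this
    rw [this]
    simp
    noncomm_ring
  have ha0 : ∀ v, a y v = g y * b y v * h y - fderiv ℝ g y v * h y := hab.self_of_nhds
  have hgy : g y * h y = 1 := hgh.self_of_nhds
  simp only [flatCurv, flatD, hd, h', ha0, hs w u]
  have k : ∀ p q : 𝔸, p * h y * (g y * q) = p * q := fun p q => by
    rw [mul_assoc, ← mul_assoc (h y), hhg, one_mul]
  have e1 : ∀ u w, (g y * b y u * h y - fderiv ℝ g y u * h y) *
      (g y * b y w * h y - fderiv ℝ g y w * h y) = g y * b y u * b y w * h y -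
      g y * b y u * h y * fderiv ℝ g y w * h y - fderiv ℝ g y u * b y w * h y +
      fderiv ℝ g y u * h y * fderiv ℝ g y w * h y := by
    intro u w
    have k1 := k (g y * b y u) (b y w * h y)
    have k2 := k (fderiv ℝ g y u) (b y w * h y)
    simp only [sub_mul, mul_sub, mul_assoc] at k1 k2 ⊢
    rw [k1, k2]
    abel
  rw [e1, e1]
  noncomm_ring

end Flat

/-! ### The Lie algebra of a group of unitary matrices -/

section LieAlgebra

variable {N : ℕ} (G : Subgroup (Matrix.unitaryGroup (Fin N) ℂ))

lemma hasDerivAt_mul_curve {γ δ : ℝ → Matrix.unitaryGroup (Fin N) ℂ} {ξ η : Mat N}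
    (hγ : HasDerivAt (fun s => (γ s : Mat N)) ξ 0) (hδ : HasDerivAt (fun s => (δ s : Mat N)) η 0) :
    HasDerivAt (fun s => ((γ s * δ s : Matrix.unitaryGroup (Fin N) ℂ) : Mat N))
      (ξ * (δ 0 : Mat N) + (γ 0 : Mat N) * η) 0 :=
  hγ.mul hδ

/-- The velocities at the identity of curves in `G` form a real vector space: products and
reparametrizations of curves realize sums and multiples of their velocities. -/
noncomputable def lieSubmodule : Submodule ℝ (Mat N) where
  carrier := lieAlg G
  zero_mem' := ⟨fun _ => 1, fun _ => G.one_mem, rfl, hasDerivAt_const _ _⟩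
  add_mem' := by
    rintro ξ η ⟨γ, hγ, hγ0, hγ'⟩ ⟨δ, hδ, hδ0, hδ'⟩
    refine ⟨fun s => γ s * δ s, fun s => G.mul_mem (hγ s) (hδ s), by simp [hγ0, hδ0], ?_⟩
    simpa [hγ0, hδ0] using hasDerivAt_mul_curve hγ' hδ'
  smul_mem' := by
    rintro c ξ ⟨γ, hγ, hγ0, hγ'⟩
    refine ⟨fun s => γ (c * s), fun s => hγ _, by simp [hγ0], ?_⟩
    have h : HasDerivAt (fun s : ℝ => c * s) c 0 := by
      simpa using (hasDerivAt_id (0 : ℝ)).const_mul c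
    have hγ'' : HasDerivAt (fun s => (γ s : Mat N)) ξ (c * 0) := by simpa using hγ'
    exact hγ''.scomp (0 : ℝ) h

variable {G}

lemma isClosed_lieSubmodule : IsClosed (lieSubmodule G : Set (Mat N)) :=
  Submodule.closed_of_finiteDimensional _

lemma conj_mem_lieSubmodule {g : Matrix.unitaryGroup (Fin N) ℂ} (hg : g ∈ G) {ξ : Mat N}
    (hξ : ξ ∈ lieSubmodule G) :
    (g : Mat N) * ξ * ((g⁻¹ : Matrix.unitaryGroup (Fin N) ℂ) : Mat N) ∈ lieSubmodule G := by
  obtain ⟨γ, hγ, hγ0, hγ'⟩ := hξ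
  refine ⟨fun s => g * γ s * g⁻¹, fun s => G.mul_mem (G.mul_mem hg (hγ s)) (G.inv_mem hg),
    by simp [hγ0], ?_⟩
  exact (hγ'.const_mul (g : Mat N)).mul_const _

/-- Elements of the Lie algebra of a group of unitary matrices are skew-Hermitian. -/
lemma conjTranspose_of_mem_lieSubmodule {ξ : Mat N} (hξ : ξ ∈ lieSubmodule G) : ξᴴ = -ξ := by
  obtain ⟨γ, -, hγ0, hγ'⟩ := hξ
  have h1 := hγ'.mul hγ'.star
  have h2 : ((fun s => (γ s : Mat N)) * fun s => star (γ s : Mat N)) = fun _ => 1 :=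
    funext fun s => Unitary.mul_star_self_of_mem (γ s).2
  rw [h2] at h1
  have h3 := h1.unique (hasDerivAt_const (0 : ℝ) (1 : Mat N))
  simp only [hγ0, OneMemClass.coe_one, star_one, mul_one, one_mul] at h3
  exact eq_neg_of_add_eq_zero_right h3

/-- The Lie algebra is closed under brackets: `[ξ, η]` is the velocity of the curve
`γ η γ⁻¹` in the Lie algebra, where `γ` has velocity `ξ`. -/
lemma bracket_mem_lieSubmodule {ξ η : Mat N} (hξ : ξ ∈ lieSubmodule G)
    (hη : η ∈ lieSubmodule G) : ξ * η - η * ξ ∈ lieSubmodule G := by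
  have hskew := conjTranspose_of_mem_lieSubmodule hξ
  obtain ⟨γ, hγ, hγ0, hγ'⟩ := hξ
  have h1 : HasDerivAt (fun s => (γ s : Mat N) * η * star (γ s : Mat N)) (ξ * η - η * ξ) 0 := by
    have h : HasDerivAt (fun s => (γ s : Mat N) * η * star (γ s : Mat N)) _ 0 :=
      (hγ'.mul_const η).mul hγ'.star
    refine h.congr_deriv ?_
    simp [hγ0, Matrix.star_eq_conjTranspose, hskew, sub_eq_add_neg]
  have h2 := h1.tendsto_slope_zero_right
  refine isClosed_lieSubmodule.mem_of_tendsto h2 (Eventually.of_forall fun t => ?_)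
  refine Submodule.smul_mem _ _ (Submodule.sub_mem _ (conj_mem_lieSubmodule (hγ _) hη) ?_)
  exact conj_mem_lieSubmodule (hγ 0) hη

end LieAlgebra

/-! ### Alternating forms -/

section AltForm

variable {E F : Type*} [AddCommGroup E] [Module ℝ E] [AddCommGroup F] [Module ℝ F]

/-- An alternating bilinear form on a vector space, given as a function of two vectors. -/
structure IsAltForm (η : E → E → F) : Prop where
  add_left : ∀ u u' w, η (u + u') w = η u w + η u' w
  smul_left : ∀ (c : ℝ) u w, η (c • u) w = c • η u w
  swap : ∀ u w, η w u = -η u w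

namespace IsAltForm

variable {η η' : E → E → F}

lemma add_right (h : IsAltForm η) (u w w' : E) : η u (w + w') = η u w + η u w' := by
  rw [h.swap, h.add_left, neg_add, ← h.swap, ← h.swap]

lemma smul_right (h : IsAltForm η) (c : ℝ) (u w : E) : η u (c • w) = c • η u w := by
  rw [h.swap, h.smul_left, ← smul_neg, ← h.swap]

lemma self (h : IsAltForm η) (u : E) : η u u = 0 := by
  have h1 := h.swap u u
  have h2 : (2 : ℝ) • η u u = 0 := by
    rw [two_smul]
    nth_rw 1 [h1]
    exact neg_add_cancel _
  exact (smul_eq_zero.1 h2).resolve_left two_ne_zero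

lemma add (h : IsAltForm η) (h' : IsAltForm η') : IsAltForm (fun u w => η u w + η' u w) where
  add_left u u' w := by rw [h.add_left, h'.add_left]; abel
  smul_left c u w := by rw [h.smul_left, h'.smul_left, smul_add]
  swap u w := by rw [h.swap u w, h'.swap u w]; abel

lemma smul [Module ℂ F] [SMulCommClass ℂ ℝ F] (h : IsAltForm η) (c : ℂ) :
    IsAltForm (fun u w => c • η u w) where
  add_left u u' w := by rw [h.add_left, smul_add]
  smul_left r u w := by rw [h.smul_left, smul_comm]
  swap u w := by rw [h.swap u w, smul_neg]

lemma real_smul (h : IsAltForm η) (c : ℝ) : IsAltForm (fun u w => c • η u w) where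
  add_left u u' w := by rw [h.add_left, smul_add]
  smul_left r u w := by rw [h.smul_left, smul_comm]
  swap u w := by rw [h.swap u w, smul_neg]

lemma sub (h : IsAltForm η) (h' : IsAltForm η') : IsAltForm (fun u w => η u w - η' u w) where
  add_left u u' w := by rw [h.add_left, h'.add_left]; abel
  smul_left c u w := by rw [h.smul_left, h'.smul_left, smul_sub]
  swap u w := by rw [h.swap u w, h'.swap u w]; abel

/-- Left linearity of an alternating form. -/
lemma sum_left (h : IsAltForm η) {ι : Type*} (s : Finset ι) (c : ι → ℝ) (e : ι → E) (w : E) :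
    η (∑ i ∈ s, c i • e i) w = ∑ i ∈ s, c i • η (e i) w := by
  classical
  induction s using Finset.induction_on with
  | empty => simpa using h.smul_left 0 0 w
  | insert i s hi ih => rw [Finset.sum_insert hi, Finset.sum_insert hi, h.add_left, h.smul_left, ih]

end IsAltForm

end AltForm

/-! ### Algebra of matrix valued forms -/

section Manifold

variable {E H M : Type*} [NormedAddCommGroup E] [NormedSpace ℝ E] [TopologicalSpace H]
  [TopologicalSpace M] [ChartedSpace H M] {I : ModelWithCorners ℝ E H} [I.Boundaryless]
  {N : ℕ} {U : Set M} {α β : OneForm E M N}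

lemma SmoothOn.contDiffAt (hα : SmoothOn I U α) (hU : IsOpen U) {p : M} {y : E}
    (hy : y ∈ chartDomain I p U) : ContDiffAt ℝ ∞ (inChart I p α) y :=
  (smoothOn_iff hU).1 hα p y hy

lemma SmoothOn.differentiableAt (hα : SmoothOn I U α) (hU : IsOpen U) {p : M} {y : E}
    (hy : y ∈ chartDomain I p U) : DifferentiableAt ℝ (inChart I p α) y :=
  (hα.contDiffAt hU hy).differentiableAt (by simp)

lemma SmoothOn.add (hα : SmoothOn I U α) (hβ : SmoothOn I U β) : SmoothOn I U (α + β) :=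
  fun p => (hα p).add (hβ p)

lemma SmoothOn.smul (hα : SmoothOn I U α) (c : ℂ) : SmoothOn I U (c • α) :=
  fun p => (hα p).const_smul c

lemma SmoothOn.real_smul (hα : SmoothOn I U α) (c : ℝ) : SmoothOn I U (c • α) :=
  fun p => (hα p).const_smul c

lemma SmoothOn.neg (hα : SmoothOn I U α) : SmoothOn I U (-α) :=
  fun p => (hα p).neg

lemma SmoothOn.sub (hα : SmoothOn I U α) (hβ : SmoothOn I U β) : SmoothOn I U (α - β) := by
  rw [sub_eq_add_neg]
  exact hα.add hβ.neg

lemma extD_add (hα : SmoothOn I U α) (hβ : SmoothOn I U β) (hU : IsOpen U) {x : M} (hx : x ∈ U)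
    (u w : E) : extD I (α + β) x u w = extD I α x u w + extD I β x u w :=
  flatD_add (hα.differentiableAt hU (extChartAt_mem_chartDomain hx))
    (hβ.differentiableAt hU (extChartAt_mem_chartDomain hx)) u w

lemma extD_smul (hα : SmoothOn I U α) (hU : IsOpen U) {x : M} (hx : x ∈ U) (c : ℂ)
    (u w : E) : extD I (c • α) x u w = c • extD I α x u w :=
  flatD_const_smul (hα.differentiableAt hU (extChartAt_mem_chartDomain hx)) c u w

lemma extD_real_smul (hα : SmoothOn I U α) (hU : IsOpen U) {x : M} (hx : x ∈ U) (c : ℝ)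
    (u w : E) : extD I (c • α) x u w = c • extD I α x u w :=
  flatD_const_smul (hα.differentiableAt hU (extChartAt_mem_chartDomain hx)) c u w

lemma extD_mem (hα : SmoothOn I U α) (hU : IsOpen U) {S : Submodule ℝ (Mat N)}
    (hS : ∀ x ∈ U, ∀ v, α x v ∈ S) {x : M} (hx : x ∈ U) (u w : E) : extD I α x u w ∈ S := by
  refine flatD_mem (hα.differentiableAt hU (extChartAt_mem_chartDomain hx))
    (Submodule.closed_of_finiteDimensional S) ?_ u w
  filter_upwards [(isOpen_chartDomain x hU).mem_nhds (extChartAt_mem_chartDomain hx)] with z hz v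
  exact hS _ hz.2 _

lemma isAltForm_extD (α : OneForm E M N) (x : M) : IsAltForm (extD I α x) where
  add_left u u' w := by simp only [extD, map_add, _root_.add_apply]; abel
  smul_left c u w := by simp only [extD, map_smul, _root_.smul_apply, smul_sub]
  swap u w := by simp only [extD]; abel

lemma isAltForm_bracket (a b : E →L[ℝ] Mat N) :
    IsAltForm (fun u w => a u * b w - b w * a u - (a w * b u - b u * a w)) where
  add_left u u' w := by simp only [map_add, add_mul, mul_add]; abel
  smul_left c u w := by simp only [map_smul, smul_mul_assoc, mul_smul_comm, smul_sub]
  swap u w := by abel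

lemma isAltForm_commutator (a : E →L[ℝ] Mat N) :
    IsAltForm (fun u w => a u * a w - a w * a u) where
  add_left u u' w := by simp only [map_add, add_mul, mul_add]; abel
  smul_left c u w := by simp only [map_smul, smul_mul_assoc, mul_smul_comm, smul_sub]
  swap u w := by abel

lemma isAltForm_curvature (α : OneForm E M N) (x : M) : IsAltForm (curvature I α x) :=
  (isAltForm_extD α x).add (isAltForm_commutator (α x))

lemma isAltForm_covD (A α : OneForm E M N) (x : M) : IsAltForm (covD I A α x) :=
  (isAltForm_extD α x).add (isAltForm_bracket (A x) (α x))

/-- The curvature along an affine line of connections is quadratic in the parameter. -/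
lemma curvature_add (hα : SmoothOn I U α) (hβ : SmoothOn I U β) (hU : IsOpen U) {x : M}
    (hx : x ∈ U) (u w : E) :
    curvature I (α + β) x u w =
      curvature I α x u w + covD I α β x u w + (β x u * β x w - β x w * β x u) := by
  simp only [curvature, covD, wedgeBracket, extD_add hα hβ hU hx, Pi.add_apply, _root_.add_apply]
  noncomm_ring

lemma covD_add (A : OneForm E M N) (hα : SmoothOn I U α) (hβ : SmoothOn I U β) (hU : IsOpen U)
    {x : M} (hx : x ∈ U) (u w : E) :
    covD I A (α + β) x u w = covD I A α x u w + covD I A β x u w := by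
  simp only [covD, wedgeBracket, extD_add hα hβ hU hx, Pi.add_apply, _root_.add_apply]
  noncomm_ring

lemma covD_smul (A : OneForm E M N) (hα : SmoothOn I U α) (hU : IsOpen U)
    {x : M} (hx : x ∈ U) (c : ℂ) (u w : E) :
    covD I A (c • α) x u w = c • covD I A α x u w := by
  simp only [covD, wedgeBracket, extD_smul hα hU hx, Pi.smul_apply, _root_.smul_apply,
    mul_smul_comm, smul_mul_assoc, smul_add, smul_sub]

lemma covD_real_smul (A : OneForm E M N) (hα : SmoothOn I U α) (hU : IsOpen U)
    {x : M} (hx : x ∈ U) (c : ℝ) (u w : E) :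
    covD I A (c • α) x u w = c • covD I A α x u w := by
  simp only [covD, wedgeBracket, extD_real_smul hα hU hx, Pi.smul_apply, _root_.smul_apply,
    mul_smul_comm, smul_mul_assoc, smul_add, smul_sub]

/-- The curvature of a complex connection `D_A + iφ` is `F_A - φ ∧ φ + i D_A φ`. -/
lemma curvature_complexForm (hα : SmoothOn I U α) (hβ : SmoothOn I U β) (hU : IsOpen U) {x : M}
    (hx : x ∈ U) (u w : E) :
    curvature I (complexForm α β) x u w =
      (curvature I α x u w - (β x u * β x w - β x w * β x u)) +
        Complex.I • covD I α β x u w := by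
  have h : complexForm α β = α + Complex.I • β := rfl
  rw [h, curvature_add hα (hβ.smul _) hU hx, covD_smul α hβ hU hx]
  simp only [Pi.smul_apply, _root_.smul_apply, mul_smul_comm, smul_mul_assoc, smul_smul,
    Complex.I_mul_I, neg_one_smul]
  abel

variable [IsManifold I ∞ M]

/-- The curvature in a chart. -/
lemma curvature_chartDeriv (hα : SmoothOn I U α) (hU : IsOpen U) {p : M} {y : E}
    (hy : y ∈ chartDomain I p U) (u w : E) :
    curvature I α ((extChartAt I p).symm y) (chartDeriv I p y u) (chartDeriv I p y w) =
      flatCurv (inChart I p α) y u w := by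
  rw [curvature, extD_chartDeriv hy.1 (hα.differentiableAt hU hy)]
  rfl

lemma contDiffAt_flatCurv {F 𝔸 : Type*} [NormedAddCommGroup F] [NormedSpace ℝ F] [NormedRing 𝔸]
    [NormedAlgebra ℝ 𝔸] {a : F → F →L[ℝ] 𝔸} {y : F} (ha : ContDiffAt ℝ ∞ a y) (u w : F) :
    ContDiffAt ℝ ∞ (fun z => flatCurv a z u w) y := by
  have h : ContDiffAt ℝ ∞ (fderiv ℝ a) y := ha.fderiv_right (by simp)
  have h2 : ∀ v v', ContDiffAt ℝ ∞ (fun z => fderiv ℝ a z v v') y := fun v v' =>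
    (h.clm_apply contDiffAt_const).clm_apply contDiffAt_const
  have h1 : ∀ v, ContDiffAt ℝ ∞ (fun z => a z v) y := fun v => ha.clm_apply contDiffAt_const
  exact ((h2 u w).sub (h2 w u)).add (((h1 u).mul (h1 w)).sub ((h1 w).mul (h1 u)))

end Manifold

/-! ### Gauge covariance -/

namespace GaugeBundle

section Manifold

variable {E H M : Type*} [NormedAddCommGroup E] [NormedSpace ℝ E] [TopologicalSpace H]
  [TopologicalSpace M] [ChartedSpace H M] {I : ModelWithCorners ℝ E H} [I.Boundaryless]
  {N : ℕ} {G : Subgroup (Matrix.unitaryGroup (Fin N) ℂ)} {ι : Type*}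

/-- The action on `Mat N` of the transition function from the trivialization `j` to `i`. -/
noncomputable def adj (P : GaugeBundle I M G ι) (i j : ι) (x : M) (Z : Mat N) : Mat N :=
  (P.trans i j x : Mat N) * Z * ((P.trans i j x)⁻¹ : Matrix.unitaryGroup (Fin N) ℂ)

section adj

variable (P : GaugeBundle I M G ι) (i j : ι) (x : M)

lemma coe_inv_mul_coe (g : Matrix.unitaryGroup (Fin N) ℂ) :
    ((g⁻¹ : Matrix.unitaryGroup (Fin N) ℂ) : Mat N) * (g : Mat N) = 1 := by
  rw [← Submonoid.coe_mul, inv_mul_cancel]; rfl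

lemma coe_mul_coe_inv (g : Matrix.unitaryGroup (Fin N) ℂ) :
    (g : Mat N) * ((g⁻¹ : Matrix.unitaryGroup (Fin N) ℂ) : Mat N) = 1 := by
  rw [← Submonoid.coe_mul, mul_inv_cancel]; rfl

lemma adj_add (Z W : Mat N) : P.adj i j x (Z + W) = P.adj i j x Z + P.adj i j x W := by
  simp only [adj, mul_add, add_mul]

lemma adj_sub (Z W : Mat N) : P.adj i j x (Z - W) = P.adj i j x Z - P.adj i j x W := by
  simp only [adj, mul_sub, sub_mul]

lemma adj_neg (Z : Mat N) : P.adj i j x (-Z) = -P.adj i j x Z := by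
  simp only [adj, mul_neg, neg_mul]

lemma adj_smul (c : ℂ) (Z : Mat N) : P.adj i j x (c • Z) = c • P.adj i j x Z := by
  simp only [adj, mul_smul_comm, smul_mul_assoc]

lemma adj_real_smul (c : ℝ) (Z : Mat N) : P.adj i j x (c • Z) = c • P.adj i j x Z := by
  simp only [adj, mul_smul_comm, smul_mul_assoc]

lemma adj_mul (Z W : Mat N) : P.adj i j x (Z * W) = P.adj i j x Z * P.adj i j x W := by
  simp only [adj, mul_assoc]
  rw [← mul_assoc _ (P.trans i j x : Mat N), coe_inv_mul_coe, one_mul]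

lemma trace_adj (Z : Mat N) : (P.adj i j x Z).trace = Z.trace := by
  rw [adj, Matrix.trace_mul_cycle, coe_inv_mul_coe, one_mul]

end adj

/-- A smooth connection on the bundle with structure group extended to all matrices: the conditions
of `IsConnection` without the one on the values. -/
structure IsSmoothConnection (P : GaugeBundle I M G ι) (A : ι → OneForm E M N) : Prop where
  smooth : ∀ i, SmoothOn I (P.baseSet i) (A i)
  change : ∀ i j, ∀ x ∈ P.baseSet i ∩ P.baseSet j, ∀ v : E,
    A i x v = P.adj i j x (A j x v) -
      differential I (fun z => (P.trans i j z : Mat N)) x v *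
        ((P.trans i j x)⁻¹ : Matrix.unitaryGroup _ ℂ)

/-- A smooth matrix valued 1-form of adjoint type: the conditions of `IsAdForm` without the one on
the values. -/
structure IsSmoothAdForm (P : GaugeBundle I M G ι) (b : ι → OneForm E M N) : Prop where
  smooth : ∀ i, SmoothOn I (P.baseSet i) (b i)
  change : ∀ i j, ∀ x ∈ P.baseSet i ∩ P.baseSet j, ∀ v : E, b i x v = P.adj i j x (b j x v)

/-- A smooth matrix valued 2-form of adjoint type. -/
structure IsAdTwoForm (P : GaugeBundle I M G ι) (Ω : ι → M → E → E → Mat N) : Prop where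
  alt : ∀ i, ∀ x ∈ P.baseSet i, IsAltForm (Ω i x)
  smooth : ∀ i p u w, ∀ y ∈ chartDomain I p (P.baseSet i), ContDiffAt ℝ ∞ (fun z =>
    Ω i ((extChartAt I p).symm z) (chartDeriv I p z u) (chartDeriv I p z w)) y
  change : ∀ i j, ∀ x ∈ P.baseSet i ∩ P.baseSet j, ∀ u w,
    Ω i x u w = P.adj i j x (Ω j x u w)

variable {P : GaugeBundle I M G ι} {A : ι → OneForm E M N} {b b' : ι → OneForm E M N}
  {Ω Ω' : ι → M → E → E → Mat N}

lemma IsConnection.isSmoothConnection (h : P.IsConnection A) : P.IsSmoothConnection A :=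
  ⟨h.smooth, h.change⟩

lemma IsAdForm.isSmoothAdForm (h : P.IsAdForm b) : P.IsSmoothAdForm b :=
  ⟨h.smooth, h.change⟩

lemma IsSmoothAdForm.add (h : P.IsSmoothAdForm b) (h' : P.IsSmoothAdForm b') :
    P.IsSmoothAdForm (b + b') where
  smooth i := (h.smooth i).add (h'.smooth i)
  change i j x hx v := by
    simp only [Pi.add_apply, _root_.add_apply, h.change i j x hx, h'.change i j x hx, adj_add]

lemma IsSmoothAdForm.smul (h : P.IsSmoothAdForm b) (c : ℂ) : P.IsSmoothAdForm (c • b) where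
  smooth i := (h.smooth i).smul c
  change i j x hx v := by
    simp only [Pi.smul_apply, _root_.smul_apply, h.change i j x hx, adj_smul]

lemma IsSmoothConnection.add (h : P.IsSmoothConnection A) (h' : P.IsSmoothAdForm b) :
    P.IsSmoothConnection (A + b) where
  smooth i := (h.smooth i).add (h'.smooth i)
  change i j x hx v := by
    simp only [Pi.add_apply, _root_.add_apply, h.change i j x hx, h'.change i j x hx, adj_add]
    abel

lemma IsSmoothConnection.sub {A' : ι → OneForm E M N} (h : P.IsSmoothConnection A)
    (h' : P.IsSmoothConnection A') : P.IsSmoothAdForm (A - A') where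
  smooth i := (h.smooth i).sub (h'.smooth i)
  change i j x hx v := by
    simp only [Pi.sub_apply, _root_.sub_apply, h.change i j x hx, h'.change i j x hx, adj_sub]
    abel

lemma IsAdForm.add (h : P.IsAdForm b) (h' : P.IsAdForm b') : P.IsAdForm (b + b') where
  smooth i := (h.smooth i).add (h'.smooth i)
  mem i x hx v := (lieSubmodule G).add_mem (h.mem i x hx v) (h'.mem i x hx v)
  change := (h.isSmoothAdForm.add h'.isSmoothAdForm).change

lemma IsAdForm.neg (h : P.IsAdForm b) : P.IsAdForm (-b) where
  smooth i := (h.smooth i).neg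
  mem i x hx v := (lieSubmodule G).neg_mem (h.mem i x hx v)
  change i j x hx v := by
    simp only [Pi.neg_apply, _root_.neg_apply]
    rw [h.isSmoothAdForm.change i j x hx]
    exact (P.adj_neg i j x _).symm

lemma IsAdForm.sub (h : P.IsAdForm b) (h' : P.IsAdForm b') : P.IsAdForm (b - b') := by
  rw [sub_eq_add_neg]
  exact h.add h'.neg

lemma trans_self {i : ι} {x : M} (hx : x ∈ P.baseSet i) : P.trans i i x = 1 :=
  mul_eq_left.1 (P.trans_comp i i i x ⟨⟨hx, hx⟩, hx⟩)

lemma trans_symm {i j : ι} {x : M} (hx : x ∈ P.baseSet i ∩ P.baseSet j) :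
    P.trans j i x = (P.trans i j x)⁻¹ :=
  eq_inv_of_mul_eq_one_right
    ((P.trans_comp i j i x ⟨hx, hx.1⟩).trans (trans_self hx.1))

lemma isOpen_inter (i j : ι) : IsOpen (P.baseSet i ∩ P.baseSet j) :=
  (P.isOpen_baseSet i).inter (P.isOpen_baseSet j)

section Two

lemma IsAdTwoForm.add (h : P.IsAdTwoForm Ω) (h' : P.IsAdTwoForm Ω') :
    P.IsAdTwoForm (fun i x u w => Ω i x u w + Ω' i x u w) where
  alt i x hx := (h.alt i x hx).add (h'.alt i x hx)
  smooth i p u w y hy := (h.smooth i p u w y hy).add (h'.smooth i p u w y hy)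
  change i j x hx u w := by rw [h.change i j x hx, h'.change i j x hx, adj_add]

lemma IsAdTwoForm.sub (h : P.IsAdTwoForm Ω) (h' : P.IsAdTwoForm Ω') :
    P.IsAdTwoForm (fun i x u w => Ω i x u w - Ω' i x u w) where
  alt i x hx := (h.alt i x hx).sub (h'.alt i x hx)
  smooth i p u w y hy := (h.smooth i p u w y hy).sub (h'.smooth i p u w y hy)
  change i j x hx u w := by rw [h.change i j x hx, h'.change i j x hx, adj_sub]

lemma IsAdTwoForm.real_smul (h : P.IsAdTwoForm Ω) (c : ℝ) :
    P.IsAdTwoForm (fun i x u w => c • Ω i x u w) where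
  alt i x hx := (h.alt i x hx).real_smul c
  smooth i p u w y hy := (h.smooth i p u w y hy).const_smul c
  change i j x hx u w := by rw [h.change i j x hx, adj_real_smul]

lemma IsAdTwoForm.congr (h : P.IsAdTwoForm Ω)
    (he : ∀ i, ∀ x ∈ P.baseSet i, ∀ u w, Ω' i x u w = Ω i x u w) : P.IsAdTwoForm Ω' where
  alt i x hx := by
    have : Ω' i x = Ω i x := funext₂ (he i x hx)
    rw [this]; exact h.alt i x hx
  smooth i p u w y hy := by
    refine (h.smooth i p u w y hy).congr_of_eventuallyEq ?_
    filter_upwards [(isOpen_chartDomain p (P.isOpen_baseSet i)).mem_nhds hy] with z hz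
    exact he i _ hz.2 _ _
  change i j x hx u w := by rw [he i x hx.1, he j x hx.2, h.change i j x hx]

/-- The 2-form `b ∧ b` of adjoint type. -/
lemma IsSmoothAdForm.commutator (h : P.IsSmoothAdForm b) :
    P.IsAdTwoForm (fun i x u w => b i x u * b i x w - b i x w * b i x u) where
  alt i x hx := isAltForm_commutator _
  smooth i p u w y hy := by
    have h1 : ∀ v, ContDiffAt ℝ ∞ (fun z => inChart I p (b i) z v) y := fun v =>
      ((h.smooth i).contDiffAt (P.isOpen_baseSet i) hy).clm_apply contDiffAt_const
    exact ((h1 u).mul (h1 w)).sub ((h1 w).mul (h1 u))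
  change i j x hx u w := by simp only [h.change i j x hx, adj_sub, adj_mul]

end Two

variable [IsManifold I ∞ M]

lemma contDiffAt_trans {i j : ι} {p : M} {y : E}
    (hy : y ∈ chartDomain I p (P.baseSet i ∩ P.baseSet j)) :
    ContDiffAt ℝ ∞ (fun z => (P.trans i j ((extChartAt I p).symm z) : Mat N)) y := by
  rw [← contMDiffAt_iff_contDiffAt]
  have h1 := (P.trans_smooth i j).contMDiffAt ((isOpen_inter i j).mem_nhds hy.2)
  have h2 : ContMDiffAt 𝓘(ℝ, E) I ∞ (extChartAt I p).symm y :=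
    (contMDiffOn_extChartAt_symm p).contMDiffAt ((isOpen_extChartAt_target p).mem_nhds hy.1)
  exact h1.comp y h2

lemma fderiv_trans {i j : ι} {p : M} {y : E}
    (hy : y ∈ chartDomain I p (P.baseSet i ∩ P.baseSet j)) (v : E) :
    fderiv ℝ (fun z => (P.trans i j ((extChartAt I p).symm z) : Mat N)) y v =
      differential I (fun z => (P.trans i j z : Mat N)) ((extChartAt I p).symm y)
        (chartDeriv I p y v) := by
  have h1 := ((P.trans_smooth i j).contMDiffAt
    ((isOpen_inter i j).mem_nhds hy.2)).mdifferentiableAt (by simp)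
  have h := mfderiv_comp y h1 (mdifferentiableAt_extChartAt_symm hy.1)
  rw [mfderiv_eq_fderiv] at h
  exact congrArg (fun T : E →L[ℝ] Mat N => T v) h

/-- The curvature of a connection is a 2-form of adjoint type. -/
lemma IsSmoothConnection.curvature (h : P.IsSmoothConnection A) :
    P.IsAdTwoForm (fun i => curvature I (A i)) where
  alt i x _ := isAltForm_curvature _ x
  smooth i p u w y hy := by
    have h1 := (h.smooth i).contDiffAt (P.isOpen_baseSet i) hy
    refine (contDiffAt_flatCurv h1 u w).congr_of_eventuallyEq ?_
    filter_upwards [(isOpen_chartDomain p (P.isOpen_baseSet i)).mem_nhds hy] with z hz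
    exact curvature_chartDeriv (h.smooth i) (P.isOpen_baseSet i) hz u w
  change i j x hx u w := by
    have hy := extChartAt_mem_chartDomain (I := I) hx
    have hyi := extChartAt_mem_chartDomain (I := I) hx.1
    have hyj := extChartAt_mem_chartDomain (I := I) hx.2
    have hyx : extChartAt I x x ∈ chartDomain I x (P.baseSet j ∩ P.baseSet i) := by
      rwa [inter_comm]
    have hev : ∀ᶠ z in 𝓝 (extChartAt I x x), z ∈ chartDomain I x (P.baseSet i ∩ P.baseSet j) :=
      (isOpen_chartDomain x (isOpen_inter i j)).mem_nhds hy
    have hinv : ∀ z ∈ chartDomain I x (P.baseSet i ∩ P.baseSet j),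
        (P.trans j i ((extChartAt I x).symm z) : Mat N) =
          ((P.trans i j ((extChartAt I x).symm z))⁻¹ : Matrix.unitaryGroup (Fin N) ℂ) :=
      fun z hz => by rw [trans_symm hz.2]
    have key := flatCurv_gauge ((h.smooth i).differentiableAt (P.isOpen_baseSet i) hyi)
      ((h.smooth j).differentiableAt (P.isOpen_baseSet j) hyj) (contDiffAt_trans hy)
      ((contDiffAt_trans hyx).differentiableAt (by simp))
      (hev.mono fun z hz => by rw [hinv z hz, coe_mul_coe_inv])
      (by rw [hinv _ hy, coe_inv_mul_coe])
      (hev.mono fun z hz v => by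
        rw [inChart_apply, inChart_apply, h.change i j _ hz.2, fderiv_trans hz, hinv z hz]
        rfl) u w
    rw [hinv _ hy, extChartAt_to_inv] at key
    have e : ∀ k, x ∈ P.baseSet k → KapustinWitten.curvature I (A k) x u w =
        flatCurv (inChart I x (A k)) (extChartAt I x x) u w := by
      intro k hk
      have := curvature_chartDeriv (h.smooth k) (P.isOpen_baseSet k)
        (extChartAt_mem_chartDomain (I := I) hk) u w
      rwa [chartDeriv_self, extChartAt_to_inv] at this
    rw [e i hx.1, e j hx.2]
    exact key

/-- The covariant derivative of a 1-form of adjoint type is of adjoint type: it is the linear term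
of the curvature of the connections `A + s b`. -/
lemma IsSmoothConnection.covD (h : P.IsSmoothConnection A) (hb : P.IsSmoothAdForm b) :
    P.IsAdTwoForm (fun i => covD I (A i) (b i)) :=
  (((h.add hb).curvature.sub h.curvature).sub hb.commutator).congr fun i x hx u w => by
    rw [Pi.add_apply, curvature_add (h.smooth i) (hb.smooth i) (P.isOpen_baseSet i) hx]
    abel

end Manifold

end GaugeBundle

/-! ### Three-forms and the volume form -/

section Linear

variable {F : Type*} [AddCommGroup F] [Module ℝ F]

lemma eq_sum_e3 (v : E3) : v = v 0 • e3 0 + v 1 • e3 1 + v 2 • e3 2 := by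
  ext i
  fin_cases i <;> simp [e3]

lemma det_eq_det_e3 (L : E3 →L[ℝ] E3) :
    L.det = (Matrix.of fun i j => L (e3 j) i).det := by
  rw [ContinuousLinearMap.det, ← LinearMap.det_toMatrix (EuclideanSpace.basisFun (Fin 3) ℝ).toBasis]
  congr 1

/-- The cyclic sum of a trilinear map that is alternating in the last two variables is an
alternating 3-form, so a linear map multiplies its value on the standard basis by the
determinant. -/
lemma cyclic_sum_det {β : E3 → E3 → E3 → F} (hadd : ∀ u u' v w, β (u + u') v w = β u v w + β u' v w)
    (hsmul : ∀ (c : ℝ) u v w, β (c • u) v w = c • β u v w) (halt : ∀ u, IsAltForm (β u))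
    (L : E3 →L[ℝ] E3) :
    β (L (e3 0)) (L (e3 1)) (L (e3 2)) + β (L (e3 1)) (L (e3 2)) (L (e3 0)) +
        β (L (e3 2)) (L (e3 0)) (L (e3 1)) =
      L.det • (β (e3 0) (e3 1) (e3 2) + β (e3 1) (e3 2) (e3 0) + β (e3 2) (e3 0) (e3 1)) := by
  have h10 : ∀ u, β u (e3 1) (e3 0) = -β u (e3 0) (e3 1) := fun u => (halt u).swap _ _
  have h21 : ∀ u, β u (e3 2) (e3 1) = -β u (e3 1) (e3 2) := fun u => (halt u).swap _ _
  have h02 : ∀ u, β u (e3 0) (e3 2) = -β u (e3 2) (e3 0) := fun u => (halt u).swap _ _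
  have hs : ∀ u v, β u v v = 0 := fun u v => (halt u).self v
  have hl := fun u => (halt u).add_left
  have hr := fun u => (halt u).add_right
  have hsl := fun u => (halt u).smul_left
  have hsr := fun u => (halt u).smul_right
  rw [det_eq_det_e3, Matrix.det_fin_three]
  simp only [Matrix.of_apply]
  generalize L (e3 0) = a, L (e3 1) = b, L (e3 2) = c
  rw [eq_sum_e3 a, eq_sum_e3 b, eq_sum_e3 c]
  simp only [hadd, hsmul, hl, hr, hsl, hsr, h10, h21, h02, hs]
  simp [e3]
  module

lemma alternatingMap_det (f : E3 [⋀^Fin 3]→ₗ[ℝ] ℝ) (L : E3 →L[ℝ] E3) :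
    f (fun k => L (e3 k)) = L.det * f e3 := by
  set b := (EuclideanSpace.basisFun (Fin 3) ℝ).toBasis
  have hb : (b : Fin 3 → E3) = e3 := by
    ext i
    simp [b, e3]
  have h1 : (fun k => L (e3 k)) = (L : E3 →ₗ[ℝ] E3) ∘ b := by rw [hb]; rfl
  rw [f.eq_smul_basis_det b, h1]
  simp only [AlternatingMap.smul_apply, Module.Basis.det_comp, hb, smul_eq_mul]
  rw [← hb, Module.Basis.det_self]
  simp [ContinuousLinearMap.det, mul_comm]

end Linear

section Manifold

variable {E H M : Type*} [NormedAddCommGroup E] [NormedSpace ℝ E] [TopologicalSpace H]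
  [TopologicalSpace M] [ChartedSpace H M] {I : ModelWithCorners ℝ E H} [I.Boundaryless]
  [IsManifold I ∞ M]

/-- The coordinate vector fields of a chart are smooth. -/
lemma contMDiffAt_chartDeriv {p : M} {y : E} (hy : y ∈ (extChartAt I p).target) (u : E) :
    ContMDiffAt 𝓘(ℝ, E) (I.prod 𝓘(ℝ, E)) ∞ (fun z => Bundle.TotalSpace.mk' E
      (E := (TangentSpace I : M → Type _)) ((extChartAt I p).symm z) (chartDeriv I p z u)) y := by
  rw [Bundle.contMDiffAt_totalSpace]
  refine ⟨(contMDiffOn_extChartAt_symm p).contMDiffAt ((isOpen_extChartAt_target p).mem_nhds hy),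
    ?_⟩
  set q := (extChartAt I p).symm y
  have hyq : y ∈ chartDomain I p (extChartAt I q).source := ⟨hy, mem_extChartAt_source q⟩
  have h1 : ContDiffAt ℝ ∞ (fun z => fderiv ℝ (transition I p q) z u) y :=
    ((contDiffAt_transition p q hyq).fderiv_right (m := ∞) (by simp)).clm_apply contDiffAt_const
  rw [contMDiffAt_iff_contDiffAt]
  refine h1.congr_of_eventuallyEq ?_
  filter_upwards [(isOpen_chartDomain p (isOpen_extChartAt_source q)).mem_nhds hyq] with z hz
  have hz2 : (extChartAt I p).symm z ∈ (chartAt H q).source := by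
    simpa using hz.2
  have h2 := mfderiv_comp z (mdifferentiableAt_extChartAt (I := I) hz2)
    (mdifferentiableAt_extChartAt_symm hz.1)
  rw [mfderiv_eq_fderiv, ← TangentBundle.continuousLinearMapAt_trivializationAt hz2] at h2
  have h3 := congrArg (fun T : E →L[ℝ] E => T u) h2
  have hb : (extChartAt I p).symm z ∈ (trivializationAt E (TangentSpace I) q).baseSet := by
    simpa using hz2
  refine Eq.trans ?_ h3.symm
  exact (Bundle.Trivialization.continuousLinearMapAt_apply_of_mem ℝ _ hb _).symm

end Manifold

section ThreeManifold

variable {X : Type*} [TopologicalSpace X] [ChartedSpace E3 X]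

variable [IsManifold (𝓡 3) ∞ X] (g : OrientedMetric X)

/-- The metric at `x` as a continuous bilinear map. -/
noncomputable def OrientedMetric.formL (x : X) : E3 →L[ℝ] E3 →L[ℝ] ℝ := g.metric.inner x

lemma OrientedMetric.form_eq (x : X) (u w : E3) : g.form x u w = g.formL x u w := rfl

lemma OrientedMetric.form_symm (x : X) (u w : E3) : g.form x u w = g.form x w u :=
  g.metric.symm x u w

lemma OrientedMetric.form_pos (x : X) {u : E3} (hu : u ≠ 0) : 0 < g.form x u u :=
  g.metric.pos x u hu

/-- The matrix of the metric in the coordinate basis. -/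
noncomputable def OrientedMetric.gram (x : X) : Matrix (Fin 3) (Fin 3) ℝ :=
  Matrix.of fun k l => g.form x (e3 k) (e3 l)

lemma OrientedMetric.gram_posDef (x : X) : (g.gram x).PosDef := by
  refine Matrix.PosDef.of_dotProduct_mulVec_pos ?_ ?_
  · ext i j
    exact g.form_symm x _ _
  · intro c hc
    have hv : (∑ i, c i • e3 i : E3) ≠ 0 := by
      intro h
      apply hc
      ext i
      simpa [e3, Finset.sum_apply, Pi.single_apply] using congrArg (fun v : E3 => v i) h
    have := g.form_pos x hv
    refine this.trans_eq ?_
    simp only [g.form_eq, map_sum, map_smul, _root_.sum_apply, _root_.smul_apply,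
      dotProduct, Matrix.mulVec, OrientedMetric.gram, Matrix.of_apply, smul_eq_mul, star_trivial,
      Finset.mul_sum]
    refine Finset.sum_congr rfl fun i _ => Finset.sum_congr rfl fun j _ => ?_
    rw [← g.form_eq, ← g.form_eq, g.form_symm]
    ring

lemma OrientedMetric.vol_sq_e3 (x : X) : g.vol x e3 ^ 2 = (g.gram x).det := g.vol_sq x e3

lemma OrientedMetric.vol_e3_ne_zero (x : X) : g.vol x e3 ≠ 0 := by
  intro h
  have := (g.gram_posDef x).det_pos
  rw [← g.vol_sq_e3, h] at this
  simp at this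

lemma chartDeriv_det_ne_zero {p : X} {y : E3} (hy : y ∈ (extChartAt (𝓡 3) p).target) :
    (chartDeriv (𝓡 3) p y).det ≠ 0 := by
  have hyx : y ∈ chartDomain (𝓡 3) p (extChartAt (𝓡 3) ((extChartAt (𝓡 3) p).symm y)).source :=
    ⟨hy, mem_extChartAt_source _⟩
  have h := fderiv_transition_comp p _ hyx
  rw [← chartDeriv_eq_fderiv_transition hy] at h
  intro h0
  have h1 := congrArg ContinuousLinearMap.det h
  have h2 : ∀ A B : E3 →L[ℝ] E3, (A.comp B).det = A.det * B.det := fun A B =>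
    LinearMap.det_comp _ _
  rw [h2, h0, mul_zero] at h1
  simp [ContinuousLinearMap.det] at h1

/-- The coefficients of the metric in a chart are smooth. -/
lemma OrientedMetric.contDiffAt_form {p : X} {y : E3} (hy : y ∈ (extChartAt (𝓡 3) p).target)
    (u w : E3) : ContDiffAt ℝ ∞ (fun z => g.form ((extChartAt (𝓡 3) p).symm z)
      (chartDeriv (𝓡 3) p z u) (chartDeriv (𝓡 3) p z w)) y := by
  have hb : ContMDiffAt 𝓘(ℝ, E3) (𝓡 3) ∞ (extChartAt (𝓡 3) p).symm y :=
    (contMDiffOn_extChartAt_symm p).contMDiffAt ((isOpen_extChartAt_target p).mem_nhds hy)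
  have h : ContMDiffAt 𝓘(ℝ, E3) ((𝓡 3).prod 𝓘(ℝ)) ∞ (fun z => Bundle.TotalSpace.mk' ℝ
      (E := Bundle.Trivial X ℝ) ((extChartAt (𝓡 3) p).symm z)
      (g.metric.inner ((extChartAt (𝓡 3) p).symm z) (chartDeriv (𝓡 3) p z u)
        (chartDeriv (𝓡 3) p z w))) y := by
    apply ContMDiffAt.clm_bundle_apply₂ (F₁ := E3) (F₂ := E3)
    · exact g.metric.contMDiff.contMDiffAt.comp y hb
    · exact contMDiffAt_chartDeriv hy u
    · exact contMDiffAt_chartDeriv hy w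
  rw [Bundle.contMDiffAt_totalSpace] at h
  exact contMDiffAt_iff_contDiffAt.1 h.2

end ThreeManifold

/-! ### Integration of three-forms -/

section Integration

variable {X : Type*} [TopologicalSpace X] [ChartedSpace E3 X] [IsManifold (𝓡 3) ∞ X]
  {F : Type*} [NormedAddCommGroup F] [NormedSpace ℝ F]

/-- A continuous 3-form, presented as a field of functions of three vectors. As every triple of
vectors is the image of the standard basis under a linear map, the condition `det` says that these
functions are trilinear and alternating. -/
structure IsThreeForm (η : X → (Fin 3 → E3) → F) : Prop where
  cont : ∀ p, ContinuousOn (coeff p η) (extChartAt (𝓡 3) p).target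
  det : ∀ x (L : E3 →L[ℝ] E3), η x (fun k => L (e3 k)) = L.det • η x e3

lemma coeff_eq (p : X) (η : X → (Fin 3 → E3) → F) (y : E3) :
    coeff p η y = η ((extChartAt (𝓡 3) p).symm y) (fun k => chartDeriv (𝓡 3) p y (e3 k)) := rfl

namespace IsThreeForm

variable {η η' : X → (Fin 3 → E3) → F}

lemma add (h : IsThreeForm η) (h' : IsThreeForm η') : IsThreeForm (fun x v => η x v + η' x v) where
  cont p := (h.cont p).add (h'.cont p)
  det x L := by rw [h.det, h'.det, smul_add]

lemma const_smul {R : Type*} [Monoid R] [DistribMulAction R F] [SMulCommClass R ℝ F]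
    [ContinuousConstSMul R F] (h : IsThreeForm η) (c : R) :
    IsThreeForm (fun x v => c • η x v) where
  cont p := (h.cont p).const_smul c
  det x L := by rw [h.det, smul_comm]

lemma sum {κ : Type*} (s : Finset κ) {η : κ → X → (Fin 3 → E3) → F}
    (h : ∀ k ∈ s, IsThreeForm (η k)) : IsThreeForm (fun x v => ∑ k ∈ s, η k x v) where
  cont p := continuousOn_finsetSum s fun k hk => (h k hk).cont p
  det x L := by
    rw [Finset.smul_sum]
    exact Finset.sum_congr rfl fun k hk => (h k hk).det x L

lemma coeff_eq_det (h : IsThreeForm η) (p : X) (y : E3) :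
    coeff p η y = (chartDeriv (𝓡 3) p y).det • η ((extChartAt (𝓡 3) p).symm y) e3 := h.det _ _

/-- The coefficients of a 3-form in two charts differ by the Jacobian of the change of
coordinates. -/
lemma coeff_transition (h : IsThreeForm η) {p q : X} {y : E3}
    (hy : y ∈ chartDomain (𝓡 3) p (extChartAt (𝓡 3) q).source) :
    coeff p η y = (fderiv ℝ (transition (𝓡 3) p q) y).det •
      coeff q η (transition (𝓡 3) p q y) := by
  rw [h.coeff_eq_det, h.coeff_eq_det, chartDeriv_eq_comp p q hy, symm_transition p q hy, smul_smul,
    mul_comm]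
  congr 1
  exact LinearMap.det_comp _ _

end IsThreeForm

variable (g : OrientedMetric X)

lemma OrientedMetric.isThreeForm_vol : IsThreeForm (fun x v => g.vol x v) where
  cont p := (g.vol_smooth p).continuousOn
  det _ L := alternatingMap_det _ L

/-- The coefficient of the volume form in the chart at `p`. -/
noncomputable def OrientedMetric.volCoeff (p : X) (y : E3) : ℝ := coeff p (fun x v => g.vol x v) y

lemma OrientedMetric.volCoeff_ne_zero {p : X} {y : E3} (hy : y ∈ (extChartAt (𝓡 3) p).target) :
    g.volCoeff p y ≠ 0 := by
  rw [OrientedMetric.volCoeff, g.isThreeForm_vol.coeff_eq_det]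
  exact mul_ne_zero (chartDeriv_det_ne_zero hy) (g.vol_e3_ne_zero _)

lemma sign_eq_div_abs (r : ℝ) : Real.sign r = r / |r| := by
  rcases lt_trichotomy r 0 with h | h | h
  · rw [Real.sign_of_neg h, abs_of_neg h, div_neg, div_self h.ne]
  · simp [h]
  · rw [Real.sign_of_pos h, abs_of_pos h, div_self h.ne']

lemma OrientedMetric.contDiffAt_volCoeff {p : X} {y : E3}
    (hy : y ∈ (extChartAt (𝓡 3) p).target) : ContDiffAt ℝ ∞ (g.volCoeff p) y :=
  (g.vol_smooth p).contDiffAt ((isOpen_extChartAt_target p).mem_nhds hy)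

/-- The orientation sign of a chart is locally constant. -/
lemma OrientedMetric.sign_eventuallyEq {p : X} {y : E3} (hy : y ∈ (extChartAt (𝓡 3) p).target) :
    ∀ᶠ z in 𝓝 y, Real.sign (g.volCoeff p z) = Real.sign (g.volCoeff p y) := by
  have hc := (g.contDiffAt_volCoeff hy).continuousAt
  rcases lt_or_gt_of_ne (g.volCoeff_ne_zero hy) with h | h
  · filter_upwards [hc.eventually (gt_mem_nhds h)] with z hz
    rw [Real.sign_of_neg hz, Real.sign_of_neg h]
  · filter_upwards [hc.eventually (lt_mem_nhds h)] with z hz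
    rw [Real.sign_of_pos hz, Real.sign_of_pos h]

lemma OrientedMetric.continuousOn_sign (p : X) :
    ContinuousOn (fun y => Real.sign (g.volCoeff p y)) (extChartAt (𝓡 3) p).target := fun _ hy =>
  (continuousAt_const.congr (EventuallyEq.symm (g.sign_eventuallyEq hy))).continuousWithinAt

/-- The orientation signs of two charts differ by the sign of the Jacobian. -/
lemma OrientedMetric.sign_transition {p q : X} {y : E3}
    (hy : y ∈ chartDomain (𝓡 3) p (extChartAt (𝓡 3) q).source) :
    |(fderiv ℝ (transition (𝓡 3) p q) y).det| * Real.sign (g.volCoeff q (transition (𝓡 3) p q y)) =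
      (fderiv ℝ (transition (𝓡 3) p q) y).det * Real.sign (g.volCoeff p y) := by
  have h := g.isThreeForm_vol.coeff_transition hy
  rw [OrientedMetric.volCoeff, OrientedMetric.volCoeff, h, sign_eq_div_abs, sign_eq_div_abs,
    smul_eq_mul, abs_mul]
  have hd := abs_mul_abs_self (fderiv ℝ (transition (𝓡 3) p q) y).det
  by_cases h0 : (fderiv ℝ (transition (𝓡 3) p q) y).det = 0
  · simp [h0]
  by_cases h1 : coeff q (fun x v => g.vol x v) (transition (𝓡 3) p q y) = 0
  · simp [h1]
  field_simp
  rw [sq_abs]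

/-- The integral over the chart at `p` of a 3-form, with the sign of the orientation. -/
noncomputable def chartIntegral (p : X) (η : X → (Fin 3 → E3) → F) : F :=
  ∫ y in (extChartAt (𝓡 3) p).target, Real.sign (g.volCoeff p y) • coeff p η y

/-- A continuous function on a chart that vanishes off a compact subset of it is integrable. -/
lemma integrableOn_chart {p : X} {f : E3 → F}
    (hf : ContinuousOn f (extChartAt (𝓡 3) p).target) {K : Set X} (hK : IsCompact K)
    (hKp : K ⊆ (extChartAt (𝓡 3) p).source)
    (h0 : ∀ y ∈ (extChartAt (𝓡 3) p).target, (extChartAt (𝓡 3) p).symm y ∉ K → f y = 0) :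
    IntegrableOn f (extChartAt (𝓡 3) p).target := by
  have hK' : IsCompact (extChartAt (𝓡 3) p '' K) :=
    hK.image_of_continuousOn ((continuousOn_extChartAt p).mono hKp)
  have hsub : extChartAt (𝓡 3) p '' K ⊆ (extChartAt (𝓡 3) p).target := by
    rintro _ ⟨x, hx, rfl⟩
    exact (extChartAt (𝓡 3) p).map_source (hKp hx)
  refine ((hf.mono hsub).integrableOn_compact hK').of_forall_sdiff_eq_zero
    (isOpen_extChartAt_target p).measurableSet ?_
  rintro y ⟨hy, hyK⟩
  refine h0 y hy fun h => hyK ⟨_, h, (extChartAt (𝓡 3) p).right_inv hy⟩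

variable {η : X → (Fin 3 → E3) → F}

lemma integrableOn_chartIntegral (hη : IsThreeForm η) {p : X} {K : Set X} (hK : IsCompact K)
    (hKp : K ⊆ (extChartAt (𝓡 3) p).source) (h0 : ∀ x ∉ K, ∀ v, η x v = 0) :
    IntegrableOn (fun y => Real.sign (g.volCoeff p y) • coeff p η y)
      (extChartAt (𝓡 3) p).target :=
  integrableOn_chart ((g.continuousOn_sign p).smul (hη.cont p)) hK hKp fun y _ hy => by
    rw [coeff_eq, h0 _ hy, smul_zero]

/-- Multiplication of a 3-form by a continuous function. -/
lemma IsThreeForm.smul (hη : IsThreeForm η) {χ : X → ℝ} (hχ : Continuous χ) :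
    IsThreeForm (fun x v => χ x • η x v) where
  cont p := (hχ.comp_continuousOn (continuousOn_extChartAt_symm p)).smul (hη.cont p)
  det x L := by rw [hη.det, smul_comm]

/-- The change of variables formula: the integral of a 3-form supported in the intersection of two
charts can be computed in either of them. -/
lemma chartIntegral_eq (hη : IsThreeForm η) {p q : X}
    (h0 : ∀ x, x ∉ (extChartAt (𝓡 3) p).source ∩ (extChartAt (𝓡 3) q).source → ∀ v, η x v = 0) :
    chartIntegral g q η = chartIntegral g p η := by
  have hop := isOpen_chartDomain (I := 𝓡 3) p (isOpen_extChartAt_source (I := 𝓡 3) q)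
  have hoq := isOpen_chartDomain (I := 𝓡 3) q (isOpen_extChartAt_source (I := 𝓡 3) p)
  have e : ∀ r s : X, (∀ x, x ∉ (extChartAt (𝓡 3) s).source → ∀ v, η x v = 0) →
      chartIntegral g r η = ∫ y in chartDomain (𝓡 3) r (extChartAt (𝓡 3) s).source,
        Real.sign (g.volCoeff r y) • coeff r η y := by
    intro r s h
    refine setIntegral_eq_of_subset_of_forall_sdiff_eq_zero
      (isOpen_extChartAt_target r).measurableSet (fun y hy => hy.1) ?_
    rintro y ⟨hy, hy'⟩
    rw [coeff_eq, h _ (fun h' => hy' ⟨hy, h'⟩), smul_zero]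
  rw [e q p fun x hx => h0 x fun h => hx h.1, e p q fun x hx => h0 x fun h => hx h.2]
  have himg : transition (𝓡 3) p q '' chartDomain (𝓡 3) p (extChartAt (𝓡 3) q).source =
      chartDomain (𝓡 3) q (extChartAt (𝓡 3) p).source := by
    refine Subset.antisymm ?_ fun y hy =>
      ⟨transition (𝓡 3) q p y, transition_mem q p hy, transition_transition q p hy⟩
    rintro _ ⟨y, hy, rfl⟩
    exact transition_mem p q hy
  have hinj : InjOn (transition (𝓡 3) p q) (chartDomain (𝓡 3) p (extChartAt (𝓡 3) q).source) :=
    fun y hy z hz h => by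
      rw [← transition_transition p q hy, h, transition_transition p q hz]
  rw [← himg, integral_image_eq_integral_abs_det_fderiv_smul volume hop.measurableSet
    (fun y hy => ((contDiffAt_transition p q hy).differentiableAt
      (by simp)).hasFDerivAt.hasFDerivWithinAt) hinj]
  refine setIntegral_congr_fun hop.measurableSet fun y hy => ?_
  rw [smul_smul, g.sign_transition hy, hη.coeff_transition hy, smul_smul, mul_comm]

end Integration

section Integration

variable {X : Type*} [TopologicalSpace X] [ChartedSpace E3 X] [IsManifold (𝓡 3) ∞ X]
  [T2Space X] [CompactSpace X]
  {F : Type*} [NormedAddCommGroup F] [NormedSpace ℝ F]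

lemma chartPartition_subordinate (p : X) :
    tsupport (chartPartition X p) ⊆ (extChartAt (𝓡 3) p).source := by
  rw [extChartAt_source]
  exact (SmoothPartitionOfUnity.exists_isSubordinate_chartAt_source (𝓡 3) X).choose_spec p

lemma isCompact_tsupport_chartPartition (p : X) : IsCompact (tsupport (chartPartition X p)) :=
  (isClosed_tsupport _).isCompact

lemma finite_chartPartition : {p : X | ∃ x, chartPartition X p x ≠ 0}.Finite := by
  have := (chartPartition X).locallyFinite.finite_nonempty_of_compact
  simpa [Set.Nonempty] using this

variable (X) in
/-- The labels of the functions of the partition of unity that do not vanish identically. -/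
noncomputable def partitionSupport : Finset X := finite_chartPartition (X := X).toFinset

lemma chartPartition_eq_zero {p : X} (hp : p ∉ partitionSupport X) (x : X) :
    chartPartition X p x = 0 := by
  by_contra h
  exact hp ((Set.Finite.mem_toFinset _).2 ⟨x, h⟩)

lemma sum_chartPartition (x : X) : ∑ p ∈ partitionSupport X, chartPartition X p x = 1 :=
  (chartPartition X).sum_finsupport' x (mem_univ x) fun p hp => by
    by_contra h
    exact ((chartPartition X).mem_finsupport x).1 hp (chartPartition_eq_zero h x)

lemma continuous_chartPartition (p : X) : Continuous (chartPartition X p) :=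
  (chartPartition X p).contMDiff.continuous

variable (g : OrientedMetric X) {η η' : X → (Fin 3 → E3) → F}

/-- The integral over `X` is the sum of the integrals over the charts of the pieces cut out by the
partition of unity. -/
lemma integralForm_eq_sum (η : X → (Fin 3 → E3) → F) :
    integralForm g η =
      ∑ p ∈ partitionSupport X, chartIntegral g p (fun x v => chartPartition X p x • η x v) := by
  rw [integralForm, finsum_eq_sum_of_support_subset]
  · refine Finset.sum_congr rfl fun p _ => ?_
    refine setIntegral_congr_fun (isOpen_extChartAt_target p).measurableSet fun y _ => ?_
    rw [coeff_eq _ (fun x v => _ • η x v), smul_smul, mul_comm]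
    rfl
  · intro p hp
    by_contra h
    refine hp ?_
    simp only [chartPartition_eq_zero h, zero_mul, zero_smul, integral_zero]

lemma integrableOn_partition (hη : IsThreeForm η) (p : X) :
    IntegrableOn (fun y => Real.sign (g.volCoeff p y) •
      coeff p (fun x v => chartPartition X p x • η x v) y) (extChartAt (𝓡 3) p).target := by
  refine integrableOn_chartIntegral g (hη.smul (continuous_chartPartition p))
    (isCompact_tsupport_chartPartition p) (chartPartition_subordinate p) fun x hx v => ?_
  rw [image_eq_zero_of_notMem_tsupport hx, zero_smul]

lemma integralForm_congr (h : ∀ x v, η x v = η' x v) : integralForm g η = integralForm g η' := by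
  have : η = η' := funext₂ h
  rw [this]

lemma integralForm_add (hη : IsThreeForm η) (hη' : IsThreeForm η') :
    integralForm g (fun x v => η x v + η' x v) = integralForm g η + integralForm g η' := by
  simp only [integralForm_eq_sum]
  rw [← Finset.sum_add_distrib]
  refine Finset.sum_congr rfl fun p _ => ?_
  rw [chartIntegral, chartIntegral, chartIntegral,
    ← integral_add (integrableOn_partition g hη p) (integrableOn_partition g hη' p)]
  simp only [coeff_eq, smul_add]

lemma integralForm_smul {𝕜 : Type*} [RCLike 𝕜] [NormedSpace 𝕜 F] [SMulCommClass ℝ 𝕜 F] (c : 𝕜)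
    (η : X → (Fin 3 → E3) → F) :
    integralForm g (fun x v => c • η x v) = c • integralForm g η := by
  simp only [integralForm_eq_sum, Finset.smul_sum]
  refine Finset.sum_congr rfl fun p _ => ?_
  rw [chartIntegral, chartIntegral, ← integral_smul]
  simp only [coeff_eq, smul_comm _ c]

lemma integralForm_sum {κ : Type*} (s : Finset κ) {η : κ → X → (Fin 3 → E3) → F}
    (h : ∀ k ∈ s, IsThreeForm (η k)) :
    integralForm g (fun x v => ∑ k ∈ s, η k x v) = ∑ k ∈ s, integralForm g (η k) := by
  classical
  induction s using Finset.induction_on with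
  | empty => simp [integralForm, coeff_eq]
  | insert k s hk ih =>
    simp only [Finset.sum_insert hk]
    rw [integralForm_add g (h k (Finset.mem_insert_self _ _))
      (IsThreeForm.sum s fun j hj => h j (Finset.mem_insert_of_mem hj)),
      ih fun j hj => h j (Finset.mem_insert_of_mem hj)]

/-- The integral of a 3-form supported in a chart is its integral over that chart. -/
lemma integralForm_eq_chartIntegral (hη : IsThreeForm η) {q : X} {K : Set X} (hK : IsCompact K)
    (hKq : K ⊆ (extChartAt (𝓡 3) q).source) (h0 : ∀ x ∉ K, ∀ v, η x v = 0) :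
    integralForm g η = chartIntegral g q η := by
  rw [integralForm_eq_sum]
  have h1 : ∀ p ∈ partitionSupport X,
      chartIntegral g p (fun x v => chartPartition X p x • η x v) =
        chartIntegral g q (fun x v => chartPartition X p x • η x v) := fun p _ =>
    chartIntegral_eq g (hη.smul (continuous_chartPartition p)) fun x hx v => by
      by_cases hxK : x ∈ K
      · have : x ∉ tsupport (chartPartition X p) := fun h =>
          hx ⟨hKq hxK, chartPartition_subordinate p h⟩
        rw [image_eq_zero_of_notMem_tsupport this, zero_smul]
      · rw [h0 x hxK, smul_zero]
  rw [Finset.sum_congr rfl h1]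
  simp only [chartIntegral]
  rw [← integral_finsetSum]
  · refine setIntegral_congr_fun (isOpen_extChartAt_target q).measurableSet fun y _ => ?_
    simp only [coeff_eq]
    rw [← Finset.smul_sum, ← Finset.sum_smul, sum_chartPartition, one_smul]
  · intro p _
    exact integrableOn_chartIntegral g (hη.smul (continuous_chartPartition p)) hK hKq
      fun x hx v => by rw [h0 x hx, smul_zero]

/-- A continuous 3-form that is a nonnegative multiple of the volume form and has vanishing
integral is zero. -/
lemma eq_zero_of_integralForm_eq_zero {h : X → ℝ} (hh : ∀ x, 0 ≤ h x)
    (hη : IsThreeForm (fun x v => h x * g.vol x v))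
    (h0 : integralForm g (fun x v => h x * g.vol x v) = 0) (x : X) : h x = 0 := by
  have hnn : ∀ p y, 0 ≤ Real.sign (g.volCoeff p y) •
      coeff p (fun x v => chartPartition X p x • (h x * g.vol x v)) y := by
    intro p y
    have h1 := Real.sign_mul_nonneg (g.volCoeff p y)
    have h2 := (chartPartition X).nonneg p ((extChartAt (𝓡 3) p).symm y)
    have h3 := mul_nonneg (mul_nonneg h2 (hh ((extChartAt (𝓡 3) p).symm y))) h1
    refine h3.trans_eq ?_
    simp only [coeff_eq, smul_eq_mul, OrientedMetric.volCoeff]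
    ring
  rw [integralForm_eq_sum, Finset.sum_eq_zero_iff_of_nonneg fun p _ => integral_nonneg (hnn p)]
    at h0
  obtain ⟨p, hp⟩ := (chartPartition X).exists_pos_of_mem (mem_univ x)
  have hpS : p ∈ partitionSupport X := by
    by_contra hc
    exact hp.ne' (chartPartition_eq_zero hc x)
  have hxs : x ∈ (extChartAt (𝓡 3) p).source :=
    chartPartition_subordinate p (subset_tsupport _ hp.ne')
  have h1 := (setIntegral_eq_zero_iff_of_nonneg_ae (Eventually.of_forall (hnn p))
    (integrableOn_partition g hη p)).1 (h0 p hpS)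
  have hc : ContinuousOn (fun y => Real.sign (g.volCoeff p y) •
      coeff p (fun x v => chartPartition X p x • (h x * g.vol x v)) y)
      (extChartAt (𝓡 3) p).target :=
    (g.continuousOn_sign p).smul ((hη.smul (continuous_chartPartition p)).cont p)
  -- a continuous function that vanishes almost everywhere on an open set vanishes on it
  have h2 := Measure.eqOn_open_of_ae_eq h1 (isOpen_extChartAt_target p) hc continuousOn_const
    ((extChartAt (𝓡 3) p).map_source hxs)
  have h3 := g.volCoeff_ne_zero ((extChartAt (𝓡 3) p).map_source hxs)
  have h4 := Real.sign_mul_pos_of_ne_zero _ h3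
  simp only [coeff_eq, (extChartAt (𝓡 3) p).left_inv hxs, smul_eq_mul, Pi.zero_apply] at h2
  simp only [OrientedMetric.volCoeff, coeff_eq, (extChartAt (𝓡 3) p).left_inv hxs] at h2 h4
  by_contra hne
  refine hp.ne' ?_
  have h5 : chartPartition X p x * h x * (Real.sign (g.vol x fun k =>
      chartDeriv (𝓡 3) p (extChartAt (𝓡 3) p x) (e3 k)) * (g.vol x fun k =>
      chartDeriv (𝓡 3) p (extChartAt (𝓡 3) p x) (e3 k))) = 0 := by
    rw [← h2]; ring
  rcases mul_eq_zero.1 h5 with h6 | h6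
  · exact (mul_eq_zero.1 h6).resolve_right hne
  · exact absurd h6 h4.ne'

end Integration

/-! ### Stokes' theorem -/

/-- Integration by parts against the constant function `1`. -/
lemma integral_fderiv_eq_zero {V F : Type*} [NormedAddCommGroup V] [NormedSpace ℝ V]
    [FiniteDimensional ℝ V] [MeasurableSpace V] [BorelSpace V] [NormedAddCommGroup F]
    [NormedSpace ℝ F] (μ : Measure V) [μ.IsAddHaarMeasure] {f : V → F} (hf : ContDiff ℝ 1 f)
    (hc : HasCompactSupport f) (v : V) : ∫ y, fderiv ℝ f y v ∂μ = 0 := by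
  have h1 : Integrable f μ := hf.continuous.integrable_of_hasCompactSupport hc
  have h2 : Integrable (fun y => fderiv ℝ f y v) μ :=
    ((hf.continuous_fderiv (by simp)).clm_apply continuous_const).integrable_of_hasCompactSupport
      (hc.fderiv_apply (𝕜 := ℝ) v)
  have := integral_smul_fderiv_eq_neg_fderiv_smul_of_integrable (μ := μ) (f := fun _ : V => (1 : ℝ))
    (g := f) (v := v) (by simp) (by simpa using h2) (by simpa using h1)
    (fun _ _ => differentiableAt_const _) (fun x _ => (hf.differentiable (by simp)) x)
  simpa using this

section Integration

variable {X : Type*} [TopologicalSpace X] [ChartedSpace E3 X] [IsManifold (𝓡 3) ∞ X]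
  {F : Type*} [NormedAddCommGroup F] [NormedSpace ℝ F]

/-- A smooth 2-form. -/
structure IsTwoForm (τ : X → E3 → E3 → F) : Prop where
  alt : ∀ x, IsAltForm (τ x)
  smooth : ∀ p u w, ∀ y ∈ (extChartAt (𝓡 3) p).target, ContDiffAt ℝ ∞ (fun z =>
    τ ((extChartAt (𝓡 3) p).symm z) (chartDeriv (𝓡 3) p z u) (chartDeriv (𝓡 3) p z w)) y

/-- The coefficient `τ(∂_{k+1}, ∂_{k+2})`, with indices modulo 3, of a 2-form in a chart. -/
noncomputable def twoCoeff (p : X) (τ : X → E3 → E3 → F) (k : Fin 3) (y : E3) : F :=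
  τ ((extChartAt (𝓡 3) p).symm y) (chartDeriv (𝓡 3) p y (e3 (k + 1)))
    (chartDeriv (𝓡 3) p y (e3 (k + 2)))

/-- The differential of a real function. -/
noncomputable def scalarD (χ : X → ℝ) (x : X) : E3 →L[ℝ] ℝ := mfderiv (𝓡 3) 𝓘(ℝ, ℝ) χ x

/-- The 3-form `dχ ∧ τ`. -/
noncomputable def dWedge (χ : X → ℝ) (τ : X → E3 → E3 → F) (x : X) (v : Fin 3 → E3) : F :=
  scalarD χ x (v 0) • τ x (v 1) (v 2) +
    scalarD χ x (v 1) • τ x (v 2) (v 0) +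
    scalarD χ x (v 2) • τ x (v 0) (v 1)

variable {χ : X → ℝ} {τ : X → E3 → E3 → F}

lemma fderiv_comp_symm (hχ : ContMDiff (𝓡 3) 𝓘(ℝ, ℝ) ∞ χ) {p : X} {y : E3}
    (hy : y ∈ (extChartAt (𝓡 3) p).target) (v : E3) :
    fderiv ℝ (χ ∘ (extChartAt (𝓡 3) p).symm) y v =
      scalarD χ ((extChartAt (𝓡 3) p).symm y)
        (chartDeriv (𝓡 3) p y v) := by
  have h := mfderiv_comp y ((hχ.mdifferentiable (by simp)) _)
    (mdifferentiableAt_extChartAt_symm (I := 𝓡 3) hy)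
  rw [mfderiv_eq_fderiv] at h
  exact congrArg (fun T : E3 →L[ℝ] ℝ => T v) h

lemma contDiffAt_comp_symm (hχ : ContMDiff (𝓡 3) 𝓘(ℝ, ℝ) ∞ χ) {p : X} {y : E3}
    (hy : y ∈ (extChartAt (𝓡 3) p).target) :
    ContDiffAt ℝ ∞ (χ ∘ (extChartAt (𝓡 3) p).symm) y := by
  rw [← contMDiffAt_iff_contDiffAt]
  exact hχ.contMDiffAt.comp y
    ((contMDiffOn_extChartAt_symm p).contMDiffAt ((isOpen_extChartAt_target p).mem_nhds hy))

lemma coeff_dWedge (hχ : ContMDiff (𝓡 3) 𝓘(ℝ, ℝ) ∞ χ) {p : X} {y : E3}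
    (hy : y ∈ (extChartAt (𝓡 3) p).target) :
    coeff p (dWedge χ τ) y =
      ∑ k, fderiv ℝ (χ ∘ (extChartAt (𝓡 3) p).symm) y (e3 k) • twoCoeff p τ k y := by
  simp only [fderiv_comp_symm hχ hy, Fin.sum_univ_three, coeff_eq, dWedge]
  rfl

lemma isThreeForm_dWedge (hχ : ContMDiff (𝓡 3) 𝓘(ℝ, ℝ) ∞ χ) (hτ : IsTwoForm τ) :
    IsThreeForm (dWedge χ τ) where
  cont p := by
    have h : ContinuousOn (fun y => ∑ k, fderiv ℝ (χ ∘ (extChartAt (𝓡 3) p).symm) y (e3 k) •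
        twoCoeff p τ k y) (extChartAt (𝓡 3) p).target := by
      refine continuousOn_finsetSum _ fun k _ y hy => ?_
      have h1 := ((contDiffAt_comp_symm hχ hy).fderiv_right (m := ∞) (by simp)).clm_apply
        (contDiffAt_const (c := e3 k))
      exact (h1.continuousAt.smul
        (hτ.smooth p (e3 (k + 1)) (e3 (k + 2)) y hy).continuousAt).continuousWithinAt
    exact h.congr fun y hy => coeff_dWedge hχ hy
  det x L := cyclic_sum_det
    (β := fun u v w => scalarD χ x u • τ x v w)
    (fun u u' v w => by rw [map_add, add_smul]) (fun c u v w => by rw [map_smul, smul_assoc])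
    (fun u => by
      have h := (hτ.alt x).real_smul (scalarD χ x u)
      exact h) L

variable [T2Space X] [CompactSpace X] (g : OrientedMetric X)

/-- A divergence with compact support in a chart has integral zero. -/
lemma integral_sign_divergence {p : X} (W : Fin 3 → E3 → F)
    (hW : ∀ k, ∀ y ∈ (extChartAt (𝓡 3) p).target, ContDiffAt ℝ ∞ (W k) y) {K : Set X}
    (hK : IsCompact K) (hKp : K ⊆ (extChartAt (𝓡 3) p).source)
    (h0 : ∀ k, ∀ y ∈ (extChartAt (𝓡 3) p).target, (extChartAt (𝓡 3) p).symm y ∉ K → W k y = 0) :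
    ∫ y in (extChartAt (𝓡 3) p).target,
      Real.sign (g.volCoeff p y) • ∑ k, fderiv ℝ (W k) y (e3 k) = 0 := by
  have hT := isOpen_extChartAt_target (I := 𝓡 3) p
  have hK' : IsCompact (extChartAt (𝓡 3) p '' K) :=
    hK.image_of_continuousOn ((continuousOn_extChartAt p).mono hKp)
  have hsub : extChartAt (𝓡 3) p '' K ⊆ (extChartAt (𝓡 3) p).target := by
    rintro _ ⟨x, hx, rfl⟩
    exact (extChartAt (𝓡 3) p).map_source (hKp hx)
  -- extend the components, with the locally constant sign, by zero to all of space
  set f : Fin 3 → E3 → F := fun k => (extChartAt (𝓡 3) p).target.indicator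
    fun y => Real.sign (g.volCoeff p y) • W k y with hf
  have hfT : ∀ k, ∀ y ∈ (extChartAt (𝓡 3) p).target,
      f k =ᶠ[𝓝 y] fun z => Real.sign (g.volCoeff p y) • W k z := by
    intro k y hy
    filter_upwards [hT.mem_nhds hy, g.sign_eventuallyEq hy] with z hz hs
    rw [hf]
    simp only [indicator_of_mem hz, hs]
  have hfK : ∀ k, ∀ y ∉ extChartAt (𝓡 3) p '' K, f k y = 0 := by
    intro k y hy
    by_cases hyT : y ∈ (extChartAt (𝓡 3) p).target
    · rw [hf]
      simp only [indicator_of_mem hyT]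
      rw [h0 k y hyT fun h => hy ⟨_, h, (extChartAt (𝓡 3) p).right_inv hyT⟩, smul_zero]
    · exact indicator_of_notMem hyT _
  have hfc : ∀ k, HasCompactSupport (f k) := fun k => HasCompactSupport.intro hK' (hfK k)
  have hfd : ∀ k, ContDiff ℝ 1 (f k) := by
    refine fun k => contDiff_iff_contDiffAt.2 fun y => ?_
    by_cases hyT : y ∈ (extChartAt (𝓡 3) p).target
    · exact ((contDiffAt_const.smul ((hW k y hyT).of_le (by
        exact WithTop.coe_le_coe.2 le_top))).congr_of_eventuallyEq (hfT k y hyT))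
    · refine contDiffAt_const (c := (0 : F)) |>.congr_of_eventuallyEq ?_
      filter_upwards [hK'.isClosed.isOpen_compl.mem_nhds fun h => hyT (hsub h)] with z hz
      exact hfK k z hz
  have hfd0 : ∀ k, ∀ y ∉ (extChartAt (𝓡 3) p).target, fderiv ℝ (f k) y = 0 := by
    intro k y hyT
    have h1 : f k =ᶠ[𝓝 y] fun _ => 0 := by
      filter_upwards [hK'.isClosed.isOpen_compl.mem_nhds fun h => hyT (hsub h)] with z hz
      exact hfK k z hz
    rw [h1.fderiv_eq]
    simp
  have h1 : ∫ y in (extChartAt (𝓡 3) p).target,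
      Real.sign (g.volCoeff p y) • ∑ k, fderiv ℝ (W k) y (e3 k) =
        ∫ y in (extChartAt (𝓡 3) p).target, ∑ k, fderiv ℝ (f k) y (e3 k) := by
    refine setIntegral_congr_fun hT.measurableSet fun y hy => ?_
    rw [Finset.smul_sum]
    refine Finset.sum_congr rfl fun k _ => ?_
    rw [(hfT k y hy).fderiv_eq,
      fderiv_fun_const_smul ((hW k y hy).differentiableAt (by simp))]
    rfl
  rw [h1, setIntegral_eq_integral_of_forall_compl_eq_zero, integral_finsetSum]
  · exact Finset.sum_eq_zero fun k _ => integral_fderiv_eq_zero volume (hfd k) (hfc k) _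
  · intro k _
    exact (((hfd k).continuous_fderiv (by simp)).clm_apply
      continuous_const).integrable_of_hasCompactSupport ((hfc k).fderiv_apply (𝕜 := ℝ) _)
  · intro y hy
    exact Finset.sum_eq_zero fun k _ => by rw [hfd0 k y hy]; rfl

/-- Stokes' theorem: the integral of an exact 3-form vanishes. The exterior derivative is expressed
as a divergence in every chart. A partition of unity `ρ_p` reduces it to the vanishing of the
integral of `d(ρ_p τ)` and to `∑ dρ_p ∧ τ = 0`. -/
theorem integralForm_eq_zero_of_exact {η : X → (Fin 3 → E3) → F} (hη : IsThreeForm η)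
    (hτ : IsTwoForm τ) (hd : ∀ p, ∀ y ∈ (extChartAt (𝓡 3) p).target,
      coeff p η y = ∑ k, fderiv ℝ (twoCoeff p τ k) y (e3 k)) :
    integralForm g η = 0 := by
  have hsm : ∀ p : X, ContMDiff (𝓡 3) 𝓘(ℝ, ℝ) ∞ (chartPartition X p) := fun p =>
    (chartPartition X p).contMDiff
  have h3 : ∀ p : X, IsThreeForm (dWedge (chartPartition X p) τ) := fun p =>
    isThreeForm_dWedge (hsm p) hτ
  have hsupp : ∀ p : X, ∀ x ∉ tsupport (chartPartition X p), ∀ v,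
      dWedge (chartPartition X p) τ x v = 0 := by
    intro p x hx v
    have h1 : (chartPartition X p : X → ℝ) =ᶠ[𝓝 x] fun _ => 0 :=
      notMem_tsupport_iff_eventuallyEq.1 hx
    have h2 : scalarD (chartPartition X p) x = 0 := by
      rw [scalarD, h1.mfderiv_eq, mfderiv_const]
      rfl
    have h3 : ∀ u : E3, scalarD (chartPartition X p) x u = 0 := fun u => by rw [h2]; rfl
    simp only [dWedge, h3, zero_smul, add_zero]
  -- the integral of `ρ_p dτ + dρ_p ∧ τ = d(ρ_p τ)` vanishes
  have h1 : ∀ p ∈ partitionSupport X, chartIntegral g p (fun x v => chartPartition X p x • η x v) =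
      -integralForm g (dWedge (chartPartition X p) τ) := by
    intro p _
    rw [integralForm_eq_chartIntegral g (h3 p) (isCompact_tsupport_chartPartition p)
      (chartPartition_subordinate p) (hsupp p), eq_neg_iff_add_eq_zero, chartIntegral,
      chartIntegral, ← integral_add (integrableOn_partition g hη p)
      (integrableOn_chartIntegral g (h3 p) (isCompact_tsupport_chartPartition p)
      (chartPartition_subordinate p) (hsupp p))]
    have hW : ∀ k, ∀ y ∈ (extChartAt (𝓡 3) p).target, ContDiffAt ℝ ∞ (twoCoeff p τ k) y :=
      fun k y hy => hτ.smooth p _ _ y hy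
    refine Eq.trans ?_ (integral_sign_divergence g (p := p)
      (fun k y => (chartPartition X p ∘ (extChartAt (𝓡 3) p).symm) y • twoCoeff p τ k y)
      (fun k y hy => (contDiffAt_comp_symm (hsm p) hy).smul (hW k y hy))
      (isCompact_tsupport_chartPartition p) (chartPartition_subordinate p)
      fun k y _ hyK => by
        simp only [Function.comp_apply, image_eq_zero_of_notMem_tsupport hyK, zero_smul])
    refine setIntegral_congr_fun (isOpen_extChartAt_target p).measurableSet fun y hy => ?_
    have e1 : coeff p (fun x v => chartPartition X p x • η x v) y =
        (chartPartition X p ∘ (extChartAt (𝓡 3) p).symm) y • coeff p η y := rfl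
    rw [e1, hd p y hy, coeff_dWedge (hsm p) hy, ← smul_add, Finset.smul_sum,
      ← Finset.sum_add_distrib]
    congr 1
    refine Finset.sum_congr rfl fun k _ => ?_
    rw [fderiv_fun_smul ((contDiffAt_comp_symm (hsm p) hy).differentiableAt (by simp))
      ((hW k y hy).differentiableAt (by simp))]
    simp
  rw [integralForm_eq_sum, Finset.sum_congr rfl h1, Finset.sum_neg_distrib, neg_eq_zero,
    ← integralForm_sum g _ fun p _ => h3 p]
  -- the differentials of the functions of the partition of unity add up to zero
  have h4 : ∀ x (u : E3), ∑ p ∈ partitionSupport X,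
      scalarD (chartPartition X p) x u = 0 := by
    intro x u
    have hx := mem_extChartAt_target (I := 𝓡 3) x
    have e : ∀ p, scalarD (chartPartition X p) x u =
        fderiv ℝ (chartPartition X p ∘ (extChartAt (𝓡 3) x).symm) (extChartAt (𝓡 3) x x) u := by
      intro p
      rw [fderiv_comp_symm (hsm p) hx, chartDeriv_self, extChartAt_to_inv]
      rfl
    simp only [e]
    rw [← _root_.sum_apply, ← fderiv_fun_sum fun p _ =>
      (contDiffAt_comp_symm (hsm p) hx).differentiableAt (by simp)]
    simp only [Function.comp_apply, sum_chartPartition]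
    simp
  have h5 : ∀ x v, ∑ p ∈ partitionSupport X, dWedge (chartPartition X p) τ x v = 0 := by
    intro x v
    simp only [dWedge, Finset.sum_add_distrib, ← Finset.sum_smul, h4, zero_smul, add_zero]
  simp [h5, integralForm, coeff_eq]

end Integration

/-! ### The first variation of the Chern–Simons functional -/

section TraceAlgebra

variable {N : ℕ}

lemma trace_bracket_cycle (x y z : Mat N) :
    (x * (y * z - z * y)).trace = (y * (z * x - x * z)).trace := by
  simp only [mul_sub, Matrix.trace_sub, ← mul_assoc]
  rw [Matrix.trace_mul_cycle x y z, Matrix.trace_mul_cycle z x y, Matrix.trace_mul_cycle x z y]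

lemma trace_bracket_swap (x A y : Mat N) :
    (x * (A * y - y * A)).trace = -(y * (A * x - x * A)).trace := by
  rw [trace_bracket_cycle x A y, trace_bracket_cycle A y x, ← Matrix.trace_neg, ← mul_neg, neg_sub]

lemma trace_real_smul (r : ℝ) (Z : Mat N) : (r • Z).trace = r * Z.trace := by
  rw [Matrix.trace_smul, Complex.real_smul]

end TraceAlgebra

section ThreeManifold

variable {X : Type*} [TopologicalSpace X] [ChartedSpace E3 X]
  {N : ℕ} {U : Set X} {A₀ 𝒜 a b : OneForm E3 X N}

/-- By cyclicity the three terms of `tr (a ∧ a ∧ a)` agree. -/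
lemma trWedge_cubic (a : E3 → Mat N) (v : Fin 3 → E3) :
    (1 / 3 : ℂ) * trWedge a (fun u w => a u * a w - a w * a u) v =
      (a (v 0) * (a (v 1) * a (v 2) - a (v 2) * a (v 1))).trace := by
  have h1 := trace_bracket_cycle (a (v 0)) (a (v 1)) (a (v 2))
  have h2 := trace_bracket_cycle (a (v 1)) (a (v 2)) (a (v 0))
  simp only [trWedge]
  linear_combination (-(2 : ℂ) / 3) * h1 - (1 / 3 : ℂ) * h2

/-- The Chern–Simons form along a line of connections is a cubic polynomial. Its linear coefficient
is `tr (b ∧ F)` up to the exact form `tr (a ∧ d_{A₀} b) - tr (b ∧ d_{A₀} a)`. -/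
lemma csForm_line (hA₀ : SmoothOn (𝓡 3) U A₀) (h𝒜 : SmoothOn (𝓡 3) U 𝒜)
    (hb : SmoothOn (𝓡 3) U b) (hU : IsOpen U) {x : X} (hx : x ∈ U) (v : Fin 3 → E3) (s : ℝ) :
    csForm A₀ (𝒜 + s • b) x v = csForm A₀ 𝒜 x v +
      s * (trWedge (b x) (curvature (𝓡 3) 𝒜 x) v +
        (1 / 2) * (trWedge ((𝒜 - A₀) x) (covD (𝓡 3) A₀ b x) v -
          trWedge (b x) (covD (𝓡 3) A₀ (𝒜 - A₀) x) v)) +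
      s ^ 2 * ((1 / 2) * trWedge (b x) (covD (𝓡 3) A₀ b x) v +
        trWedge ((𝒜 - A₀) x) (fun u w => b x u * b x w - b x w * b x u) v) +
      s ^ 3 * ((1 / 3) * trWedge (b x) (fun u w => b x u * b x w - b x w * b x u) v) := by
  obtain ⟨a, ha⟩ : ∃ a, a = 𝒜 - A₀ := ⟨_, rfl⟩
  have has : SmoothOn (𝓡 3) U a := ha ▸ h𝒜.sub hA₀
  have h1 : 𝒜 + s • b - A₀ = a + s • b := by rw [ha]; abel
  have h2 : 𝒜 = A₀ + a := by rw [ha]; abel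
  have hF : ∀ u w, curvature (𝓡 3) 𝒜 x u w = curvature (𝓡 3) A₀ x u w +
      covD (𝓡 3) A₀ a x u w + (a x u * a x w - a x w * a x u) := fun u w => by
    rw [h2, curvature_add hA₀ has hU hx]
  have hD : ∀ u w, covD (𝓡 3) A₀ (a + s • b) x u w =
      covD (𝓡 3) A₀ a x u w + s • covD (𝓡 3) A₀ b x u w := fun u w => by
    rw [covD_add A₀ has (hb.real_smul s) hU hx, covD_real_smul A₀ hb hU hx]
  simp only [csForm, h1, ← ha, trWedge_cubic]
  have hab : ∀ u, (a + s • b) x u = a x u + s • b x u := fun _ => rfl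
  simp only [trWedge, hF, hD, hab]
  generalize covD (𝓡 3) A₀ a x = Da, covD (𝓡 3) A₀ b x = Db, curvature (𝓡 3) A₀ x = F0
  generalize a x (v 0) = a0, a x (v 1) = a1, a x (v 2) = a2, b x (v 0) = b0, b x (v 1) = b1,
    b x (v 2) = b2
  have k1 := trace_bracket_cycle a0 b1 a2
  have k2 := trace_bracket_cycle a0 a1 b2
  have k3 := trace_bracket_cycle a1 b2 a0
  have k4 := trace_bracket_cycle b0 a1 b2
  have k5 := trace_bracket_cycle b0 b1 a2
  have k6 := trace_bracket_cycle b1 a2 b0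
  simp only [mul_sub, mul_add, add_mul, smul_mul_assoc, mul_smul_comm, Matrix.trace_add,
    Matrix.trace_sub, trace_real_smul] at k1 k2 k3 k4 k5 k6 ⊢
  linear_combination (s : ℂ) * (k1 + k2 + k3) + (s : ℂ) ^ 2 * (k4 + k5 + k6)

end ThreeManifold

section Flat

variable {E F 𝔸 : Type*} [NormedAddCommGroup E] [NormedSpace ℝ E] [NormedAddCommGroup F]
  [NormedSpace ℝ F] [NormedRing 𝔸] [NormedAlgebra ℝ 𝔸]

lemma hasFDerivAt_apply {a : E → E →L[ℝ] F} {y : E} (ha : DifferentiableAt ℝ a y) (w : E) :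
    HasFDerivAt (fun z => a z w) ((fderiv ℝ a y).flip w) y := by
  simpa using ha.hasFDerivAt.clm_apply (hasFDerivAt_const w y)

lemma fderiv_clm_mul_apply (T : 𝔸 →L[ℝ] F) {a b : E → E →L[ℝ] 𝔸} {y : E}
    (ha : DifferentiableAt ℝ a y) (hb : DifferentiableAt ℝ b y) (u w v : E) :
    fderiv ℝ (fun z => T (a z u * b z w) - T (a z w * b z u)) y v =
      T (fderiv ℝ a y v u * b y w + a y u * fderiv ℝ b y v w) -
        T (fderiv ℝ a y v w * b y u + a y w * fderiv ℝ b y v u) := by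
  have h : ∀ u w, HasFDerivAt (fun z => T (a z u * b z w)) _ y := fun u w =>
    T.hasFDerivAt.comp y ((hasFDerivAt_apply ha u).mul' (hasFDerivAt_apply hb w))
  have h2 : HasFDerivAt (fun z => T (a z u * b z w) - T (a z w * b z u)) _ y :=
    (h u w).sub (h w u)
  rw [h2.fderiv]
  simp [add_comm]

lemma contDiffAt_clm_mul_apply (T : 𝔸 →L[ℝ] F) {a b : E → E →L[ℝ] 𝔸} {y : E}
    (ha : ContDiffAt ℝ ∞ a y) (hb : ContDiffAt ℝ ∞ b y) (u w : E) :
    ContDiffAt ℝ ∞ (fun z => T (a z u * b z w) - T (a z w * b z u)) y := by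
  have h1 : ∀ v, ContDiffAt ℝ ∞ (fun z => a z v) y := fun v => ha.clm_apply contDiffAt_const
  have h2 : ∀ v, ContDiffAt ℝ ∞ (fun z => b z v) y := fun v => hb.clm_apply contDiffAt_const
  exact (T.contDiff.contDiffAt.comp y ((h1 u).mul (h2 w))).sub
    (T.contDiff.contDiffAt.comp y ((h1 w).mul (h2 u)))

end Flat

/-- The trace as a continuous real linear map. -/
noncomputable def traceL (N : ℕ) : Mat N →L[ℝ] ℂ :=
  LinearMap.toContinuousLinearMap (Matrix.traceLinearMap (Fin N) ℝ ℂ)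

lemma traceL_apply {N : ℕ} (Z : Mat N) : traceL N Z = Z.trace := rfl

section ThreeManifold

variable {X : Type*} [TopologicalSpace X] [ChartedSpace E3 X]
  {N : ℕ} {ι : Type*} {G : Subgroup (Matrix.unitaryGroup (Fin N) ℂ)} {P : GaugeBundle (𝓡 3) X G ι}
  {A₀ 𝒜 a b : ι → OneForm E3 X N} {Ω : ι → X → E3 → E3 → Mat N}

/-- The expression `tr (b ∧ Ω)` does not depend on the trivialization. -/
lemma trWedge_change (hb : P.IsSmoothAdForm b) (hΩ : P.IsAdTwoForm Ω) {i j : ι} {x : X}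
    (hx : x ∈ P.baseSet i ∩ P.baseSet j) (v : Fin 3 → E3) :
    trWedge (b i x) (Ω i x) v = trWedge (b j x) (Ω j x) v := by
  simp only [trWedge, hb.change i j x hx, hΩ.change i j x hx, ← GaugeBundle.adj_mul,
    GaugeBundle.trace_adj]

/-- The covariant derivative in a chart. -/
lemma covD_chartDeriv [IsManifold (𝓡 3) ∞ X] {U : Set X} {α β : OneForm E3 X N}
    (hβ : SmoothOn (𝓡 3) U β) (hU : IsOpen U) {p : X} {y : E3} (hy : y ∈ chartDomain (𝓡 3) p U)
    (u w : E3) :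
    covD (𝓡 3) α β ((extChartAt (𝓡 3) p).symm y) (chartDeriv (𝓡 3) p y u)
        (chartDeriv (𝓡 3) p y w) =
      flatD (inChart (𝓡 3) p β) y u w +
        ((inChart (𝓡 3) p α y u * inChart (𝓡 3) p β y w -
            inChart (𝓡 3) p β y w * inChart (𝓡 3) p α y u) -
          (inChart (𝓡 3) p α y w * inChart (𝓡 3) p β y u -
            inChart (𝓡 3) p β y u * inChart (𝓡 3) p α y w)) := by
  rw [covD, extD_chartDeriv hy.1 (hβ.differentiableAt hU hy)]
  rfl

/-- The 2-form `tr (b ∧ a)` on the base, for 1-forms of adjoint type. -/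
noncomputable def traceTwo (P : GaugeBundle (𝓡 3) X G ι) (b a : ι → OneForm E3 X N) (x : X)
    (u w : E3) : ℂ :=
  traceL N (b (P.indexAt x) x u * a (P.indexAt x) x w) -
    traceL N (b (P.indexAt x) x w * a (P.indexAt x) x u)

lemma traceTwo_eq (hb : P.IsSmoothAdForm b) (ha : P.IsSmoothAdForm a) {i : ι} {x : X}
    (hx : x ∈ P.baseSet i) (u w : E3) :
    traceTwo P b a x u w = traceL N (b i x u * a i x w) - traceL N (b i x w * a i x u) := by
  have hx' := And.intro (P.mem_baseSet_at x) hx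
  simp only [traceTwo, traceL_apply, hb.change _ _ x hx', ha.change _ _ x hx',
    ← GaugeBundle.adj_mul, GaugeBundle.trace_adj]

variable [IsManifold (𝓡 3) ∞ X]

/-- `tr (b ∧ Ω)` is a continuous 3-form on the base. -/
lemma isThreeForm_trWedge (hb : P.IsSmoothAdForm b) (hΩ : P.IsAdTwoForm Ω) :
    IsThreeForm (fun x v => trWedge (b (P.indexAt x) x) (Ω (P.indexAt x) x) v) where
  cont p := fun y hy => by
    set i := P.indexAt ((extChartAt (𝓡 3) p).symm y)
    have hyi : y ∈ chartDomain (𝓡 3) p (P.baseSet i) := ⟨hy, P.mem_baseSet_at _⟩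
    have hb1 : ∀ u, ContinuousAt (fun z => inChart (𝓡 3) p (b i) z u) y := fun u =>
      (((hb.smooth i).contDiffAt (P.isOpen_baseSet i) hyi).clm_apply
        contDiffAt_const).continuousAt
    have hΩ1 := fun u w => (hΩ.smooth i p u w y hyi).continuousAt
    have h1 : ∀ u v w, ContinuousAt (fun z => (inChart (𝓡 3) p (b i) z u *
        Ω i ((extChartAt (𝓡 3) p).symm z) (chartDeriv (𝓡 3) p z v)
          (chartDeriv (𝓡 3) p z w)).trace) y := fun u v w =>
      (traceL N).continuous.continuousAt.comp ((hb1 u).mul (hΩ1 v w))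
    refine ContinuousAt.continuousWithinAt ((((h1 (e3 0) (e3 1) (e3 2)).add
      (h1 (e3 1) (e3 2) (e3 0))).add (h1 (e3 2) (e3 0) (e3 1))).congr ?_)
    filter_upwards [(isOpen_chartDomain p (P.isOpen_baseSet i)).mem_nhds hyi] with z hz
    rw [coeff_eq, trWedge_change hb hΩ ⟨P.mem_baseSet_at _, hz.2⟩]
    rfl
  det x L := by
    have hL := hΩ.alt _ x (P.mem_baseSet_at x)
    refine cyclic_sum_det (β := fun u v w => (b (P.indexAt x) x u *
      Ω (P.indexAt x) x v w).trace) ?_ ?_ ?_ L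
    · intro u u' v w
      rw [map_add, add_mul, Matrix.trace_add]
    · intro c u v w
      rw [map_smul, smul_mul_assoc, Matrix.trace_smul]
    · refine fun u => ⟨fun v v' w => ?_, fun c v w => ?_, fun v w => ?_⟩
      · rw [hL.add_left, mul_add, Matrix.trace_add]
      · rw [hL.smul_left, mul_smul_comm, Matrix.trace_smul]
      · rw [hL.swap v w, mul_neg, Matrix.trace_neg]

lemma isTwoForm_traceTwo (hb : P.IsSmoothAdForm b) (ha : P.IsSmoothAdForm a) :
    IsTwoForm (traceTwo P b a) where
  alt x := by
    refine ⟨fun u u' w => ?_, fun c u w => ?_, fun u w => ?_⟩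
    · simp only [traceTwo, map_add, add_mul, mul_add]; ring
    · simp only [traceTwo, map_smul, smul_mul_assoc, mul_smul_comm, smul_sub]
    · simp only [traceTwo]; ring
  smooth p u w y hy := by
    set i := P.indexAt ((extChartAt (𝓡 3) p).symm y)
    have hyi : y ∈ chartDomain (𝓡 3) p (P.baseSet i) := ⟨hy, P.mem_baseSet_at _⟩
    refine (contDiffAt_clm_mul_apply (traceL N) ((hb.smooth i).contDiffAt (P.isOpen_baseSet i) hyi)
      ((ha.smooth i).contDiffAt (P.isOpen_baseSet i) hyi) u w).congr_of_eventuallyEq ?_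
    filter_upwards [(isOpen_chartDomain p (P.isOpen_baseSet i)).mem_nhds hyi] with z hz
    exact traceTwo_eq hb ha hz.2 _ _

/-- `tr (a ∧ d_{A₀} b) - tr (b ∧ d_{A₀} a)` is the exterior derivative of `tr (b ∧ a)`: by
invariance of the trace the terms with `A₀` cancel. -/
lemma coeff_exact (ha : P.IsSmoothAdForm a)
    (hb : P.IsSmoothAdForm b) {p : X} {y : E3} (hy : y ∈ (extChartAt (𝓡 3) p).target) :
    coeff p (fun x v =>
        trWedge (a (P.indexAt x) x) (covD (𝓡 3) (A₀ (P.indexAt x)) (b (P.indexAt x)) x) v -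
          trWedge (b (P.indexAt x) x) (covD (𝓡 3) (A₀ (P.indexAt x)) (a (P.indexAt x)) x) v) y =
      ∑ k, fderiv ℝ (twoCoeff p (traceTwo P b a) k) y (e3 k) := by
  obtain ⟨i, hi⟩ : ∃ i, P.indexAt ((extChartAt (𝓡 3) p).symm y) = i := ⟨_, rfl⟩
  have hyi : y ∈ chartDomain (𝓡 3) p (P.baseSet i) := ⟨hy, hi ▸ P.mem_baseSet_at _⟩
  have hda := (ha.smooth i).differentiableAt (P.isOpen_baseSet i) hyi
  have hdb := (hb.smooth i).differentiableAt (P.isOpen_baseSet i) hyi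
  have h1 : ∀ k, fderiv ℝ (twoCoeff p (traceTwo P b a) k) y (e3 k) = _ := fun k => by
    have : twoCoeff p (traceTwo P b a) k =ᶠ[𝓝 y] fun z =>
        traceL N (inChart (𝓡 3) p (b i) z (e3 (k + 1)) * inChart (𝓡 3) p (a i) z (e3 (k + 2))) -
          traceL N (inChart (𝓡 3) p (b i) z (e3 (k + 2)) *
            inChart (𝓡 3) p (a i) z (e3 (k + 1))) := by
      filter_upwards [(isOpen_chartDomain p (P.isOpen_baseSet i)).mem_nhds hyi] with z hz
      exact traceTwo_eq hb ha hz.2 _ _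
    rw [this.fderiv_eq, fderiv_clm_mul_apply (traceL N) hdb hda]
  simp only [h1]
  rw [coeff_eq]
  simp only [hi, trWedge, covD_chartDeriv (ha.smooth i) (P.isOpen_baseSet i) hyi,
    covD_chartDeriv (hb.smooth i) (P.isOpen_baseSet i) hyi, ← inChart_apply, flatD,
    Fin.sum_univ_three, traceL_apply]
  simp only [Fin.reduceAdd, Fin.isValue, zero_add]
  generalize inChart (𝓡 3) p (a i) y = a', inChart (𝓡 3) p (b i) y = b',
    inChart (𝓡 3) p (A₀ i) y = A', fderiv ℝ (inChart (𝓡 3) p (a i)) y = da,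
    fderiv ℝ (inChart (𝓡 3) p (b i)) y = db
  -- invariance of the trace cancels the terms with `A₀`, cyclicity matches those with `db`
  have t := fun j k l => trace_bracket_swap (a' (e3 j)) (A' (e3 k)) (b' (e3 l))
  have c := fun j k l => Matrix.trace_mul_comm (a' (e3 j)) (db (e3 k) (e3 l))
  have t1 := t 0 1 2
  have t2 := t 1 2 0
  have t3 := t 2 0 1
  have t4 := t 0 2 1
  have t5 := t 1 0 2
  have t6 := t 2 1 0
  simp only [mul_sub, mul_add, Matrix.trace_add, Matrix.trace_sub, c] at t1 t2 t3 t4 t5 t6 ⊢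
  linear_combination t1 + t2 + t3 - t4 - t5 - t6

variable [T2Space X] [CompactSpace X] (g : OrientedMetric X)

/-- The integral of a cubic polynomial with 3-forms as coefficients has the integral of the linear
coefficient as its derivative at `0`. -/
lemma hasDerivAt_integralForm_cubic {η₀ η₁ η₂ η₃ : X → (Fin 3 → E3) → ℂ} (h₀ : IsThreeForm η₀)
    (h₁ : IsThreeForm η₁) (h₂ : IsThreeForm η₂) (h₃ : IsThreeForm η₃) :
    HasDerivAt (fun s : ℝ => integralForm g fun x v =>
        η₀ x v + (s : ℂ) • η₁ x v + ((s : ℂ) ^ 2) • η₂ x v + ((s : ℂ) ^ 3) • η₃ x v)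
      (integralForm g η₁) 0 := by
  have key : (fun s : ℝ => integralForm g fun x v =>
        η₀ x v + (s : ℂ) • η₁ x v + ((s : ℂ) ^ 2) • η₂ x v + ((s : ℂ) ^ 3) • η₃ x v) =
      fun s : ℝ => integralForm g η₀ + (s : ℂ) * integralForm g η₁ +
        (s : ℂ) ^ 2 * integralForm g η₂ + (s : ℂ) ^ 3 * integralForm g η₃ := by
    funext s
    rw [integralForm_add g ((h₀.add (h₁.const_smul (s : ℂ))).add (h₂.const_smul ((s : ℂ) ^ 2)))
        (h₃.const_smul ((s : ℂ) ^ 3)),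
      integralForm_add g (h₀.add (h₁.const_smul (s : ℂ))) (h₂.const_smul ((s : ℂ) ^ 2)),
      integralForm_add g h₀ (h₁.const_smul (s : ℂ)), integralForm_smul, integralForm_smul,
      integralForm_smul]
    rfl
  rw [key]
  have hs : HasDerivAt (fun s : ℝ => (s : ℂ)) 1 0 := Complex.ofRealCLM.hasDerivAt
  have h := (((hasDerivAt_const (0 : ℝ) (integralForm g η₀)).add
    (hs.mul_const (integralForm g η₁))).add ((hs.pow 2).mul_const (integralForm g η₂))).add
      ((hs.pow 3).mul_const (integralForm g η₃))
  exact h.congr_deriv (by simp)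

/-- The first variation of the Chern–Simons functional is `∫ tr (b ∧ F)`. -/
lemma hasDerivAt_csForm (hA₀ : P.IsSmoothConnection A₀) (h𝒜 : P.IsSmoothConnection 𝒜)
    (hb : P.IsSmoothAdForm b) :
    HasDerivAt (fun s : ℝ => integralForm g fun x v =>
        csForm (A₀ (P.indexAt x)) (𝒜 (P.indexAt x) + s • b (P.indexAt x)) x v)
      (integralForm g fun x v =>
        trWedge (b (P.indexAt x) x) (curvature (𝓡 3) (𝒜 (P.indexAt x)) x) v) 0 := by
  have ha := h𝒜.sub hA₀
  have f0 : IsThreeForm (fun x v => csForm (A₀ (P.indexAt x)) (𝒜 (P.indexAt x)) x v) :=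
    ((isThreeForm_trWedge ha hA₀.curvature).add
      ((isThreeForm_trWedge ha (hA₀.covD ha)).const_smul (1 / 2 : ℂ))).add
      ((isThreeForm_trWedge ha ha.commutator).const_smul (1 / 3 : ℂ))
  have f1 := isThreeForm_trWedge hb h𝒜.curvature
  have f2 := (isThreeForm_trWedge ha (hA₀.covD hb)).add
    ((isThreeForm_trWedge hb (hA₀.covD ha)).const_smul (-1 : ℂ))
  have f3 := ((isThreeForm_trWedge hb (hA₀.covD hb)).const_smul (1 / 2 : ℂ)).add
    (isThreeForm_trWedge ha hb.commutator)
  have f4 := (isThreeForm_trWedge hb hb.commutator).const_smul (1 / 3 : ℂ)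
  -- the part of the linear coefficient that is exact
  have hex := integralForm_eq_zero_of_exact g f2 (isTwoForm_traceTwo hb ha) fun p y hy => by
    rw [← coeff_exact (A₀ := A₀) ha hb hy]
    simp only [coeff_eq, neg_smul, one_smul, ← sub_eq_add_neg]
  have h := hasDerivAt_integralForm_cubic g f0 (f1.add (f2.const_smul (1 / 2 : ℂ))) f3 f4
  rw [integralForm_add g f1 (f2.const_smul (1 / 2 : ℂ)), integralForm_smul, hex, smul_zero,
    add_zero] at h
  refine h.congr_of_eventuallyEq (Eventually.of_forall fun s => integralForm_congr g fun x v => ?_)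
  rw [csForm_line (hA₀.smooth (P.indexAt x)) (h𝒜.smooth _) (hb.smooth _)
        (P.isOpen_baseSet _) (P.mem_baseSet_at x) v s]
  simp only [smul_eq_mul, Pi.sub_apply]
  ring

end ThreeManifold

/-! ### The Hodge star in dimension three and the pointwise inner product -/

section Star

variable {X : Type*} [TopologicalSpace X] [ChartedSpace E3 X] [IsManifold (𝓡 3) ∞ X]
  (g : OrientedMetric X) {F : Type*} [NormedAddCommGroup F] [NormedSpace ℝ F]

/-- The Hodge star of a 2-form on the three-manifold, in terms of its values
`η(∂₁, ∂₂), η(∂₂, ∂₀), η(∂₀, ∂₁)`. -/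
noncomputable def star3 (x : X) (η : E3 → E3 → F) : E3 →L[ℝ] F :=
  (g.vol x e3)⁻¹ • ∑ l, (g.formL x (e3 l)).smulRight (η (e3 (l + 1)) (e3 (l + 2)))

variable {g}

lemma star3_apply (x : X) (η : E3 → E3 → F) (w : E3) :
    star3 g x η w = (g.vol x e3)⁻¹ • ∑ l, g.form x w (e3 l) • η (e3 (l + 1)) (e3 (l + 2)) := by
  simp only [star3, _root_.smul_apply, _root_.sum_apply, ContinuousLinearMap.smulRight_apply,
    ← g.form_eq, g.form_symm x w]

/-- The formula for the Hodge star holds in every frame, not only in the coordinate one. -/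
lemma star3_frame {x : X} {η : E3 → E3 → F} (hη : IsAltForm η) (L : E3 →L[ℝ] E3) (w : E3) :
    g.vol x (fun k => L (e3 k)) • star3 g x η w =
      ∑ l, g.form x w (L (e3 l)) • η (L (e3 (l + 1))) (L (e3 (l + 2))) := by
  have h := cyclic_sum_det (β := fun u v v' => g.form x w u • η v v') (fun u u' v v' => by
    simp only [g.form_eq, map_add, add_smul]) (fun c u v v' => by
    simp only [g.form_eq, map_smul, smul_assoc]) (fun u => hη.real_smul _) L
  rw [alternatingMap_det, star3_apply, smul_smul, mul_assoc, mul_inv_cancel₀ (g.vol_e3_ne_zero x),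
    mul_one]
  simpa [Fin.sum_univ_three] using h.symm

lemma star3_add (x : X) (η η' : E3 → E3 → F) :
    star3 g x (fun u w => η u w + η' u w) = star3 g x η + star3 g x η' := by
  ext w
  simp only [star3_apply, _root_.add_apply, smul_add, Finset.sum_add_distrib]

lemma star3_map {F' : Type*} [NormedAddCommGroup F'] [NormedSpace ℝ F'] (T : F →ₗ[ℝ] F') (x : X)
    (η : E3 → E3 → F) (w : E3) : star3 g x (fun u v => T (η u v)) w = T (star3 g x η w) := by
  simp only [star3_apply, map_smul, map_sum]

lemma star3_mem {S : Submodule ℝ F} {x : X} {η : E3 → E3 → F} (h : ∀ u w, η u w ∈ S) (w : E3) :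
    star3 g x η w ∈ S := by
  rw [star3_apply]
  exact S.smul_mem _ (S.sum_mem fun l _ => S.smul_mem _ (h _ _))

end Star

section ThreeManifold

variable {X : Type*} [TopologicalSpace X] [ChartedSpace E3 X] [IsManifold (𝓡 3) ∞ X]
  {g : OrientedMetric X}
  {N : ℕ} {ι : Type*} {G : Subgroup (Matrix.unitaryGroup (Fin N) ℂ)} {P : GaugeBundle (𝓡 3) X G ι}
  {a b : ι → OneForm E3 X N} {Ω : ι → X → E3 → E3 → Mat N}

lemma contDiffAt_clm_of_apply {V W F : Type*} [NormedAddCommGroup V] [NormedSpace ℝ V]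
    [NormedAddCommGroup W] [NormedSpace ℝ W] [FiniteDimensional ℝ W] [NormedAddCommGroup F]
    [NormedSpace ℝ F] {f : V → W →L[ℝ] F} {y : V} {U : Set V} (hU : IsOpen U) (hy : y ∈ U)
    (h : ∀ w, ∀ z ∈ U, ContDiffAt ℝ ∞ (fun z => f z w) z) : ContDiffAt ℝ ∞ f y :=
  (contDiffOn_clm_apply.2 fun w z hz => (h w z hz).contDiffWithinAt).contDiffAt (hU.mem_nhds hy)

/-- The Hodge star of a 2-form with values in the adjoint bundle. -/
lemma isAdForm_star3 (hΩ : P.IsAdTwoForm Ω)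
    (hmem : ∀ i, ∀ x ∈ P.baseSet i, ∀ u w, Ω i x u w ∈ lieSubmodule G) :
    P.IsAdForm (fun i x => star3 g x (Ω i x)) where
  mem i x hx := star3_mem (hmem i x hx)
  change i j x hx v := by
    have h : Ω i x = fun u w => P.adj i j x (Ω j x u w) := funext₂ (hΩ.change i j x hx)
    rw [h]
    let T : Mat N →ₗ[ℝ] Mat N :=
      { toFun := P.adj i j x
        map_add' := P.adj_add i j x
        map_smul' := P.adj_real_smul i j x }
    exact star3_map T x (Ω j x) v
  smooth i := by
    rw [smoothOn_iff (P.isOpen_baseSet i)]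
    intro p y hy
    refine contDiffAt_clm_of_apply (isOpen_chartDomain p (P.isOpen_baseSet i)) hy fun w z hz => ?_
    have h : ContDiffAt ℝ ∞ (fun z => (g.volCoeff p z)⁻¹ • ∑ l,
        g.form ((extChartAt (𝓡 3) p).symm z) (chartDeriv (𝓡 3) p z w)
          (chartDeriv (𝓡 3) p z (e3 l)) • Ω i ((extChartAt (𝓡 3) p).symm z)
          (chartDeriv (𝓡 3) p z (e3 (l + 1))) (chartDeriv (𝓡 3) p z (e3 (l + 2)))) z :=
      ((g.contDiffAt_volCoeff hz.1).inv (g.volCoeff_ne_zero hz.1)).smul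
        (ContDiffAt.sum fun l _ => (g.contDiffAt_form hz.1 _ _).smul (hΩ.smooth i p _ _ z hz))
    refine h.congr_of_eventuallyEq ?_
    filter_upwards [(isOpen_chartDomain p (P.isOpen_baseSet i)).mem_nhds hz] with q hq
    rw [inChart_apply, ← star3_frame (hΩ.alt i _ hq.2) (chartDeriv (𝓡 3) p q), smul_smul]
    exact (by rw [inv_mul_cancel₀ (g.volCoeff_ne_zero hq.1), one_smul] :
      ((g.volCoeff p q)⁻¹ * g.volCoeff p q) • _ = _).symm

lemma exists_clm_e3 (v : Fin 3 → E3) : ∃ L : E3 →L[ℝ] E3, v = fun k => L (e3 k) := by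
  refine ⟨LinearMap.toContinuousLinearMap
    ((EuclideanSpace.basisFun (Fin 3) ℝ).toBasis.constr ℝ v), ?_⟩
  funext k
  simp [e3]

lemma IsThreeForm.ext {F : Type*} [NormedAddCommGroup F] [NormedSpace ℝ F]
    {η η' : X → (Fin 3 → E3) → F} (h : IsThreeForm η) (h' : IsThreeForm η')
    (he : ∀ x, η x e3 = η' x e3) : η = η' := by
  funext x v
  obtain ⟨L, rfl⟩ := exists_clm_e3 v
  rw [h.det, h'.det, he]

/-- The matrix of the values `Re tr (a(u_i) b(u_j))` in a frame. -/
noncomputable def traceMatrix (a b : E3 → Mat N) (L : E3 →L[ℝ] E3) : Matrix (Fin 3) (Fin 3) ℝ :=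
  Matrix.of fun i j => (a (L (e3 i)) * b (L (e3 j))).trace.re

/-- The Gram matrix of a frame. -/
noncomputable def gramFrame (g : OrientedMetric X) (x : X) (L : E3 →L[ℝ] E3) :
    Matrix (Fin 3) (Fin 3) ℝ :=
  Matrix.of fun i j => g.form x (L (e3 i)) (L (e3 j))

/-- The matrix of an endomorphism of the model space in the standard basis. -/
noncomputable def frameMatrix (L : E3 →L[ℝ] E3) : Matrix (Fin 3) (Fin 3) ℝ :=
  Matrix.of fun i j => L (e3 j) i

lemma apply_e3_eq_sum (L : E3 →L[ℝ] E3) (j : Fin 3) :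
    L (e3 j) = ∑ i, frameMatrix L i j • e3 i := by
  rw [eq_sum_e3 (L (e3 j)), Fin.sum_univ_three]
  rfl

lemma gramFrame_eq (x : X) (L : E3 →L[ℝ] E3) :
    gramFrame g x L = (frameMatrix L)ᵀ * g.gram x * frameMatrix L := by
  ext i j
  simp only [gramFrame, Matrix.of_apply, apply_e3_eq_sum L, g.form_eq, map_sum, map_smul,
    _root_.sum_apply, _root_.smul_apply, smul_eq_mul, Matrix.mul_apply, Matrix.transpose_apply,
    OrientedMetric.gram, Finset.mul_sum, Finset.sum_mul]
  exact Finset.sum_congr rfl fun k _ => Finset.sum_congr rfl fun l _ => by ring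

lemma traceMatrix_eq (a b : E3 →L[ℝ] Mat N) (L : E3 →L[ℝ] E3) :
    traceMatrix a b L =
      (frameMatrix L)ᵀ * traceMatrix a b (ContinuousLinearMap.id ℝ E3) * frameMatrix L := by
  ext i j
  simp only [traceMatrix, Matrix.of_apply, apply_e3_eq_sum L, map_sum, map_smul,
    Matrix.mul_apply, Matrix.transpose_apply, Finset.mul_sum, Finset.sum_mul,
    Matrix.trace_sum, smul_mul_assoc, mul_smul_comm, trace_real_smul,
    ContinuousLinearMap.id_apply, Complex.re_sum, Complex.re_ofReal_mul]
  exact Finset.sum_congr rfl fun k _ => Finset.sum_congr rfl fun l _ => by ring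

/-- The pointwise inner product can be computed in every frame. -/
lemma pointInner_frame (x : X) (a b : E3 →L[ℝ] Mat N) {L : E3 →L[ℝ] E3} (hL : L.det ≠ 0) :
    pointInner g x a b = -((gramFrame g x L)⁻¹ * (traceMatrix a b L)ᵀ).trace := by
  have hM : IsUnit (frameMatrix L).det := by
    rw [det_eq_det_e3] at hL
    exact hL.isUnit
  have hMt : IsUnit (frameMatrix L)ᵀ.det := by rwa [Matrix.det_transpose]
  rw [gramFrame_eq, traceMatrix_eq, Matrix.transpose_mul, Matrix.transpose_mul,
    Matrix.transpose_transpose, Matrix.mul_inv_rev, Matrix.mul_inv_rev]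
  set M := frameMatrix L
  set T := traceMatrix a b (ContinuousLinearMap.id ℝ E3) with hT
  have h1 : M⁻¹ * ((g.gram x)⁻¹ * Mᵀ⁻¹) * (Mᵀ * (Tᵀ * M)) = M⁻¹ * ((g.gram x)⁻¹ * Tᵀ) * M := by
    calc _ = M⁻¹ * ((g.gram x)⁻¹ * (Mᵀ⁻¹ * Mᵀ) * Tᵀ) * M := by simp only [mul_assoc]
      _ = _ := by rw [Matrix.nonsing_inv_mul _ hMt, mul_one]
  rw [h1, Matrix.trace_mul_cycle, Matrix.mul_nonsing_inv _ hM, one_mul, Matrix.trace, pointInner]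
  refine congrArg _ (Finset.sum_congr rfl fun i _ => ?_)
  simp only [Matrix.diag_apply, Matrix.mul_apply, Matrix.transpose_apply, hT, traceMatrix,
    Matrix.of_apply]
  rfl

lemma pointInner_eq_trace (x : X) (a b : E3 →L[ℝ] Mat N) :
    pointInner g x a b =
      -((g.gram x)⁻¹ * (traceMatrix a b (ContinuousLinearMap.id ℝ E3))ᵀ).trace :=
  pointInner_frame x a b (L := ContinuousLinearMap.id ℝ E3) (by simp [ContinuousLinearMap.det])

/-- The pointwise inner product of forms of adjoint type does not depend on the trivialization. -/
lemma pointInner_change (ha : P.IsSmoothAdForm a) (hb : P.IsSmoothAdForm b) {i j : ι} {x : X}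
    (hx : x ∈ P.baseSet i ∩ P.baseSet j) :
    pointInner g x (a i x) (b i x) = pointInner g x (a j x) (b j x) := by
  simp only [pointInner, ha.change i j x hx, hb.change i j x hx, ← GaugeBundle.adj_mul,
    GaugeBundle.trace_adj]

/-- The integrand of the `L²` inner product is a continuous 3-form. -/
lemma isThreeForm_pointInner (ha : P.IsSmoothAdForm a) (hb : P.IsSmoothAdForm b) :
    IsThreeForm (fun x v => pointInner g x (a (P.indexAt x) x) (b (P.indexAt x) x) * g.vol x v)
    where
  det x L := by rw [alternatingMap_det, smul_eq_mul]; ring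
  cont p := fun y hy => by
    obtain ⟨i, hi⟩ : ∃ i, P.indexAt ((extChartAt (𝓡 3) p).symm y) = i := ⟨_, rfl⟩
    have hyi : y ∈ chartDomain (𝓡 3) p (P.baseSet i) := ⟨hy, hi ▸ P.mem_baseSet_at _⟩
    have hΓ : ContinuousAt (fun z => gramFrame g ((extChartAt (𝓡 3) p).symm z)
        (chartDeriv (𝓡 3) p z)) y :=
      continuousAt_pi.2 fun k => continuousAt_pi.2 fun l => (g.contDiffAt_form hy _ _).continuousAt
    have hdet : (gramFrame g ((extChartAt (𝓡 3) p).symm y) (chartDeriv (𝓡 3) p y)).det ≠ 0 := by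
      have h := chartDeriv_det_ne_zero hy
      rw [det_eq_det_e3] at h
      rw [gramFrame_eq, Matrix.det_mul, Matrix.det_mul, Matrix.det_transpose]
      exact mul_ne_zero (mul_ne_zero h (g.gram_posDef _).det_pos.ne') h
    have hΓ' := (continuousAt_matrix_inv _ (by
      simpa using NormedRing.inverse_continuousAt (Units.mk0 _ hdet))).comp hΓ
    have ha1 : ∀ u, ContinuousAt (fun z => inChart (𝓡 3) p (a i) z u) y := fun u =>
      (((ha.smooth i).contDiffAt (P.isOpen_baseSet i) hyi).clm_apply
        contDiffAt_const).continuousAt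
    have hb1 : ∀ u, ContinuousAt (fun z => inChart (𝓡 3) p (b i) z u) y := fun u =>
      (((hb.smooth i).contDiffAt (P.isOpen_baseSet i) hyi).clm_apply
        contDiffAt_const).continuousAt
    have hT : ContinuousAt (fun z => (traceMatrix (a i ((extChartAt (𝓡 3) p).symm z))
        (b i ((extChartAt (𝓡 3) p).symm z)) (chartDeriv (𝓡 3) p z))ᵀ) y :=
      continuousAt_pi.2 fun k => continuousAt_pi.2 fun l =>
        (Complex.reCLM.continuous.comp (traceL N).continuous).continuousAt.comp
          ((ha1 (e3 l)).mul (hb1 (e3 k)))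
    have h1 : ContinuousAt (fun z => -((gramFrame g ((extChartAt (𝓡 3) p).symm z)
        (chartDeriv (𝓡 3) p z))⁻¹ * (traceMatrix (a i ((extChartAt (𝓡 3) p).symm z))
        (b i ((extChartAt (𝓡 3) p).symm z)) (chartDeriv (𝓡 3) p z))ᵀ).trace) y :=
      ((Continuous.matrix_trace continuous_id).continuousAt.comp (hΓ'.mul hT)).neg
    refine ContinuousAt.continuousWithinAt
      ((h1.mul (g.contDiffAt_volCoeff hy).continuousAt).congr ?_)
    filter_upwards [(isOpen_chartDomain p (P.isOpen_baseSet i)).mem_nhds hyi] with z hz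
    rw [coeff_eq, pointInner_change ha hb ⟨P.mem_baseSet_at _, hz.2⟩,
      pointInner_frame _ _ _ (chartDeriv_det_ne_zero hz.1)]
    rfl

/-- The defining property of the Hodge star: the inner product with `⋆η` is the wedge product with
`η`. -/
lemma pointInner_star3 (x : X) (η : E3 → E3 → Mat N) (b : E3 →L[ℝ] Mat N) :
    pointInner g x (star3 g x η) b * g.vol x e3 = -(trWedge b η e3).re := by
  have hΓ := (g.gram_posDef x).det_pos.ne'.isUnit
  have hs : traceMatrix (star3 g x η) b (ContinuousLinearMap.id ℝ E3) =
      (g.vol x e3)⁻¹ • (g.gram x * Matrix.of fun l j =>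
        (η (e3 (l + 1)) (e3 (l + 2)) * b (e3 j)).trace.re) := by
    ext i j
    simp only [traceMatrix, Matrix.of_apply, ContinuousLinearMap.id_apply, star3_apply,
      smul_mul_assoc, Finset.sum_mul, trace_real_smul, Matrix.trace_sum, Complex.re_ofReal_mul,
      Complex.re_sum, Matrix.smul_apply, Matrix.mul_apply, smul_eq_mul, OrientedMetric.gram]
  have hsym : (g.gram x)ᵀ = g.gram x := by
    ext i j
    exact g.form_symm x _ _
  rw [pointInner_eq_trace, hs, Matrix.transpose_smul, Matrix.transpose_mul, hsym, Matrix.mul_smul,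
    Matrix.trace_smul, Matrix.trace_mul_comm, mul_assoc, Matrix.mul_nonsing_inv _ hΓ, mul_one,
    smul_eq_mul, neg_mul, mul_comm, ← mul_assoc, mul_inv_cancel₀ (g.vol_e3_ne_zero x), one_mul,
    Matrix.trace_transpose, Matrix.trace, Fin.sum_univ_three]
  simp only [Matrix.diag_apply, Matrix.of_apply, trWedge, Complex.add_re,
    Matrix.trace_mul_comm (b _)]
  rfl

/-- The trace of a product of skew-Hermitian matrices is real. -/
lemma trace_mul_im_of_skew {Z W : Mat N} (hZ : Zᴴ = -Z) (hW : Wᴴ = -W) :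
    (Z * W).trace.im = 0 := by
  have h : (Z * W)ᴴ.trace = (Z * W).trace := by
    rw [Matrix.conjTranspose_mul, hZ, hW, neg_mul_neg, Matrix.trace_mul_comm]
  rw [Matrix.trace_conjTranspose] at h
  exact Complex.conj_eq_iff_im.1 h

end ThreeManifold

/-! ### The gradient of the Chern–Simons functional -/

section ThreeManifold

variable {X : Type*} [TopologicalSpace X] [ChartedSpace E3 X] [IsManifold (𝓡 3) ∞ X]
  {g : OrientedMetric X}
  {N : ℕ} {ι : Type*} {G : Subgroup (Matrix.unitaryGroup (Fin N) ℂ)} {P : GaugeBundle (𝓡 3) X G ι}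
  {A₀ A φ B ψ B' ψ' : ι → OneForm E3 X N}

lemma pointInner_sub_left (x : X) (a a' b : E3 →L[ℝ] Mat N) :
    pointInner g x (a - a') b = pointInner g x a b - pointInner g x a' b := by
  simp only [pointInner, _root_.sub_apply, sub_mul, Matrix.trace_sub, Complex.sub_re, mul_sub,
    Finset.sum_sub_distrib]
  ring

lemma re_trace_mul_self_of_skew {Z W : Mat N} (hZ : Zᴴ = -Z) :
    -(Z * W).trace.re = ∑ n, ∑ m, ((Z m n).re * (W m n).re + (Z m n).im * (W m n).im) := by
  have h : -(Z * W).trace.re = (Zᴴ * W).trace.re := by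
    rw [hZ, neg_mul, Matrix.trace_neg, Complex.neg_re]
  rw [h, Matrix.trace, Complex.re_sum]
  refine Finset.sum_congr rfl fun n _ => ?_
  rw [Matrix.diag_apply, Matrix.mul_apply, Complex.re_sum]
  refine Finset.sum_congr rfl fun m _ => ?_
  simp [Matrix.conjTranspose_apply, Complex.mul_re]

/-- For skew-Hermitian values, the pointwise norm is a sum of values of the inverse metric. -/
lemma pointInner_self (x : X) {a : E3 →L[ℝ] Mat N} (ha : ∀ u, (a u)ᴴ = -a u) :
    pointInner g x a a = ∑ n, ∑ m,
      ((fun i => (a (e3 i) m n).re) ⬝ᵥ ((g.gram x)⁻¹ *ᵥ fun i => (a (e3 i) m n).re) +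
        (fun i => (a (e3 i) m n).im) ⬝ᵥ ((g.gram x)⁻¹ *ᵥ fun i => (a (e3 i) m n).im)) := by
  have h : pointInner g x a a = ∑ i, ∑ j, (g.gram x)⁻¹ i j *
      ∑ n, ∑ m, ((a (e3 i) m n).re * (a (e3 j) m n).re +
        (a (e3 i) m n).im * (a (e3 j) m n).im) := by
    simp only [← re_trace_mul_self_of_skew (ha _), mul_neg, Finset.sum_neg_distrib]
    rfl
  rw [h]
  simp only [dotProduct, Matrix.mulVec, Finset.mul_sum, ← Finset.sum_add_distrib]
  calc _ = ∑ i, ∑ n, ∑ m, ∑ j, (g.gram x)⁻¹ i j * ((a (e3 i) m n).re * (a (e3 j) m n).re +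
        (a (e3 i) m n).im * (a (e3 j) m n).im) :=
        Finset.sum_congr rfl fun i _ => by
          rw [Finset.sum_comm]
          exact Finset.sum_congr rfl fun n _ => Finset.sum_comm
    _ = ∑ n, ∑ m, ∑ i, ∑ j, (g.gram x)⁻¹ i j * ((a (e3 i) m n).re * (a (e3 j) m n).re +
        (a (e3 i) m n).im * (a (e3 j) m n).im) := by
          rw [Finset.sum_comm]
          exact Finset.sum_congr rfl fun n _ => Finset.sum_comm
    _ = _ := Finset.sum_congr rfl fun n _ => Finset.sum_congr rfl fun m _ =>
          Finset.sum_congr rfl fun i _ => Finset.sum_congr rfl fun j _ => by ring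

lemma pointInner_self_nonneg (x : X) {a : E3 →L[ℝ] Mat N} (ha : ∀ u, (a u)ᴴ = -a u) :
    0 ≤ pointInner g x a a := by
  have h := (g.gram_posDef x).inv.posSemidef
  rw [pointInner_self x ha]
  refine Finset.sum_nonneg fun n _ => Finset.sum_nonneg fun m _ => add_nonneg ?_ ?_
  · simpa using h.dotProduct_mulVec_nonneg fun i => (a (e3 i) m n).re
  · simpa using h.dotProduct_mulVec_nonneg fun i => (a (e3 i) m n).im

lemma eq_zero_of_pointInner_self (x : X) {a : E3 →L[ℝ] Mat N} (ha : ∀ u, (a u)ᴴ = -a u)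
    (h0 : pointInner g x a a = 0) : a = 0 := by
  have h := (g.gram_posDef x).inv
  have hnn : ∀ c : Fin 3 → ℝ, 0 ≤ c ⬝ᵥ ((g.gram x)⁻¹ *ᵥ c) := fun c => by
    simpa using h.posSemidef.dotProduct_mulVec_nonneg c
  have hz : ∀ c : Fin 3 → ℝ, c ⬝ᵥ ((g.gram x)⁻¹ *ᵥ c) = 0 → c = 0 := fun c hc => by
    by_contra hne
    have := h.dotProduct_mulVec_pos hne
    simp [hc] at this
  rw [pointInner_self x ha, Finset.sum_eq_zero_iff_of_nonneg fun n _ => Finset.sum_nonneg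
    fun m _ => add_nonneg (hnn _) (hnn _)] at h0
  have h1 : ∀ k, a (e3 k) = 0 := fun k => by
    ext m n
    have h2 := h0 n (Finset.mem_univ _)
    rw [Finset.sum_eq_zero_iff_of_nonneg fun m _ => add_nonneg (hnn _) (hnn _)] at h2
    have h3 := (add_eq_zero_iff_of_nonneg (hnn _) (hnn _)).1 (h2 m (Finset.mem_univ _))
    exact Complex.ext (congrFun (hz _ h3.1) k) (congrFun (hz _ h3.2) k)
  ext1 u
  rw [eq_sum_e3 u]
  simp [h1]

/-- The 2-form `F_A - ½[φ ∧ φ]`, the real part of the complex curvature. -/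
noncomputable def curvRe {E H M : Type*} [NormedAddCommGroup E] [NormedSpace ℝ E]
    [TopologicalSpace H] [TopologicalSpace M] [ChartedSpace H M] (I : ModelWithCorners ℝ E H)
    [I.Boundaryless] (A φ : OneForm E M N) (x : M) (u w : E) : Mat N :=
  curvature I A x u w - (φ x u * φ x w - φ x w * φ x u)

lemma isAdTwoForm_curvRe (hA : P.IsConnection A) (hφ : P.IsAdForm φ) :
    P.IsAdTwoForm (fun i => curvRe (𝓡 3) (A i) (φ i)) :=
  hA.isSmoothConnection.curvature.sub hφ.isSmoothAdForm.commutator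

lemma isAdTwoForm_covD (hA : P.IsConnection A) (hφ : P.IsAdForm φ) :
    P.IsAdTwoForm (fun i => covD (𝓡 3) (A i) (φ i)) :=
  hA.isSmoothConnection.covD hφ.isSmoothAdForm

/-- The 2-form of which the `A`-component of the gradient of `Re (e^{2iθ} CS)` is the Hodge star. -/
noncomputable def gradCurvA {E H M : Type*} [NormedAddCommGroup E] [NormedSpace ℝ E]
    [TopologicalSpace H] [TopologicalSpace M] [ChartedSpace H M] (I : ModelWithCorners ℝ E H)
    [I.Boundaryless] (θ : ℝ) (A φ : OneForm E M N) (x : M) (u w : E) : Mat N :=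
  Real.sin (2 * θ) • covD I A φ x u w - Real.cos (2 * θ) • curvRe I A φ x u w

/-- The 2-form of which the `φ`-component of the gradient of `Re (e^{2iθ} CS)` is the Hodge star. -/
noncomputable def gradCurvPhi {E H M : Type*} [NormedAddCommGroup E] [NormedSpace ℝ E]
    [TopologicalSpace H] [TopologicalSpace M] [ChartedSpace H M] (I : ModelWithCorners ℝ E H)
    [I.Boundaryless] (θ : ℝ) (A φ : OneForm E M N) (x : M) (u w : E) : Mat N :=
  Real.sin (2 * θ) • curvRe I A φ x u w + Real.cos (2 * θ) • covD I A φ x u w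

section Mem

variable {E H M : Type*} [NormedAddCommGroup E] [NormedSpace ℝ E]
    [TopologicalSpace H] [TopologicalSpace M] [ChartedSpace H M] {I : ModelWithCorners ℝ E H}
    [I.Boundaryless] {Q : GaugeBundle I M G ι} {A φ : ι → OneForm E M N}

lemma curvRe_mem (hA : Q.IsConnection A) (hφ : Q.IsAdForm φ) (i : ι) (x : M) (hx : x ∈ Q.baseSet i)
    (u w : E) : curvRe I (A i) (φ i) x u w ∈ lieSubmodule G :=
  sub_mem (add_mem (extD_mem (hA.smooth i) (Q.isOpen_baseSet i) (hA.mem i) hx u w)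
    (bracket_mem_lieSubmodule (hA.mem i x hx u) (hA.mem i x hx w)))
    (bracket_mem_lieSubmodule (hφ.mem i x hx u) (hφ.mem i x hx w))

lemma covD_mem (hA : Q.IsConnection A) (hφ : Q.IsAdForm φ) (i : ι) (x : M) (hx : x ∈ Q.baseSet i)
    (u w : E) : covD I (A i) (φ i) x u w ∈ lieSubmodule G :=
  add_mem (extD_mem (hφ.smooth i) (Q.isOpen_baseSet i) (hφ.mem i) hx u w)
    (sub_mem (bracket_mem_lieSubmodule (hA.mem i x hx u) (hφ.mem i x hx w))
      (bracket_mem_lieSubmodule (hA.mem i x hx w) (hφ.mem i x hx u)))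

end Mem

lemma isAdForm_gradA (hA : P.IsConnection A) (hφ : P.IsAdForm φ) (θ : ℝ) :
    P.IsAdForm (fun i x => star3 g x (gradCurvA (𝓡 3) θ (A i) (φ i) x)) :=
  isAdForm_star3 (((isAdTwoForm_covD hA hφ).real_smul _).sub
    ((isAdTwoForm_curvRe hA hφ).real_smul _)) fun i x hx u w =>
      sub_mem ((lieSubmodule G).smul_mem _ (covD_mem hA hφ i x hx u w))
        ((lieSubmodule G).smul_mem _ (curvRe_mem hA hφ i x hx u w))

lemma isAdForm_gradPhi (hA : P.IsConnection A) (hφ : P.IsAdForm φ) (θ : ℝ) :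
    P.IsAdForm (fun i x => star3 g x (gradCurvPhi (𝓡 3) θ (A i) (φ i) x)) :=
  isAdForm_star3 (((isAdTwoForm_curvRe hA hφ).real_smul _).add
    ((isAdTwoForm_covD hA hφ).real_smul _)) fun i x hx u w =>
      add_mem ((lieSubmodule G).smul_mem _ (curvRe_mem hA hφ i x hx u w))
        ((lieSubmodule G).smul_mem _ (covD_mem hA hφ i x hx u w))

lemma exp_two_I_mul (θ : ℝ) : Complex.exp (2 * Complex.I * θ) =
    (Real.cos (2 * θ) : ℂ) + (Real.sin (2 * θ) : ℂ) * Complex.I := by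
  rw [Complex.ofReal_cos, Complex.ofReal_sin, ← Complex.exp_mul_I]
  congr 1
  push_cast
  ring

/-- The real part of `e^{2iθ} tr ((b + ip)(r + iq))`, for skew-Hermitian `b`, `p`, `r`, `q`. All
four traces are real, so this is a combination of them with coefficients `cos 2θ` and `sin 2θ`. -/
lemma re_exp_mul_trace (θ : ℝ) {b p r q : Mat N} (hb : bᴴ = -b) (hp : pᴴ = -p) (hr : rᴴ = -r)
    (hq : qᴴ = -q) :
    (Complex.exp (2 * Complex.I * θ) *
        ((b + Complex.I • p) * (r + Complex.I • q)).trace).re =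
      -(b * (Real.sin (2 * θ) • q - Real.cos (2 * θ) • r)).trace.re -
        (p * (Real.sin (2 * θ) • r + Real.cos (2 * θ) • q)).trace.re := by
  have h1 := trace_mul_im_of_skew hb hr
  have h2 := trace_mul_im_of_skew hb hq
  have h3 := trace_mul_im_of_skew hp hr
  have h4 := trace_mul_im_of_skew hp hq
  rw [exp_two_I_mul]
  simp only [add_mul, mul_add, mul_sub, smul_mul_assoc, mul_smul_comm, Matrix.trace_add,
    Matrix.trace_sub, Matrix.trace_smul, Complex.smul_re, smul_eq_mul, Complex.add_re,
    Complex.sub_re, Complex.mul_re, Complex.mul_im, Complex.I_re, Complex.I_im, Complex.ofReal_re,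
    Complex.ofReal_im, h1, h2, h3, h4]
  ring

variable [T2Space X] [CompactSpace X]

lemma integralForm_clm {F F' : Type*} [NormedAddCommGroup F] [NormedSpace ℝ F] [CompleteSpace F]
    [NormedAddCommGroup F'] [NormedSpace ℝ F'] [CompleteSpace F'] (T : F →L[ℝ] F')
    {η : X → (Fin 3 → E3) → F} (hη : IsThreeForm η) :
    integralForm g (fun x v => T (η x v)) = T (integralForm g η) := by
  simp only [integralForm_eq_sum, map_sum]
  refine Finset.sum_congr rfl fun p _ => ?_
  rw [chartIntegral, chartIntegral, ← T.integral_comp_comm (integrableOn_partition g hη p)]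
  simp only [coeff_eq, map_smul]

lemma innerL2_congr {C χ : ι → OneForm E3 X N}
    (hB : ∀ i, ∀ x ∈ P.baseSet i, B i x = C i x) (hψ : ∀ i, ∀ x ∈ P.baseSet i, ψ i x = χ i x) :
    innerL2 g P B ψ B' ψ' = innerL2 g P C χ B' ψ' :=
  integralForm_congr g fun x v => by
    rw [hB _ x (P.mem_baseSet_at x), hψ _ x (P.mem_baseSet_at x)]

/-- The `L²` inner product with the (candidate) gradient is the first variation of
`Re (e^{2iθ} CS)`. -/
lemma innerL2_grad (hA : P.IsConnection A) (hφ : P.IsAdForm φ) (hB' : P.IsAdForm B')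
    (hψ' : P.IsAdForm ψ') (θ : ℝ) :
    innerL2 g P (fun i x => star3 g x (gradCurvA (𝓡 3) θ (A i) (φ i) x))
        (fun i x => star3 g x (gradCurvPhi (𝓡 3) θ (A i) (φ i) x)) B' ψ' =
      (Complex.exp (2 * Complex.I * θ) * integralForm g fun x v =>
        trWedge ((B' + Complex.I • ψ') (P.indexAt x) x)
          (curvature (𝓡 3) ((A + Complex.I • φ) (P.indexAt x)) x) v).re := by
  have hc := hA.isSmoothConnection.add (hφ.isSmoothAdForm.smul Complex.I)
  have hb := hB'.isSmoothAdForm.add (hψ'.isSmoothAdForm.smul Complex.I)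
  have h3 := isThreeForm_trWedge hb hc.curvature
  let T : ℂ →L[ℝ] ℝ := Complex.reCLM.comp
    ((ContinuousLinearMap.mul ℝ ℂ) (Complex.exp (2 * Complex.I * θ)))
  have hT : ∀ z : ℂ, T z = (Complex.exp (2 * Complex.I * θ) * z).re := fun _ => rfl
  rw [← hT, ← integralForm_clm T h3, innerL2]
  have h1 := (isThreeForm_pointInner (g := g) (isAdForm_gradA (g := g) hA hφ θ).isSmoothAdForm
    hB'.isSmoothAdForm).add (isThreeForm_pointInner (g := g)
      (isAdForm_gradPhi (g := g) hA hφ θ).isSmoothAdForm hψ'.isSmoothAdForm)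
  simp only [← add_mul] at h1
  have h2 : IsThreeForm (fun x v => T (trWedge ((B' + Complex.I • ψ') (P.indexAt x) x)
          (curvature (𝓡 3) ((A + Complex.I • φ) (P.indexAt x)) x) v)) :=
    ⟨fun p => T.continuous.comp_continuousOn (h3.cont p), fun x L => by rw [h3.det, map_smul]⟩
  -- it suffices to compare the two 3-forms on the coordinate frame
  refine congrArg (integralForm g) (h1.ext h2 fun x => ?_)
  have hx := P.mem_baseSet_at x
  set i := P.indexAt x
  rw [add_mul, pointInner_star3, pointInner_star3, hT]
  have hF : ∀ u w, curvature (𝓡 3) ((A + Complex.I • φ) i) x u w =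
      curvRe (𝓡 3) (A i) (φ i) x u w + Complex.I • covD (𝓡 3) (A i) (φ i) x u w :=
    curvature_complexForm (hA.smooth i) (hφ.smooth i) (P.isOpen_baseSet i) hx
  have hbv : ∀ u, (B' + Complex.I • ψ') i x u = B' i x u + Complex.I • ψ' i x u := fun _ => rfl
  have key := fun u v w => re_exp_mul_trace θ
    (conjTranspose_of_mem_lieSubmodule (hB'.mem i x hx u))
    (conjTranspose_of_mem_lieSubmodule (hψ'.mem i x hx u))
    (conjTranspose_of_mem_lieSubmodule (curvRe_mem hA hφ i x hx v w))
    (conjTranspose_of_mem_lieSubmodule (covD_mem hA hφ i x hx v w))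
  simp only [trWedge, hF, hbv, mul_add (Complex.exp _), Complex.add_re, gradCurvA, gradCurvPhi]
  rw [key, key, key]
  ring

/-- The Hodge star of the curvature is a gradient of `Re (e^{2iθ} CS)`; uniqueness is part of
`isGradient_iff`. -/
lemma isGradient_grad (hA₀ : P.IsConnection A₀) (hA : P.IsConnection A) (hφ : P.IsAdForm φ)
    (θ : ℝ) :
    IsGradient g P (realCS g P A₀ θ) A φ
      (fun i x => star3 g x (gradCurvA (𝓡 3) θ (A i) (φ i) x))
      (fun i x => star3 g x (gradCurvPhi (𝓡 3) θ (A i) (φ i) x)) := by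
  intro B' ψ' hB' hψ'
  rw [innerL2_grad hA hφ hB' hψ' θ]
  have h := hasDerivAt_csForm g hA₀.isSmoothConnection
    (hA.isSmoothConnection.add (hφ.isSmoothAdForm.smul Complex.I))
    (hB'.isSmoothAdForm.add (hψ'.isSmoothAdForm.smul Complex.I))
  have h1 := Complex.reCLM.hasFDerivAt.comp_hasDerivAt (0 : ℝ)
    (h.const_mul (Complex.exp (2 * Complex.I * θ)))
  refine h1.congr_of_eventuallyEq (Eventually.of_forall fun s => ?_)
  refine congrArg (fun z : ℂ => (Complex.exp (2 * Complex.I * θ) * z).re)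
    (integralForm_congr g fun x v => ?_)
  have hl : complexForm ((A + s • B') (P.indexAt x)) ((φ + s • ψ') (P.indexAt x)) =
      (A + Complex.I • φ) (P.indexAt x) + s • (B' + Complex.I • ψ') (P.indexAt x) := by
    have : complexForm ((A + s • B') (P.indexAt x)) ((φ + s • ψ') (P.indexAt x)) =
      (A (P.indexAt x) + s • B' (P.indexAt x)) +
        Complex.I • (φ (P.indexAt x) + s • ψ' (P.indexAt x)) := rfl
    rw [this, smul_add, smul_comm Complex.I s, add_add_add_comm]
    exact congrArg _ (smul_add s _ _).symm
  rw [hl]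

lemma innerL2_sub (hB : P.IsAdForm B) (hψ : P.IsAdForm ψ) {C χ : ι → OneForm E3 X N}
    (hC : P.IsAdForm C) (hχ : P.IsAdForm χ) (hB' : P.IsAdForm B') (hψ' : P.IsAdForm ψ') :
    innerL2 g P (B - C) (ψ - χ) B' ψ' = innerL2 g P B ψ B' ψ' - innerL2 g P C χ B' ψ' := by
  have t := fun {a b : ι → OneForm E3 X N} (ha : P.IsAdForm a) (hb : P.IsAdForm b) =>
    isThreeForm_pointInner (g := g) ha.isSmoothAdForm hb.isSmoothAdForm
  have h1 := (t hB hB').add (t hψ hψ')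
  have h2 := ((t hC hB').add (t hχ hψ')).const_smul (-1 : ℝ)
  have h := integralForm_add g h1 h2
  rw [integralForm_smul, neg_one_smul, ← sub_eq_add_neg] at h
  simp only [innerL2]
  simp only [← add_mul] at h
  refine Eq.trans (integralForm_congr g fun x v => ?_) h
  simp only [Pi.sub_apply, pointInner_sub_left, smul_eq_mul]
  ring

/-- A pair of adjoint valued 1-forms is the gradient of `Re (e^{2iθ} CS)` if and only if it is given
by the Hodge star of the curvature. -/
theorem isGradient_iff (hA₀ : P.IsConnection A₀) (hA : P.IsConnection A) (hφ : P.IsAdForm φ)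
    (hB : P.IsAdForm B) (hψ : P.IsAdForm ψ) (θ : ℝ) :
    IsGradient g P (realCS g P A₀ θ) A φ B ψ ↔ ∀ i, ∀ x ∈ P.baseSet i,
      B i x = star3 g x (gradCurvA (𝓡 3) θ (A i) (φ i) x) ∧
        ψ i x = star3 g x (gradCurvPhi (𝓡 3) θ (A i) (φ i) x) := by
  have hgrad := isGradient_grad (g := g) hA₀ hA hφ θ
  constructor
  · intro h
    have hC := isAdForm_gradA (g := g) hA hφ θ
    have hχ := isAdForm_gradPhi (g := g) hA hφ θ
    set C : ι → OneForm E3 X N := fun i x => star3 g x (gradCurvA (𝓡 3) θ (A i) (φ i) x)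
    set χ : ι → OneForm E3 X N := fun i x => star3 g x (gradCurvPhi (𝓡 3) θ (A i) (φ i) x)
    have hD := hB.sub hC
    have hE := hψ.sub hχ
    -- testing with the difference of the two gradients
    have h0 : innerL2 g P (B - C) (ψ - χ) (B - C) (ψ - χ) = 0 := by
      rw [innerL2_sub hB hψ hC hχ hD hE, sub_eq_zero]
      exact (h _ _ hD hE).unique (hgrad _ _ hD hE)
    have h3 := (isThreeForm_pointInner (g := g) hD.isSmoothAdForm hD.isSmoothAdForm).add
      (isThreeForm_pointInner (g := g) hE.isSmoothAdForm hE.isSmoothAdForm)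
    simp only [← add_mul] at h3
    have sk : ∀ {a : ι → OneForm E3 X N}, P.IsAdForm a → ∀ i, ∀ x ∈ P.baseSet i, ∀ u,
        (a i x u)ᴴ = -a i x u := fun ha i x hx u =>
      conjTranspose_of_mem_lieSubmodule (ha.mem i x hx u)
    have hnn : ∀ {a : ι → OneForm E3 X N}, P.IsAdForm a → ∀ x,
        0 ≤ pointInner g x (a (P.indexAt x) x) (a (P.indexAt x) x) := fun ha x =>
      pointInner_self_nonneg x (sk ha _ x (P.mem_baseSet_at x))
    intro i x hx
    have hz := eq_zero_of_integralForm_eq_zero g (fun x => add_nonneg (hnn hD x) (hnn hE x)) h3 h0 x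
    obtain ⟨hz1, hz2⟩ := (add_eq_zero_iff_of_nonneg (hnn hD x) (hnn hE x)).1 hz
    have hi := And.intro (P.mem_baseSet_at x) hx
    rw [pointInner_change hD.isSmoothAdForm hD.isSmoothAdForm hi] at hz1
    rw [pointInner_change hE.isSmoothAdForm hE.isSmoothAdForm hi] at hz2
    exact ⟨sub_eq_zero.1 (eq_zero_of_pointInner_self x (sk hD i x hx) hz1),
      sub_eq_zero.1 (eq_zero_of_pointInner_self x (sk hE i x hx) hz2)⟩
  · intro h B' ψ' hB' hψ'
    rw [innerL2_congr (fun i x hx => (h i x hx).1) fun i x hx => (h i x hx).2]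
    exact hgrad B' ψ' hB' hψ'

end ThreeManifold

/-! ### The Hodge star on the cylinder -/

section Volume

variable {X : Type*} [TopologicalSpace X] [ChartedSpace E3 X] [IsManifold (𝓡 3) ∞ X]
  (g : OrientedMetric X) (x : X)

/-- The volume form as a function of three vectors. -/
noncomputable def vol3 (u v w : E3) : ℝ := g.vol x ![u, v, w]

lemma vol3_eq (u v w : E3) : vol3 g x u v w =
    (u 0 * (v 1 * w 2 - v 2 * w 1) + u 1 * (v 2 * w 0 - v 0 * w 2) +
      u 2 * (v 0 * w 1 - v 1 * w 0)) * g.vol x e3 := by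
  obtain ⟨L, hL⟩ := exists_clm_e3 ![u, v, w]
  have h0 : L (e3 0) = u := (congrFun hL 0).symm
  have h1 : L (e3 1) = v := (congrFun hL 1).symm
  have h2 : L (e3 2) = w := (congrFun hL 2).symm
  rw [vol3, hL, alternatingMap_det, det_eq_det_e3, Matrix.det_fin_three]
  simp only [Matrix.of_apply, h0, h1, h2]
  ring

lemma isAltForm_vol3 (u : E3) : IsAltForm (vol3 g x u) where
  add_left v v' w := by simp only [vol3_eq, PiLp.add_apply]; ring
  smul_left c v w := by simp only [vol3_eq, PiLp.smul_apply, smul_eq_mul]; ring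
  swap v w := by simp only [vol3_eq]; ring

lemma vol3_cycle (u v w : E3) : vol3 g x u v w = vol3 g x v w u := by
  simp only [vol3_eq]; ring

lemma vol3_swap (u v w : E3) : vol3 g x u v w = -vol3 g x v u w := by
  simp only [vol3_eq]; ring

lemma vol3_sum_left (c : Fin 3 → ℝ) (e : Fin 3 → E3) (v w : E3) :
    vol3 g x (∑ k, c k • e k) v w = ∑ k, c k * vol3 g x (e k) v w := by
  rw [vol3_cycle, vol3_cycle, (isAltForm_vol3 g x w).sum_left]
  exact Finset.sum_congr rfl fun k _ => by rw [vol3_cycle g x (e k), vol3_cycle g x v]; rfl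

/-- The frame dual to the coordinate frame with respect to the metric. -/
noncomputable def dualFrame (k : Fin 3) : E3 := ∑ j, (g.gram x)⁻¹ k j • e3 j

lemma form_dualFrame (k l : Fin 3) :
    g.form x (dualFrame g x k) (e3 l) = if k = l then 1 else 0 := by
  have h := congrFun (congrFun (Matrix.nonsing_inv_mul _ (g.gram_posDef x).det_pos.ne'.isUnit) k) l
  rw [Matrix.mul_apply, Matrix.one_apply] at h
  rw [← h]
  simp only [dualFrame, g.form_eq, map_sum, map_smul, _root_.sum_apply, _root_.smul_apply,
    smul_eq_mul]
  rfl

lemma eq_sum_dualFrame (w : E3) : w = ∑ l, g.form x w (e3 l) • dualFrame g x l := by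
  rw [← sub_eq_zero]
  by_contra hne
  have hz : ∀ k, g.form x (w - ∑ l, g.form x w (e3 l) • dualFrame g x l) (e3 k) = 0 := fun k => by
    have h1 := fun l => form_dualFrame g x l k
    simp only [g.form_eq] at h1 ⊢
    simp [map_sub, map_sum, map_smul, _root_.sub_apply, _root_.sum_apply, _root_.smul_apply, h1]
  generalize w - ∑ l, g.form x w (e3 l) • dualFrame g x l = z at hz hne
  have h2 : g.form x z z = 0 := by
    rw [g.form_eq, congrArg (g.formL x z) (eq_sum_e3 z)]
    simp only [map_add, map_smul]
    simp only [← g.form_eq, hz, smul_zero, add_zero]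
  exact (g.form_pos x hne).ne' h2

lemma vol3_dualFrame : vol3 g x (dualFrame g x 0) (dualFrame g x 1) (dualFrame g x 2) =
    (g.vol x e3)⁻¹ := by
  obtain ⟨L, hL⟩ := exists_clm_e3 (dualFrame g x)
  have h : ![dualFrame g x 0, dualFrame g x 1, dualFrame g x 2] = fun k => L (e3 k) := by
    rw [← hL]
    ext k : 1
    fin_cases k <;> rfl
  have hdet : L.det = (g.gram x)⁻¹.det := by
    rw [det_eq_det_e3, ← Matrix.det_transpose]
    congr 1
    ext i j
    have : L (e3 i) = dualFrame g x i := (congrFun hL i).symm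
    rw [Matrix.transpose_apply, Matrix.of_apply, this, dualFrame, Fin.sum_univ_three]
    fin_cases j <;> simp [e3]
  have hv := g.vol_e3_ne_zero x
  rw [vol3, h, alternatingMap_det, hdet, Matrix.det_nonsing_inv, Ring.inverse_eq_inv',
    ← g.vol_sq_e3]
  field_simp

lemma vol3_dualFrame_right (k : Fin 3) (w : E3) :
    vol3 g x (dualFrame g x (k + 1)) (dualFrame g x (k + 2)) w =
      (g.vol x e3)⁻¹ * g.form x w (e3 k) := by
  have h0 : vol3 g x (dualFrame g x 0) (dualFrame g x 1) (dualFrame g x 2) =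
    (g.vol x e3)⁻¹ := vol3_dualFrame g x
  have h1 := (vol3_cycle g x _ _ _).symm.trans h0
  have h2 := (vol3_cycle g x _ _ _).symm.trans h1
  have hs : ∀ u v, vol3 g x u u v = 0 := fun u v => by
    rw [vol3_cycle]; rw [vol3_eq]; ring
  have hs' : ∀ u v, vol3 g x u v u = 0 := fun u v => by rw [vol3_eq]; ring
  conv_lhs => rw [eq_sum_dualFrame g x w]
  rw [← vol3_cycle, vol3_sum_left, Fin.sum_univ_three]
  fin_cases k <;>
    simp only [Fin.reduceFinMk, Fin.isValue, Fin.reduceAdd, Fin.zero_eta, Fin.mk_one, zero_add, hs,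
      hs', h0, h1, h2] <;> ring

/-- The Hodge star of a 1-form on the three-manifold. -/
noncomputable def starOne {F : Type*} [AddCommGroup F] [Module ℝ F] (β : E3 → F) (u w : E3) : F :=
  ∑ k, vol3 g x (dualFrame g x k) u w • β (e3 k)

variable {F : Type*} [NormedAddCommGroup F] [NormedSpace ℝ F]

lemma isAltForm_starOne (β : E3 → F) : IsAltForm (starOne g x β) where
  add_left u u' w := by
    simp only [starOne, (isAltForm_vol3 g x _).add_left, add_smul, Finset.sum_add_distrib]
  smul_left c u w := by
    simp only [starOne, (isAltForm_vol3 g x _).smul_left, smul_assoc, Finset.smul_sum]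
  swap u w := by
    simp only [starOne, (isAltForm_vol3 g x _).swap u w, neg_smul, Finset.sum_neg_distrib]

lemma star3_dualFrame (η : E3 → E3 → F) (k : Fin 3) :
    star3 g x η (dualFrame g x k) = (g.vol x e3)⁻¹ • η (e3 (k + 1)) (e3 (k + 2)) := by
  simp [star3_apply, form_dualFrame]

lemma IsAltForm.ext_e3 {η η' : E3 → E3 → F} (h : IsAltForm η) (h' : IsAltForm η')
    (he : ∀ k : Fin 3, η (e3 (k + 1)) (e3 (k + 2)) = η' (e3 (k + 1)) (e3 (k + 2))) : η = η' := by
  have h0 : η (e3 1) (e3 2) = η' (e3 1) (e3 2) := he 0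
  have h1 : η (e3 2) (e3 0) = η' (e3 2) (e3 0) := he 1
  have h2 : η (e3 0) (e3 1) = η' (e3 0) (e3 1) := he 2
  funext u w
  rw [eq_sum_e3 u, eq_sum_e3 w]
  simp only [h.add_left, h.add_right, h.smul_left, h.smul_right, h'.add_left, h'.add_right,
    h'.smul_left, h'.smul_right, h.self, h'.self, h.swap (e3 1) (e3 2), h.swap (e3 2) (e3 0),
    h.swap (e3 0) (e3 1), h'.swap (e3 1) (e3 2), h'.swap (e3 2) (e3 0), h'.swap (e3 0) (e3 1),
    h0, h1, h2]

lemma star3_injective {η η' : E3 → E3 → F} (h : IsAltForm η) (h' : IsAltForm η')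
    (he : ∀ w, star3 g x η w = star3 g x η' w) : η = η' := by
  refine h.ext_e3 h' fun k => ?_
  have hk := he (dualFrame g x k)
  rw [star3_dualFrame, star3_dualFrame] at hk
  exact smul_right_injective F (inv_ne_zero (g.vol_e3_ne_zero x)) hk

lemma star3_starOne (β : E3 →ₗ[ℝ] F) (w : E3) : star3 g x (starOne g x β) w = β w := by
  have h : ∀ k, star3 g x (starOne g x β) (dualFrame g x k) = β (dualFrame g x k) := fun k => by
    have hv : ∀ j, vol3 g x (dualFrame g x j) (e3 (k + 1)) (e3 (k + 2)) =
        (g.gram x)⁻¹ j k * g.vol x e3 := fun j => by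
      rw [dualFrame, vol3_sum_left, Fin.sum_univ_three]
      fin_cases k <;> simp [vol3_eq, e3]
    have hs : ∀ j, (g.gram x)⁻¹ j k = (g.gram x)⁻¹ k j := fun j =>
      (g.gram_posDef x).inv.isHermitian.apply k j
    rw [star3_dualFrame, starOne, Finset.smul_sum]
    conv_rhs => rw [dualFrame, map_sum]
    refine Finset.sum_congr rfl fun j _ => ?_
    rw [hv, hs, smul_smul, map_smul]
    congr 1
    field_simp [g.vol_e3_ne_zero x]
  rw [eq_sum_dualFrame g x w, map_sum, map_sum]
  simp only [map_smul, h]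

/-- On a three-manifold `⋆⋆ = 1`. -/
lemma starOne_star3 {η : E3 → E3 → F} (h : IsAltForm η) :
    starOne g x (star3 g x η) = η :=
  star3_injective g x (isAltForm_starOne g x _) h
    (star3_starOne g x (star3 g x η : E3 →ₗ[ℝ] F))

end Volume

section Cylinder

variable {X : Type*} [TopologicalSpace X] [ChartedSpace E3 X] [IsManifold (𝓡 3) ∞ X]
  (g : OrientedMetric X) (x : X) {N : ℕ}

lemma volDtX_eq (p q r s : E3 × ℝ) : volDtX g x ![p, q, r, s] =
    p.2 * vol3 g x q.1 r.1 s.1 - q.2 * vol3 g x p.1 r.1 s.1 + r.2 * vol3 g x p.1 q.1 s.1 -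
      s.2 * vol3 g x p.1 q.1 r.1 := by
  have h : ∀ k : Fin 4, (fun j => ((![p, q, r, s] : Fin 4 → E3 × ℝ) (k.succAbove j)).1) =
      ![![![q.1, r.1, s.1], ![p.1, r.1, s.1], ![p.1, q.1, s.1], ![p.1, q.1, r.1]] k 0,
        ![![q.1, r.1, s.1], ![p.1, r.1, s.1], ![p.1, q.1, s.1], ![p.1, q.1, r.1]] k 1,
        ![![q.1, r.1, s.1], ![p.1, r.1, s.1], ![p.1, q.1, s.1], ![p.1, q.1, r.1]] k 2] := by
    intro k
    ext j : 1
    fin_cases k <;> fin_cases j <;> rfl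
  simp only [volDtX, h, Fin.sum_univ_four]
  simp [vol3]
  ring

/-- Reversing the order of the factors reverses the orientation. -/
lemma volXDt_eq (u : Fin 4 → E3 × ℝ) : volXDt g x u = -volDtX g x u := by
  simp [volXDt, volDtX, Fin.sum_univ_four, Fin.rev]
  ring

/-- The inverse matrix of the product metric. -/
lemma inv_form4 : (Matrix.of fun a b => g.form4 x (e4 a) (e4 b))⁻¹ =
    Matrix.fromBlocks (g.gram x)⁻¹ 0 0 1 := by
  have h : (Matrix.of fun a b => g.form4 x (e4 a) (e4 b)) =
      Matrix.fromBlocks (g.gram x) 0 0 1 := by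
    ext a b
    rcases a with a | a <;> rcases b with b | b <;>
      simp [OrientedMetric.form4, e4, OrientedMetric.gram, g.form_eq]
  rw [h]
  refine Matrix.inv_eq_right_inv ?_
  rw [Matrix.fromBlocks_multiply]
  simp [Matrix.mul_nonsing_inv _ (g.gram_posDef x).det_pos.ne'.isUnit]

variable {η : E3 × ℝ → E3 × ℝ → Mat N}

lemma isAltForm_volDtX (p q : E3 × ℝ) : IsAltForm (fun u w => volDtX g x ![p, q, u, w]) where
  add_left v v' w := by
    simp only [volDtX_eq, vol3_eq, Prod.fst_add, Prod.snd_add, PiLp.add_apply]; ring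
  smul_left c v w := by
    simp only [volDtX_eq, vol3_eq, Prod.smul_fst, Prod.smul_snd, PiLp.smul_apply, smul_eq_mul]; ring
  swap v w := by simp only [volDtX_eq, vol3_eq]; ring

lemma isAltForm_hodge : IsAltForm (hodge g (volDtX g) x η) where
  add_left v v' w := by
    simp only [hodge, (isAltForm_volDtX g x _ _).add_left, mul_add, add_smul,
      Finset.sum_add_distrib, smul_add]
  smul_left c v w := by
    simp only [hodge, (isAltForm_volDtX g x _ _).smul_left, smul_eq_mul, mul_left_comm _ c,
      mul_smul, ← Finset.smul_sum]
    rw [smul_comm]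
  swap v w := by
    simp only [hodge, (isAltForm_volDtX g x _ _).swap v w, mul_neg, neg_smul,
      Finset.sum_neg_distrib, smul_neg]

lemma vol3_zero (u v : E3) :
    vol3 g x 0 u v = 0 ∧ vol3 g x u 0 v = 0 ∧ vol3 g x u v 0 = 0 := by
  simp [vol3_eq]

lemma vol3_dualFrame_dualFrame (i j : Fin 3) (w : E3) :
    vol3 g x (dualFrame g x i) (dualFrame g x j) w =
      ∑ i', ∑ j', (g.gram x)⁻¹ i i' * (g.gram x)⁻¹ j j' * vol3 g x (e3 i') (e3 j') w := by
  rw [dualFrame, vol3_sum_left]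
  refine Finset.sum_congr rfl fun i' _ => ?_
  rw [vol3_swap, dualFrame, vol3_sum_left, ← Finset.sum_neg_distrib, Finset.mul_sum]
  exact Finset.sum_congr rfl fun j' _ => by rw [vol3_swap g x (e3 i')]; ring

/-- The `dt`-component of the Hodge star. -/
lemma hodge_dt (hη : IsAltForm η) (w : E3) : hodge g (volDtX g) x η (0, 1) (w, 0) =
    star3 g x (fun u w => η (u, 0) (w, 0)) w := by
  have hz := vol3_zero g x
  have h : hodge g (volDtX g) x η (0, 1) (w, 0) = (1 / 2 : ℝ) • ∑ i, ∑ j,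
      vol3 g x (dualFrame g x i) (dualFrame g x j) w • η (e3 i, 0) (e3 j, 0) := by
    simp only [hodge, inv_form4]
    simp only [Fintype.sum_sum_type, Finset.univ_unique,
      Matrix.fromBlocks_apply₁₁, Matrix.fromBlocks_apply₂₁,
      Matrix.zero_apply, volDtX_eq, e4, Sum.elim_inl,
      Sum.elim_inr, zero_mul, mul_zero, one_mul, hz, zero_smul, Finset.sum_const_zero,
      add_zero, zero_add, sub_zero, sub_self]
    simp only [vol3_dualFrame_dualFrame, Finset.sum_smul]
  rw [h]
  have hself : ∀ v w, vol3 g x v v w = 0 := fun v w => by rw [vol3_eq]; ring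
  have h1 := vol3_dualFrame_right g x 0 w
  have h2 := vol3_dualFrame_right g x 1 w
  have h3 := vol3_dualFrame_right g x 2 w
  simp only [Fin.isValue, Fin.reduceAdd, zero_add] at h1 h2 h3
  simp only [Fin.sum_univ_three, star3_apply, hself, vol3_swap g x (dualFrame g x 1)
    (dualFrame g x 0), vol3_swap g x (dualFrame g x 2) (dualFrame g x 1),
    vol3_swap g x (dualFrame g x 0) (dualFrame g x 2), h1, h2, h3, hη.swap (e3 0, 0) (e3 1, 0),
    hη.swap (e3 1, 0) (e3 2, 0), hη.swap (e3 2, 0) (e3 0, 0), Fin.isValue, Fin.reduceAdd, zero_add]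
  module

/-- The component of the Hodge star along the three-manifold. -/
lemma hodge_slice (hη : IsAltForm η) (u w : E3) : hodge g (volDtX g) x η (u, 0) (w, 0) =
    starOne g x (fun v => η (0, 1) (v, 0)) u w := by
  have hz := vol3_zero g x
  simp only [hodge, inv_form4]
  simp only [Fintype.sum_sum_type, Finset.univ_unique, Finset.sum_singleton,
      Matrix.fromBlocks_apply₁₁, Matrix.fromBlocks_apply₁₂, Matrix.fromBlocks_apply₂₁,
      Matrix.fromBlocks_apply₂₂, Matrix.zero_apply, Matrix.one_apply, volDtX_eq, e4, Sum.elim_inl,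
      Sum.elim_inr, zero_mul, mul_zero, one_mul, hz, zero_smul, Finset.sum_const_zero,
      add_zero, zero_add, sub_zero, if_true, mul_one, zero_sub]
  simp only [starOne, hη.swap (0, 1) (_, 0), dualFrame, vol3_sum_left, Finset.sum_smul,
    mul_neg, neg_smul, smul_neg, neg_neg]
  module

/-- An equation `η = ⋆ T η`, with an involution `T` of the values, holds on the cylinder as soon as
its `dt`-component does. -/
lemma eq_hodge_iff (hη : IsAltForm η) (T : Mat N →ₗ[ℝ] Mat N) (hT : ∀ Z, T (T Z) = Z) :
    (∀ u w, η u w = hodge g (volDtX g) x (fun u w => T (η u w)) u w) ↔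
      ∀ w, η (0, 1) (w, 0) = T (star3 g x (fun u w => η (u, 0) (w, 0)) w) := by
  have hTη : IsAltForm (fun u w => T (η u w)) :=
    ⟨fun u u' w => by rw [hη.add_left, map_add], fun c u w => by rw [hη.smul_left, map_smul],
      fun u w => by rw [hη.swap, map_neg]⟩
  have hH : IsAltForm (fun u w => η (u, 0) (w, 0)) :=
    ⟨fun u u' w => by rw [← hη.add_left]; simp, fun c u w => by rw [← hη.smul_left]; simp,
      fun u w => hη.swap _ _⟩
  -- the `dt`-component determines the restriction to the slice because `⋆⋆ = 1` and `T² = 1`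
  have hdt : ∀ w, hodge g (volDtX g) x (fun u w => T (η u w)) (0, 1) (w, 0) =
      T (star3 g x (fun u w => η (u, 0) (w, 0)) w) := fun w => by
    rw [hodge_dt g x hTη, star3_map T]
  constructor
  · intro h w
    rw [h, hdt]
  · intro h
    have hs : ∀ u w, η (u, 0) (w, 0) =
        hodge g (volDtX g) x (fun u w => T (η u w)) (u, 0) (w, 0) := fun u w => by
      rw [hodge_slice g x hTη]
      simp only [h, hT]
      exact (congrFun₂ (starOne_star3 g x hH) u w).symm
    have hd : ∀ w, η (0, 1) (w, 0) =
        hodge g (volDtX g) x (fun u w => T (η u w)) (0, 1) (w, 0) := fun w => by rw [h, hdt]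
    have hk := isAltForm_hodge g x (η := fun u w => T (η u w))
    have hsplit : ∀ u : E3 × ℝ, u = (u.1, 0) + u.2 • (0, 1) := fun u => by simp
    intro u w
    rw [hsplit u, hsplit w]
    simp only [hη.add_left, hη.add_right, hη.smul_left, hη.smul_right, hk.add_left, hk.add_right,
      hk.smul_left, hk.smul_right, hη.self, hk.self, hs, hd, hη.swap (0, 1) (_, 0),
      hk.swap (0, 1) (_, 0)]

end Cylinder

/-! ### Slices of forms on the cylinder -/

section Slices

variable {X : Type*} [TopologicalSpace X] [ChartedSpace E3 X] [IsManifold (𝓡 3) ∞ X]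
  {N : ℕ} {ι : Type*} {G : Subgroup (Matrix.unitaryGroup (Fin N) ℂ)} {P : GaugeBundle (𝓡 3) X G ι}
  {A φ : ι → OneForm (E3 × ℝ) (X × ℝ) N}

lemma extChartAt_cylinder_symm (p : X × ℝ) (z : E3 × ℝ) :
    (extChartAt I4 p).symm z = ((extChartAt (𝓡 3) p.1).symm z.1, z.2) := by
  rw [extChartAt_prod, extChartAt_model_space_eq_id]
  rfl

lemma extChartAt_cylinder (p q : X × ℝ) :
    extChartAt I4 p q = (extChartAt (𝓡 3) p.1 q.1, q.2) := by
  rw [extChartAt_prod, extChartAt_model_space_eq_id]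
  rfl

lemma mem_chartDomain_cylinder {U : Set X} {p : X × ℝ} {z : E3 × ℝ} :
    z ∈ chartDomain I4 p (Prod.fst ⁻¹' U) ↔ z.1 ∈ chartDomain (𝓡 3) p.1 U := by
  rw [chartDomain, chartDomain, mem_inter_iff, mem_inter_iff, mem_preimage, mem_preimage,
    mem_preimage, extChartAt_cylinder_symm, extChartAt_prod, extChartAt_model_space_eq_id]
  simp

/-- The coordinate vector fields of the cylinder are those of the three-manifold and `∂/∂t`. -/
lemma chartDeriv_cylinder {p : X × ℝ} {z : E3 × ℝ} (hz : z.1 ∈ (extChartAt (𝓡 3) p.1).target)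
    (u : E3) (r : ℝ) : chartDeriv I4 p z (u, r) = (chartDeriv (𝓡 3) p.1 z.1 u, r) := by
  have hz4 : z ∈ (extChartAt I4 p).target := by
    rw [extChartAt_prod, extChartAt_model_space_eq_id]
    simpa using hz
  have hq : z.1 ∈ chartDomain (𝓡 3) p.1
      (extChartAt (𝓡 3) ((extChartAt (𝓡 3) p.1).symm z.1)).source :=
    ⟨hz, mem_extChartAt_source _⟩
  rw [chartDeriv_eq_fderiv_transition hz4, chartDeriv_eq_fderiv_transition hz]
  have ht : transition I4 p ((extChartAt I4 p).symm z) =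
      Prod.map (transition (𝓡 3) p.1 ((extChartAt (𝓡 3) p.1).symm z.1)) id := by
    funext z'
    simp only [transition, Function.comp_apply, extChartAt_cylinder, extChartAt_cylinder_symm]
    rfl
  have hd : HasFDerivAt (transition (𝓡 3) p.1 ((extChartAt (𝓡 3) p.1).symm z.1)) _ z.1 :=
    ((contDiffAt_transition p.1 _ hq).differentiableAt (by simp)).hasFDerivAt
  rw [ht, (HasFDerivAt.prodMap z hd (hasFDerivAt_id z.2)).fderiv]
  rfl

lemma inChart_cylinder {α : OneForm (E3 × ℝ) (X × ℝ) N} {p : X × ℝ} {z : E3 × ℝ}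
    (hz : z.1 ∈ (extChartAt (𝓡 3) p.1).target) (u : E3) (r : ℝ) :
    inChart I4 p α z (u, r) =
      α ((extChartAt (𝓡 3) p.1).symm z.1, z.2) (chartDeriv (𝓡 3) p.1 z.1 u, r) := by
  rw [inChart_apply, chartDeriv_cylinder hz, extChartAt_cylinder_symm]

/-- The restriction to slices of the coordinate expression of a form on the cylinder. -/
lemma inChart_slice {p : X} {y : E3} (hy : y ∈ (extChartAt (𝓡 3) p).target) (i : ι) (t s : ℝ) :
    inChart (𝓡 3) p (slice A s i) y =
      (inChart I4 (p, t) (A i) (y, s)).comp (ContinuousLinearMap.inl ℝ E3 ℝ) := by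
  ext1 u
  exact (inChart_cylinder (p := (p, t)) (z := (y, s)) hy u 0).symm

section Deriv

variable {V F : Type*} [NormedAddCommGroup V] [NormedSpace ℝ V] [NormedAddCommGroup F]
  [NormedSpace ℝ F] {a : V × ℝ → V × ℝ →L[ℝ] F} {y : V} {t : ℝ}

lemma hasFDerivAt_slice (ha : DifferentiableAt ℝ a (y, t)) :
    HasFDerivAt (fun z => (a (z, t)).comp (ContinuousLinearMap.inl ℝ V ℝ))
      (((ContinuousLinearMap.compL ℝ V (V × ℝ) F).flip (ContinuousLinearMap.inl ℝ V ℝ)).comp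
        ((fderiv ℝ a (y, t)).comp (ContinuousLinearMap.inl ℝ V ℝ))) y :=
  (((ContinuousLinearMap.compL ℝ V (V × ℝ) F).flip
    (ContinuousLinearMap.inl ℝ V ℝ)).hasFDerivAt).comp y
      (ha.hasFDerivAt.comp y (hasFDerivAt_prodMk_left y t))

lemma hasDerivAt_slice (ha : DifferentiableAt ℝ a (y, t)) :
    HasDerivAt (fun s => (a (y, s)).comp (ContinuousLinearMap.inl ℝ V ℝ))
      ((fderiv ℝ a (y, t) (0, 1)).comp (ContinuousLinearMap.inl ℝ V ℝ)) t := by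
  have h1 : HasDerivAt (fun s : ℝ => (y, s)) ((0 : V), (1 : ℝ)) t :=
    (hasDerivAt_const t y).prodMk (hasDerivAt_id t)
  have h2 : HasDerivAt (fun s => a (y, s)) _ t :=
    HasFDerivAt.comp_hasDerivAt (f := fun s : ℝ => (y, s)) t ha.hasFDerivAt h1
  exact ((ContinuousLinearMap.compL ℝ V (V × ℝ) F).flip
    (ContinuousLinearMap.inl ℝ V ℝ)).hasFDerivAt.comp_hasDerivAt t h2

lemma contDiffAt_slice (ha : ContDiffAt ℝ ∞ a (y, t)) :
    ContDiffAt ℝ ∞ (fun z => (a (z, t)).comp (ContinuousLinearMap.inl ℝ V ℝ)) y :=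
  (ha.comp y (contDiffAt_id.prodMk contDiffAt_const)).clm_comp contDiffAt_const

lemma contDiffAt_slice_deriv (ha : ContDiffAt ℝ ∞ a (y, t)) :
    ContDiffAt ℝ ∞ (fun z => (fderiv ℝ a (z, t) (0, 1)).comp (ContinuousLinearMap.inl ℝ V ℝ)) y :=
  contDiffAt_slice (a := fun z => fderiv ℝ a z (0, 1))
    ((ha.fderiv_right (m := ∞) (by simp)).clm_apply contDiffAt_const)

end Deriv

lemma contDiffAt_inChart_cylinder (hA : ∀ i, SmoothOn I4 (P.cylinder.baseSet i) (A i)) {i : ι}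
    {p : X} {y : E3} (hy : y ∈ chartDomain (𝓡 3) p (P.baseSet i)) (t s : ℝ) :
    ContDiffAt ℝ ∞ (inChart I4 (p, t) (A i)) (y, s) :=
  (hA i).contDiffAt (P.cylinder.isOpen_baseSet i) (mem_chartDomain_cylinder.2 hy)

lemma smoothOn_slice (hA : ∀ i, SmoothOn I4 (P.cylinder.baseSet i) (A i)) (i : ι) (t : ℝ) :
    SmoothOn (𝓡 3) (P.baseSet i) (slice A t i) := by
  rw [smoothOn_iff (P.isOpen_baseSet i)]
  intro p y hy
  refine (contDiffAt_slice (contDiffAt_inChart_cylinder hA hy t t)).congr_of_eventuallyEq ?_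
  filter_upwards [(isOpen_extChartAt_target p).mem_nhds hy.1] with z hz
  exact inChart_slice hz i t t

/-- The velocity of the slices, in a chart. -/
lemma hasDerivAt_inChart_slice (hA : ∀ i, SmoothOn I4 (P.cylinder.baseSet i) (A i)) {i : ι}
    {p : X} {y : E3} (hy : y ∈ chartDomain (𝓡 3) p (P.baseSet i)) (t : ℝ) :
    HasDerivAt (fun s => inChart (𝓡 3) p (slice A s i) y)
      ((fderiv ℝ (inChart I4 (p, t) (A i)) (y, t) (0, 1)).comp
        (ContinuousLinearMap.inl ℝ E3 ℝ)) t := by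
  have h := hasDerivAt_slice
    ((contDiffAt_inChart_cylinder hA hy t t).differentiableAt (by simp))
  exact h.congr_of_eventuallyEq (Eventually.of_forall fun s => inChart_slice hy.1 i t s)

lemma inChart_self (α : OneForm E3 X N) (x : X) :
    inChart (𝓡 3) x α (extChartAt (𝓡 3) x x) = α x := by
  rw [inChart_eq, chartDeriv_self, extChartAt_to_inv]
  rfl

lemma hasDerivAt_deriv_clm {V 𝔸 : Type*} [NormedAddCommGroup V] [NormedSpace ℝ V] [NormedRing 𝔸]
    [NormedAlgebra ℝ 𝔸] {f : ℝ → V →L[ℝ] 𝔸} {f' : V →L[ℝ] 𝔸} {t : ℝ} (hf : HasDerivAt f f' t) :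
    HasDerivAt f (deriv f t) t := hf.differentiableAt.hasDerivAt

lemma hasDerivAt_sliceDeriv (hA : ∀ i, SmoothOn I4 (P.cylinder.baseSet i) (A i)) {i : ι} {x : X}
    (hx : x ∈ P.baseSet i) (t : ℝ) :
    HasDerivAt (fun s => slice A s i x) (sliceDeriv A t i x) t := by
  have h := hasDerivAt_inChart_slice hA (extChartAt_mem_chartDomain hx) t
  simp only [inChart_self] at h
  exact hasDerivAt_deriv_clm h

lemma inChart_sliceDeriv (hA : ∀ i, SmoothOn I4 (P.cylinder.baseSet i) (A i)) {i : ι}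
    {p : X} {y : E3} (hy : y ∈ chartDomain (𝓡 3) p (P.baseSet i)) (t : ℝ) :
    inChart (𝓡 3) p (sliceDeriv A t i) y =
      (fderiv ℝ (inChart I4 (p, t) (A i)) (y, t) (0, 1)).comp
        (ContinuousLinearMap.inl ℝ E3 ℝ) := by
  have h1 := (hasDerivAt_sliceDeriv hA hy.2 t).clm_comp
    (hasDerivAt_const t (chartDeriv (𝓡 3) p y))
  have h2 := h1.unique (hasDerivAt_inChart_slice hA hy t)
  rw [← h2]
  simp [inChart_eq]

lemma smoothOn_sliceDeriv (hA : ∀ i, SmoothOn I4 (P.cylinder.baseSet i) (A i)) (i : ι) (t : ℝ) :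
    SmoothOn (𝓡 3) (P.baseSet i) (sliceDeriv A t i) := by
  rw [smoothOn_iff (P.isOpen_baseSet i)]
  intro p y hy
  refine (contDiffAt_slice_deriv (contDiffAt_inChart_cylinder hA hy t t)).congr_of_eventuallyEq ?_
  filter_upwards [(isOpen_chartDomain p (P.isOpen_baseSet i)).mem_nhds hy] with z hz
  exact inChart_sliceDeriv hA hz t

lemma sliceDeriv_mem (hA : ∀ i, SmoothOn I4 (P.cylinder.baseSet i) (A i))
    (hmem : ∀ i, ∀ x ∈ P.cylinder.baseSet i, ∀ v, A i x v ∈ lieSubmodule G) (i : ι) {x : X}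
    (hx : x ∈ P.baseSet i) (t : ℝ) (v : E3) : sliceDeriv A t i x v ∈ lieSubmodule G := by
  have hy := extChartAt_mem_chartDomain (I := 𝓡 3) hx
  have h := congrArg (fun T : E3 →L[ℝ] Mat N => T v) (inChart_sliceDeriv hA hy t)
  rw [inChart_self] at h
  rw [h]
  refine fderiv_apply_mem ((contDiffAt_inChart_cylinder hA hy t t).differentiableAt (by simp))
    isClosed_lieSubmodule ?_ (0, 1) (v, 0)
  have hy4 : (extChartAt (𝓡 3) x x, t) ∈ chartDomain I4 (x, t) (P.cylinder.baseSet i) :=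
    mem_chartDomain_cylinder.2 hy
  filter_upwards [(isOpen_chartDomain (x, t) (P.cylinder.isOpen_baseSet i)).mem_nhds hy4]
    with z hz w
  exact hmem i _ hz.2 _

lemma hasDerivAt_conj_sub {V 𝔸 : Type*} [NormedAddCommGroup V] [NormedSpace ℝ V] [NormedRing 𝔸]
    [NormedAlgebra ℝ 𝔸] {f : ℝ → V →L[ℝ] 𝔸} {f' : V →L[ℝ] 𝔸} {t : ℝ} (hf : HasDerivAt f f' t)
    (v : V) (a b c : 𝔸) : HasDerivAt (fun s => a * f s v * b - c) (a * f' v * b) t := by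
  have h : HasDerivAt (fun s => f s v) (f' v) t := by
    simpa using hf.clm_apply (hasDerivAt_const t v)
  exact ((h.const_mul a).mul_const b).sub_const c

lemma hasDerivAt_clm_apply {V F : Type*} [NormedAddCommGroup V] [NormedSpace ℝ V]
    [NormedAddCommGroup F] [NormedSpace ℝ F] {f : ℝ → V →L[ℝ] F} {f' : V →L[ℝ] F} {t : ℝ}
    (hf : HasDerivAt f f' t) (v : V) : HasDerivAt (fun s => f s v) (f' v) t := by
  simpa using hf.clm_apply (hasDerivAt_const t v)

lemma differential_cylinder {i j : ι} {x : X} (hx : x ∈ P.baseSet i ∩ P.baseSet j) (t : ℝ)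
    (v : E3) : differential I4 (fun z => (P.cylinder.trans i j z : Mat N)) (x, t) (v, 0) =
      differential (𝓡 3) (fun z => (P.trans i j z : Mat N)) x v := by
  have h1 := ((P.trans_smooth i j).contMDiffAt
    ((GaugeBundle.isOpen_inter i j).mem_nhds hx)).mdifferentiableAt (by simp)
  have h := mfderiv_comp (x, t) (f := (Prod.fst : X × ℝ → X)) (I := I4) h1 mdifferentiableAt_fst
  rw [mfderiv_fst] at h
  exact congrArg (fun T : E3 × ℝ →L[ℝ] Mat N => T (v, 0)) h

lemma isConnection_slice (hA : P.cylinder.IsConnection A) (t : ℝ) :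
    P.IsConnection (slice A t) where
  smooth i := smoothOn_slice hA.smooth i t
  mem i x hx v := hA.mem i (x, t) hx (v, 0)
  change i j x hx v := by
    rw [← differential_cylinder hx t v]
    exact hA.change i j (x, t) hx (v, 0)

lemma isAdForm_slice (hφ : P.cylinder.IsAdForm φ) (t : ℝ) : P.IsAdForm (slice φ t) where
  smooth i := smoothOn_slice hφ.smooth i t
  mem i x hx v := hφ.mem i (x, t) hx (v, 0)
  change i j x hx v := hφ.change i j (x, t) hx (v, 0)

/-- The velocity of a path of connections is an adjoint valued 1-form. -/
lemma isAdForm_sliceDeriv_connection (hA : P.cylinder.IsConnection A) (t : ℝ) :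
    P.IsAdForm (sliceDeriv A t) where
  smooth i := smoothOn_sliceDeriv hA.smooth i t
  mem i x hx v := sliceDeriv_mem hA.smooth hA.mem i hx t v
  change i j x hx v := by
    have h1 := hasDerivAt_clm_apply (hasDerivAt_sliceDeriv hA.smooth hx.1 t) v
    have h2 := hasDerivAt_conj_sub (hasDerivAt_sliceDeriv hA.smooth hx.2 t) v
      (P.trans i j x : Mat N) ((P.trans i j x)⁻¹ : Matrix.unitaryGroup _ ℂ)
      (differential (𝓡 3) (fun z => (P.trans i j z : Mat N)) x v *
        ((P.trans i j x)⁻¹ : Matrix.unitaryGroup _ ℂ))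
    refine h1.unique (h2.congr_of_eventuallyEq (Eventually.of_forall fun s => ?_))
    exact (isConnection_slice hA s).change i j x hx v

/-- The velocity of a path of adjoint valued 1-forms is an adjoint valued 1-form. -/
lemma isAdForm_sliceDeriv (hφ : P.cylinder.IsAdForm φ) (t : ℝ) :
    P.IsAdForm (sliceDeriv φ t) where
  smooth i := smoothOn_sliceDeriv hφ.smooth i t
  mem i x hx v := sliceDeriv_mem hφ.smooth hφ.mem i hx t v
  change i j x hx v := by
    have h1 := hasDerivAt_clm_apply (hasDerivAt_sliceDeriv hφ.smooth hx.1 t) v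
    have h2 := hasDerivAt_conj_sub (hasDerivAt_sliceDeriv hφ.smooth hx.2 t) v
      (P.trans i j x : Mat N) ((P.trans i j x)⁻¹ : Matrix.unitaryGroup _ ℂ) 0
    refine h1.unique (h2.congr_of_eventuallyEq (Eventually.of_forall fun s => ?_))
    exact ((isAdForm_slice hφ s).change i j x hx v).trans (sub_zero _).symm

/-- The exterior derivative of a form on the cylinder, evaluated along a slice. -/
lemma extD_slice (hA : ∀ i, SmoothOn I4 (P.cylinder.baseSet i) (A i)) {i : ι} {x : X}
    (hx : x ∈ P.baseSet i) (t : ℝ) (u w : E3) :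
    extD I4 (A i) (x, t) (u, 0) (w, 0) = extD (𝓡 3) (slice A t i) x u w := by
  have hy := extChartAt_mem_chartDomain (I := 𝓡 3) hx
  have h := hasFDerivAt_slice
    ((contDiffAt_inChart_cylinder hA hy t t).differentiableAt (by simp))
  have h1 : HasFDerivAt (inChart (𝓡 3) x (slice A t i)) _ _ := h.congr_of_eventuallyEq (by
    filter_upwards [(isOpen_extChartAt_target x).mem_nhds hy.1] with z hz
    exact inChart_slice hz i t t)
  rw [extD, extD, h1.fderiv, extChartAt_cylinder]
  rfl

/-- For a form without `dt`-component, the exterior derivative in the direction of `∂/∂t` is the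
velocity of the slices. -/
lemma extD_dt (hA : ∀ i, SmoothOn I4 (P.cylinder.baseSet i) (A i))
    (hAt : ∀ i, ∀ x ∈ P.baseSet i, ∀ t : ℝ, A i (x, t) (0, 1) = 0) {i : ι} {x : X}
    (hx : x ∈ P.baseSet i) (t : ℝ) (w : E3) :
    extD I4 (A i) (x, t) (0, 1) (w, 0) = sliceDeriv A t i x w := by
  have hy := extChartAt_mem_chartDomain (I := 𝓡 3) hx
  have h := congrArg (fun T : E3 →L[ℝ] Mat N => T w) (inChart_sliceDeriv hA hy t)
  rw [inChart_self] at h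
  have hd := (contDiffAt_inChart_cylinder hA hy t t).differentiableAt (by simp)
  -- the `dt`-component vanishes near the point, hence so does its derivative
  have h0 : HasFDerivAt (fun z => inChart I4 (x, t) (A i) z (0, 1))
      (0 : E3 × ℝ →L[ℝ] Mat N) (extChartAt (𝓡 3) x x, t) := by
    refine (hasFDerivAt_const (0 : Mat N) _).congr_of_eventuallyEq ?_
    have hy4 : (extChartAt (𝓡 3) x x, t) ∈ chartDomain I4 (x, t) (P.cylinder.baseSet i) :=
      mem_chartDomain_cylinder.2 hy
    filter_upwards [(isOpen_chartDomain (x, t) (P.cylinder.isOpen_baseSet i)).mem_nhds hy4]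
      with z hz
    have hz3 := mem_chartDomain_cylinder.1 hz
    rw [inChart_cylinder hz3.1, map_zero]
    exact hAt i _ hz3.2 _
  have h1 := congrArg (fun T : E3 × ℝ →L[ℝ] Mat N => T (w, 0))
    ((hasFDerivAt_apply hd (0, 1)).unique h0)
  rw [extD, extChartAt_cylinder, h]
  exact (congrArg _ h1).trans (sub_zero _)

end Slices

/-! ### The Kapustin–Witten equations as a flow -/

section Algebra

variable {N : ℕ}

/-- A complex matrix is determined by its components in `𝔲(N) ⊕ i𝔲(N)`: they are recovered from the
matrix and its conjugate `Z ↦ -Zᴴ`. -/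
lemma eq_and_eq_of_skew {a p a' p' : Mat N} (ha : aᴴ = -a) (hp : pᴴ = -p) (ha' : a'ᴴ = -a')
    (hp' : p'ᴴ = -p') (h : a + Complex.I • p = a' + Complex.I • p') : a = a' ∧ p = p' := by
  have h2 := congrArg (fun Z : Mat N => -Zᴴ) h
  have hc : ∀ {b q : Mat N}, bᴴ = -b → qᴴ = -q → -(b + Complex.I • q)ᴴ = b - Complex.I • q :=
    fun hb hq => by
      rw [Matrix.conjTranspose_add, Matrix.conjTranspose_smul, hb, hq, Complex.star_def,
        Complex.conj_I]
      module
  have h2' := (hc ha hp).symm.trans (h2.trans (hc ha' hp'))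
  have h3 : a = a' := by
    have h4 : (2 : ℂ) • a = (2 : ℂ) • a' := by
      calc (2 : ℂ) • a = (a + Complex.I • p) + (a - Complex.I • p) := by module
        _ = (a' + Complex.I • p') + (a' - Complex.I • p') := by rw [h, h2']
        _ = _ := by module
    exact smul_right_injective _ two_ne_zero h4
  refine ⟨h3, ?_⟩
  rw [h3] at h
  exact smul_right_injective _ Complex.I_ne_zero (add_left_cancel h)

lemma conjTranspose_real_comb {r q : Mat N} (hr : rᴴ = -r) (hq : qᴴ = -q) (α β : ℝ) :
    (α • r + β • q)ᴴ = -(α • r + β • q) := by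
  rw [Matrix.conjTranspose_add, Matrix.conjTranspose_smul, Matrix.conjTranspose_smul, hr, hq]
  simp only [star_trivial, smul_neg, neg_add]

/-- The `dt`-component of the equation `e^{iθ} F = ± ⋆ conj (e^{iθ} F)`, solved for the
velocities. -/
lemma exp_smul_eq_iff {a p r q : Mat N} (ha : aᴴ = -a) (hp : pᴴ = -p) (hr : rᴴ = -r)
    (hq : qᴴ = -q) (θ c : ℝ) :
    Complex.exp (Complex.I * θ) • (a + Complex.I • p) =
        c • conjLie (Complex.exp (Complex.I * θ) • (r + Complex.I • q)) ↔
      a = -c • (Real.sin (2 * θ) • q - Real.cos (2 * θ) • r) ∧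
        p = -c • (Real.sin (2 * θ) • r + Real.cos (2 * θ) • q) := by
  have hE : Complex.exp (Complex.I * θ) * Complex.exp (-(Complex.I * θ)) = 1 := by
    rw [← Complex.exp_add, add_neg_cancel, Complex.exp_zero]
  have hstar : star (Complex.exp (Complex.I * θ)) = Complex.exp (-(Complex.I * θ)) := by
    rw [Complex.star_def, ← Complex.exp_conj]
    simp
  have hconj : conjLie (Complex.exp (Complex.I * θ) • (r + Complex.I • q)) =
      Complex.exp (-(Complex.I * θ)) • (r - Complex.I • q) := by
    rw [conjLie, Matrix.conjTranspose_smul, Matrix.conjTranspose_add, Matrix.conjTranspose_smul,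
      hr, hq, hstar, ← smul_neg]
    congr 1
    simp [sub_eq_add_neg, add_comm]
  have hexp : Complex.exp (-(Complex.I * θ)) * Complex.exp (-(Complex.I * θ)) =
      (Real.cos (2 * θ) : ℂ) - Complex.I * (Real.sin (2 * θ) : ℂ) := by
    rw [← Complex.exp_add, Complex.ofReal_cos, Complex.ofReal_sin]
    have : -(Complex.I * θ) + -(Complex.I * θ) = (-((2 * θ : ℝ) : ℂ)) * Complex.I := by
      push_cast; ring
    rw [this, Complex.exp_mul_I, Complex.cos_neg, Complex.sin_neg]
    ring
  have hcs : ∀ (s : ℝ) (Z : Mat N), s • Z = (s : ℂ) • Z := fun s Z => by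
    ext m n
    simp
  set a' : Mat N := (c * Real.cos (2 * θ)) • r + (-(c * Real.sin (2 * θ))) • q with ha'
  set p' : Mat N := (-(c * Real.sin (2 * θ))) • r + (-(c * Real.cos (2 * θ))) • q with hp'
  have h1 : a' = -c • (Real.sin (2 * θ) • q - Real.cos (2 * θ) • r) := by rw [ha']; module
  have h2 : p' = -c • (Real.sin (2 * θ) • r + Real.cos (2 * θ) • q) := by rw [hp']; module
  have hkey : a' + Complex.I • p' = (c : ℂ) • ((Complex.exp (-(Complex.I * θ)) *
      Complex.exp (-(Complex.I * θ))) • (r - Complex.I • q)) := by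
    rw [hexp, ha', hp']
    simp only [hcs]
    push_cast
    have hI : (Complex.I * Complex.I) • q = (-1 : ℂ) • q := by rw [Complex.I_mul_I]
    rw [← sub_eq_zero]
    calc _ = (-(c : ℂ) * Complex.sin (2 * θ)) • ((Complex.I * Complex.I) • q - (-1 : ℂ) • q) := by
          module
      _ = 0 := by rw [hI, sub_self, smul_zero]
  rw [← h1, ← h2, hconj]
  constructor
  · intro h
    refine eq_and_eq_of_skew ha hp (conjTranspose_real_comb hr hq _ _)
      (conjTranspose_real_comb hr hq _ _) ?_
    rw [hkey, mul_smul, smul_comm (c : ℂ), ← hcs, ← h, smul_smul, mul_comm, hE, one_smul]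
  · rintro ⟨rfl, rfl⟩
    rw [hkey, mul_smul, smul_comm (c : ℂ), smul_smul, hE, one_smul, hcs]

/-- The `dt`-components of the self-duality and anti-self-duality equations, solved for the
velocities by a rotation through the angle `θ`. -/
lemma rotation_eq_iff {V : Type*} [AddCommGroup V] [Module ℝ V] (a p r q : V) (θ c : ℝ) :
    (Real.cos θ • a - Real.sin θ • p = c • (Real.cos θ • r - Real.sin θ • q) ∧
        Real.sin θ • a + Real.cos θ • p = -c • (Real.sin θ • r + Real.cos θ • q)) ↔
      a = -c • (Real.sin (2 * θ) • q - Real.cos (2 * θ) • r) ∧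
        p = -c • (Real.sin (2 * θ) • r + Real.cos (2 * θ) • q) := by
  have hs := Real.sin_sq_add_cos_sq θ
  rw [Real.sin_two_mul, Real.cos_two_mul']
  constructor
  · rintro ⟨h1, h2⟩
    constructor
    · have : (Real.sin θ ^ 2 + Real.cos θ ^ 2) • a =
          Real.cos θ • (Real.cos θ • a - Real.sin θ • p) +
            Real.sin θ • (Real.sin θ • a + Real.cos θ • p) := by module
      rw [hs, one_smul, h1, h2] at this
      rw [this]
      module
    · have : (Real.sin θ ^ 2 + Real.cos θ ^ 2) • p =
          Real.cos θ • (Real.sin θ • a + Real.cos θ • p) -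
            Real.sin θ • (Real.cos θ • a - Real.sin θ • p) := by module
      rw [hs, one_smul, h1, h2] at this
      rw [this]
      module
  · rintro ⟨rfl, rfl⟩
    constructor
    · have : c • (Real.cos θ • r - Real.sin θ • q) =
        (Real.sin θ ^ 2 + Real.cos θ ^ 2) • (c • (Real.cos θ • r - Real.sin θ • q)) := by
          rw [hs, one_smul]
      rw [this]
      module
    · have : -c • (Real.sin θ • r + Real.cos θ • q) =
        (Real.sin θ ^ 2 + Real.cos θ ^ 2) • (-c • (Real.sin θ • r + Real.cos θ • q)) := by
          rw [hs, one_smul]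
      rw [this]
      module

end Algebra

section Flow

variable {X : Type*} [TopologicalSpace X] [ChartedSpace E3 X] [IsManifold (𝓡 3) ∞ X]
  {g : OrientedMetric X}
  {N : ℕ} {ι : Type*} {G : Subgroup (Matrix.unitaryGroup (Fin N) ℂ)} {P : GaugeBundle (𝓡 3) X G ι}
  {A φ : ι → OneForm (E3 × ℝ) (X × ℝ) N}

lemma star3_comb (x : X) (η η' : E3 → E3 → Mat N) (α β : ℝ) (w : E3) :
    star3 g x (fun u w => α • η u w + β • η' u w) w =
      α • star3 g x η w + β • star3 g x η' w := by
  have h : ∀ (γ : ℝ) (ζ : E3 → E3 → Mat N),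
      star3 g x (fun u w => γ • ζ u w) w = γ • star3 g x ζ w := fun γ ζ =>
    star3_map (LinearMap.lsmul ℝ (Mat N) γ) x ζ w
  rw [star3_add, _root_.add_apply, h, h]

/-- Multiplication by a complex number, as a real linear map. -/
noncomputable def mulC (N : ℕ) (z : ℂ) : Mat N →ₗ[ℝ] Mat N where
  toFun Z := z • Z
  map_add' := smul_add z
  map_smul' r Z := smul_comm z r Z

/-- Complex conjugation on `𝔤_ℂ` as a real linear map. -/
noncomputable def conjLieL (N : ℕ) : Mat N →ₗ[ℝ] Mat N where
  toFun := conjLie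
  map_add' Z W := by simp only [conjLie, Matrix.conjTranspose_add, neg_add]
  map_smul' r Z := by simp [conjLie, Matrix.conjTranspose_smul]

lemma curvRe_slice (hA : P.cylinder.IsConnection A) {i : ι} {x : X}
    (hx : x ∈ P.baseSet i) (t : ℝ) (u w : E3) :
    curvRe I4 (A i) (φ i) (x, t) (u, 0) (w, 0) =
      curvRe (𝓡 3) (slice A t i) (slice φ t i) x u w := by
  rw [curvRe, curvRe, curvature, curvature, extD_slice hA.smooth hx]
  rfl

lemma covD_slice (hφ : P.cylinder.IsAdForm φ) {i : ι} {x : X}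
    (hx : x ∈ P.baseSet i) (t : ℝ) (u w : E3) :
    covD I4 (A i) (φ i) (x, t) (u, 0) (w, 0) =
      covD (𝓡 3) (slice A t i) (slice φ t i) x u w := by
  rw [covD, covD, extD_slice hφ.smooth hx]
  rfl

lemma curvRe_dt (hA : P.cylinder.IsConnection A)
    (hAt : ∀ i, ∀ x ∈ P.baseSet i, ∀ t : ℝ, A i (x, t) (0, 1) = 0)
    (hφt : ∀ i, ∀ x ∈ P.baseSet i, ∀ t : ℝ, φ i (x, t) (0, 1) = 0) {i : ι} {x : X}
    (hx : x ∈ P.baseSet i) (t : ℝ) (w : E3) :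
    curvRe I4 (A i) (φ i) (x, t) (0, 1) (w, 0) = sliceDeriv A t i x w := by
  rw [curvRe, curvature, extD_dt hA.smooth hAt hx, hAt i x hx, hφt i x hx]
  simp

lemma covD_dt (hφ : P.cylinder.IsAdForm φ)
    (hAt : ∀ i, ∀ x ∈ P.baseSet i, ∀ t : ℝ, A i (x, t) (0, 1) = 0)
    (hφt : ∀ i, ∀ x ∈ P.baseSet i, ∀ t : ℝ, φ i (x, t) (0, 1) = 0) {i : ι} {x : X}
    (hx : x ∈ P.baseSet i) (t : ℝ) (w : E3) :
    covD I4 (A i) (φ i) (x, t) (0, 1) (w, 0) = sliceDeriv φ t i x w := by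
  rw [covD, wedgeBracket, extD_dt hφ.smooth hφt hx, hAt i x hx, hφt i x hx]
  simp

variable {vol₄ : X → (Fin 4 → E3 × ℝ) → ℝ}

/-- A change of the orientation by the sign `c` can be moved from the Hodge star to the values. -/
lemma hodge_eq_smul {c : ℝ} (hvol : ∀ x u, vol₄ x u = c * volDtX g x u) (x : X)
    (η : E3 × ℝ → E3 × ℝ → Mat N) (u w : E3 × ℝ) :
    hodge g vol₄ x η u w = hodge g (volDtX g) x (fun u w => c • η u w) u w := by
  simp only [hodge, hvol]
  refine congrArg _ (Finset.sum_congr rfl fun a _ => Finset.sum_congr rfl fun b _ =>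
    Finset.sum_congr rfl fun a' _ => Finset.sum_congr rfl fun b' _ => ?_)
  module

/-- The gradient flow equation for `Re (e^{2iθ} CS)` with the gradient made explicit: the velocity
is `-c` times the gradient, so that the flow descends for `c = 1` and ascends for `c = -1`. -/
def IsFlow (g : OrientedMetric X) (P : GaugeBundle (𝓡 3) X G ι) (c θ : ℝ)
    (A φ : ι → OneForm (E3 × ℝ) (X × ℝ) N) : Prop :=
  ∀ i, ∀ x ∈ P.baseSet i, ∀ t : ℝ, ∀ w,
    sliceDeriv A t i x w =
        -c • star3 g x (gradCurvA (𝓡 3) θ (slice A t i) (slice φ t i) x) w ∧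
      sliceDeriv φ t i x w =
        -c • star3 g x (gradCurvPhi (𝓡 3) θ (slice A t i) (slice φ t i) x) w

lemma star3_gradCurvA (θ : ℝ) (a b : OneForm E3 X N) (x : X) (w : E3) :
    star3 g x (gradCurvA (𝓡 3) θ a b x) w =
      Real.sin (2 * θ) • star3 g x (covD (𝓡 3) a b x) w -
        Real.cos (2 * θ) • star3 g x (curvRe (𝓡 3) a b x) w := by
  rw [sub_eq_add_neg, ← neg_smul, ← star3_comb]
  simp only [neg_smul, ← sub_eq_add_neg]
  rfl

lemma star3_gradCurvPhi (θ : ℝ) (a b : OneForm E3 X N) (x : X) (w : E3) :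
    star3 g x (gradCurvPhi (𝓡 3) θ a b x) w =
      Real.sin (2 * θ) • star3 g x (curvRe (𝓡 3) a b x) w +
        Real.cos (2 * θ) • star3 g x (covD (𝓡 3) a b x) w := by
  rw [← star3_comb]
  rfl

/-- The equation `e^{iθ} F_ℂ = ⋆ conj (e^{iθ} F_ℂ)` is the flow equation. -/
theorem isKW_iff_isFlow (hA : P.cylinder.IsConnection A) (hφ : P.cylinder.IsAdForm φ)
    (hAt : ∀ i, ∀ x ∈ P.baseSet i, ∀ t : ℝ, A i (x, t) (0, 1) = 0)
    (hφt : ∀ i, ∀ x ∈ P.baseSet i, ∀ t : ℝ, φ i (x, t) (0, 1) = 0)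
    {c : ℝ} (hc : c * c = 1) (hvol : ∀ x u, vol₄ x u = c * volDtX g x u)
    (θ : ℝ) : IsKW g P vol₄ θ A φ ↔ IsFlow g P c θ A φ := by
  refine forall_congr' fun i => forall₂_congr fun x hx => forall_congr' fun t => ?_
  have hF : ∀ u w, Complex.exp (Complex.I * θ) •
      curvature I4 (complexForm (A i) (φ i)) (x, t) u w = mulC N (Complex.exp (Complex.I * θ))
        (curvRe I4 (A i) (φ i) (x, t) u w +
          mulC N Complex.I (covD I4 (A i) (φ i) (x, t) u w)) := fun u w => by
    rw [curvature_complexForm (hA.smooth i) (hφ.smooth i) (P.cylinder.isOpen_baseSet i) hx]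
    rfl
  have halt : IsAltForm (fun u w => Complex.exp (Complex.I * θ) •
      curvature I4 (complexForm (A i) (φ i)) (x, t) u w) := (isAltForm_curvature _ _).smul _
  have hTT : ∀ Z : Mat N, (c • conjLieL N) ((c • conjLieL N) Z) = Z := fun Z => by
    rw [LinearMap.smul_apply, LinearMap.smul_apply, map_smul, smul_smul, hc, one_smul]
    change conjLie (conjLie Z) = Z
    simp [conjLie]
  have h := eq_hodge_iff g x halt (c • conjLieL N) hTT
  simp only [hodge_eq_smul hvol]
  refine h.trans (forall_congr' fun w => ?_)
  have hAs := isConnection_slice hA t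
  have hφs := isAdForm_slice hφ t
  have skR := conjTranspose_of_mem_lieSubmodule
    (star3_mem (g := g) (x := x) (curvRe_mem hAs hφs i x hx) w)
  have skQ := conjTranspose_of_mem_lieSubmodule
    (star3_mem (g := g) (x := x) (covD_mem hAs hφs i x hx) w)
  have ska := conjTranspose_of_mem_lieSubmodule
    ((isAdForm_sliceDeriv_connection hA t).mem i x hx w)
  have skp := conjTranspose_of_mem_lieSubmodule ((isAdForm_sliceDeriv hφ t).mem i x hx w)
  rw [star3_gradCurvA, star3_gradCurvPhi, ← exp_smul_eq_iff ska skp skR skQ]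
  simp only [hF, curvRe_dt hA hAt hφt hx, covD_dt hφ hAt hφt hx, curvRe_slice hA hx,
    covD_slice hφ hx]
  rw [star3_map (mulC N (Complex.exp (Complex.I * θ))), star3_add, _root_.add_apply,
    star3_map (mulC N Complex.I)]
  rfl

/-- The Kapustin–Witten system is the flow equation. -/
theorem isKWSystem_iff_isFlow (hA : P.cylinder.IsConnection A) (hφ : P.cylinder.IsAdForm φ)
    (hAt : ∀ i, ∀ x ∈ P.baseSet i, ∀ t : ℝ, A i (x, t) (0, 1) = 0)
    (hφt : ∀ i, ∀ x ∈ P.baseSet i, ∀ t : ℝ, φ i (x, t) (0, 1) = 0)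
    {c : ℝ} (hc : c * c = 1)
    (hvol : ∀ x u, vol₄ x u = c * volDtX g x u) (θ : ℝ) :
    IsKWSystem g P vol₄ θ A φ ↔ IsFlow g P c θ A φ := by
  refine forall_congr' fun i => forall₂_congr fun x hx => forall_congr' fun t => ?_
  have hR : IsAltForm (curvRe I4 (A i) (φ i) (x, t)) :=
    (isAltForm_curvature _ _).sub (isAltForm_commutator _)
  have hQ : IsAltForm (covD I4 (A i) (φ i) (x, t)) := isAltForm_covD _ _ _
  have hTT : ∀ Z : Mat N, (c • LinearMap.id (R := ℝ)) ((c • LinearMap.id (R := ℝ)) Z) = Z :=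
    fun Z => by simp [smul_smul, hc]
  have hTT' : ∀ Z : Mat N, (-c • LinearMap.id (R := ℝ)) ((-c • LinearMap.id (R := ℝ)) Z) = Z :=
    fun Z => by simp [smul_smul, hc]
  have h1 := eq_hodge_iff g x ((hR.real_smul (Real.cos θ)).sub (hQ.real_smul (Real.sin θ))) _ hTT
  have h2 := eq_hodge_iff g x ((hR.real_smul (Real.sin θ)).add (hQ.real_smul (Real.cos θ))) _ hTT'
  have hasd : ∀ (η : E3 × ℝ → E3 × ℝ → Mat N) u w, antiSelfDualPart g vol₄ x η u w = 0 ↔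
      η u w = hodge g (volDtX g) x (fun u w => (c • LinearMap.id (R := ℝ)) (η u w)) u w :=
    fun η u w => by
      rw [antiSelfDualPart, hodge_eq_smul hvol, smul_eq_zero_iff_right (by norm_num), sub_eq_zero]
      rfl
  -- vanishing of the self-dual part is an equation of the same kind with the opposite sign
  have hsd : ∀ (η : E3 × ℝ → E3 × ℝ → Mat N) u w, selfDualPart g vol₄ x η u w = 0 ↔
      η u w = hodge g (volDtX g) x (fun u w => (-c • LinearMap.id (R := ℝ)) (η u w)) u w :=
    fun η u w => by
      have hn : hodge g (volDtX g) x (fun u w => (-c • LinearMap.id (R := ℝ)) (η u w)) u w =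
          -hodge g (volDtX g) x (fun u w => c • η u w) u w := by
        simp only [hodge, ← smul_neg, ← Finset.sum_neg_distrib]
        refine congrArg _ (Finset.sum_congr rfl fun a _ => Finset.sum_congr rfl fun b _ =>
          Finset.sum_congr rfl fun a' _ => Finset.sum_congr rfl fun b' _ => ?_)
        rw [LinearMap.smul_apply, LinearMap.id_apply, neg_smul, smul_neg c]
      rw [selfDualPart, hodge_eq_smul hvol, smul_eq_zero_iff_right (by norm_num), hn,
        eq_neg_iff_add_eq_zero]
  have hsplit : ∀ {p q : E3 × ℝ → E3 × ℝ → Prop},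
      (∀ u w, p u w ∧ q u w) ↔ (∀ u w, p u w) ∧ ∀ u w, q u w := fun {p q} =>
    ⟨fun h => ⟨fun u w => (h u w).1, fun u w => (h u w).2⟩, fun h u w => ⟨h.1 u w, h.2 u w⟩⟩
  refine hsplit.trans ?_
  refine (and_congr ((forall₂_congr fun u w => hasd _ u w).trans h1)
    ((forall₂_congr fun u w => hsd _ u w).trans h2)).trans ?_
  rw [← forall_and]
  refine forall_congr' fun w => ?_
  simp only [curvRe_dt hA hAt hφt hx, covD_dt hφ hAt hφt hx, curvRe_slice hA hx,
    covD_slice hφ hx, sub_eq_add_neg, ← neg_smul, star3_comb]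
  simp only [star3_gradCurvA, star3_gradCurvPhi]
  rw [← rotation_eq_iff]
  simp only [neg_smul, ← sub_eq_add_neg, LinearMap.smul_apply, LinearMap.id_apply]

variable [T2Space X] [CompactSpace X] {A₀ : ι → OneForm E3 X N}

/-- The velocity being minus the gradient is the flow equation with the sign of `dt ∧ vol_X`. -/
lemma isDescendingFlow_iff (hA₀ : P.IsConnection A₀) (hA : P.cylinder.IsConnection A)
    (hφ : P.cylinder.IsAdForm φ) (θ : ℝ) :
    IsDescendingFlow g P (realCS g P A₀ θ) A φ ↔ IsFlow g P 1 θ A φ := by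
  have h := fun t => isGradient_iff (g := g) hA₀ (isConnection_slice hA t) (isAdForm_slice hφ t)
    (isAdForm_sliceDeriv_connection hA t).neg (isAdForm_sliceDeriv hφ t).neg θ
  simp only [IsDescendingFlow, h, IsFlow]
  refine ⟨fun h i x hx t w => ?_, fun h t i x hx => ?_⟩
  · obtain ⟨h1, h2⟩ := h t i x hx
    rw [← h1, ← h2]
    simp
  · constructor
    · ext1 w
      have := (h i x hx t w).1
      simp [this]
    · ext1 w
      have := (h i x hx t w).2
      simp [this]

/-- The velocity being the gradient is the flow equation with the sign of `vol_X ∧ dt`. -/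
lemma isAscendingFlow_iff (hA₀ : P.IsConnection A₀) (hA : P.cylinder.IsConnection A)
    (hφ : P.cylinder.IsAdForm φ) (θ : ℝ) :
    IsAscendingFlow g P (realCS g P A₀ θ) A φ ↔ IsFlow g P (-1) θ A φ := by
  have h := fun t => isGradient_iff (g := g) hA₀ (isConnection_slice hA t) (isAdForm_slice hφ t)
    (isAdForm_sliceDeriv_connection hA t) (isAdForm_sliceDeriv hφ t) θ
  simp only [IsAscendingFlow, h, IsFlow, neg_neg, one_smul]
  exact ⟨fun h i x hx t w => ⟨by rw [(h t i x hx).1], by rw [(h t i x hx).2]⟩,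
    fun h t i x hx => ⟨by ext1 w; exact (h i x hx t w).1, by ext1 w; exact (h i x hx t w).2⟩⟩

end Flow

end KapustinWitten

theorem mainTheorem6 {N : ℕ} {ι X : Type*} [TopologicalSpace X] [T2Space X] [CompactSpace X]
    [ChartedSpace KapustinWitten.E3 X] [IsManifold (𝓡 3) ∞ X]
    (g : KapustinWitten.OrientedMetric X)
    (G : Subgroup (Matrix.unitaryGroup (Fin N) ℂ))
    (hG : IsClosed (G : Set (Matrix.unitaryGroup (Fin N) ℂ)))
    (P : KapustinWitten.GaugeBundle (𝓡 3) X G ι)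
    (A₀ : ι → KapustinWitten.OneForm KapustinWitten.E3 X N) (hA₀ : P.IsConnection A₀)
    (θ : ℝ)
    (A φ : ι → KapustinWitten.OneForm (KapustinWitten.E3 × ℝ) (X × ℝ) N)
    (hA : P.cylinder.IsConnection A) (hφ : P.cylinder.IsAdForm φ)
    (hAt : ∀ i, ∀ x ∈ P.baseSet i, ∀ t : ℝ, A i (x, t) (0, 1) = 0)
    (hφt : ∀ i, ∀ x ∈ P.baseSet i, ∀ t : ℝ, φ i (x, t) (0, 1) = 0) :
    List.TFAE
      [KapustinWitten.IsDescendingFlow g P (KapustinWitten.realCS g P A₀ θ) A φ,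
        KapustinWitten.IsKW g P (KapustinWitten.volDtX g) θ A φ,
        KapustinWitten.IsKWSystem g P (KapustinWitten.volDtX g) θ A φ] ∧
    List.TFAE
      [KapustinWitten.IsAscendingFlow g P (KapustinWitten.realCS g P A₀ θ) A φ,
        KapustinWitten.IsKW g P (KapustinWitten.volXDt g) θ A φ,
        KapustinWitten.IsKWSystem g P (KapustinWitten.volXDt g) θ A φ] := by
  have hdt : ∀ x u, KapustinWitten.volDtX g x u = 1 * KapustinWitten.volDtX g x u :=
    fun x u => (one_mul _).symm
  have hxt : ∀ x u, KapustinWitten.volXDt g x u = -1 * KapustinWitten.volDtX g x u :=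
    fun x u => by rw [KapustinWitten.volXDt_eq, neg_one_mul]
  rw [KapustinWitten.isDescendingFlow_iff hA₀ hA hφ,
    KapustinWitten.isKW_iff_isFlow hA hφ hAt hφt (one_mul 1) hdt,
    KapustinWitten.isKWSystem_iff_isFlow hA hφ hAt hφt (one_mul 1) hdt,
    KapustinWitten.isAscendingFlow_iff hA₀ hA hφ,
    KapustinWitten.isKW_iff_isFlow hA hφ hAt hφt (by norm_num) hxt,
    KapustinWitten.isKWSystem_iff_isFlow hA hφ hAt hφt (by norm_num) hxt]
  simp
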